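/- **Conventions.** A (strict) double category $\mathcal C$ has a class of objects, a category $\mathcal M$ of m-morphisms $\rightarrowtail$ and a category $\mathcal E$ of e-morphisms $\hookrightarrow$ on these objects, and (mixed) squares with m-morphisms as horizontal and e-morphisms as vertical sides, composable horizontally and vertically. $\mathrm{Ar}_\circlearrowleft\mathcal M$ (resp. $\mathrm{Ar}_\circlearrowleft\mathcal E$) is the category of m-morphisms (resp. e-morphisms) and mixed squares. $\mathcal C$ has *shared isomorphisms* if the groupoids of isomorphisms of $\mathcal M$ and of $\mathcal E$ are identified, by the identity on objects, and a mixed boundary with two parallel isomorphisms bounds a (unique) square iff it commutes after these isomorphisms are read in the category of the other two sides. For a category $\mathcal A$, a class of good squares is a wide subcategory $\mathrm{Ar}_g\mathcal A$ of the arrow category $\mathrm{Ar}\,\mathcal A$; $\mathrm{Ar}_\triangle\mathcal A$ consists of the commutative squares from $A\to B$ to $A'\to B'$ with $A\to A'$ invertible, and $\mathrm{Ar}_\times\mathcal A$ of the pullback squares. A *g-CGW category* is a double category with shared isomorphisms, classes of good squares $\mathrm{Ar}_g\mathcal M$, $\mathrm{Ar}_g\mathcal E$ and equivalences of categories $k:\mathrm{Ar}_\circlearrowleft\mathcal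 E\to\mathrm{Ar}_g\mathcal M$, $c:\mathrm{Ar}_\circlearrowleft\mathcal M\to\mathrm{Ar}_g\mathcal E$, which commute with the codomain functors (so $k(g)$ is an m-morphism $B\backslash A\rightarrowtail B$ for $g:A\hookrightarrow B$, and $c(f)$ is an e-morphism $B/A\hookrightarrow B$ for $f:A\rightarrowtail B$), such that: (Z) some object $\varnothing$ is initial in both $\mathcal M$ and $\mathcal E$; (M) all m- and e-morphisms are monic; (G) $\mathrm{Ar}_\triangle\subseteq\mathrm{Ar}_g\subseteq\mathrm{Ar}_\times$ for $\mathcal M$ and for $\mathcal E$; (D) $k$ sends a mixed square into $\mathrm{Ar}_\triangle\mathcal M$ iff $c$ sends it into $\mathrm{Ar}_\triangle\mathcal E$ (the square is then called *distinguished*); (K) for every m-morphism $f:A\rightarrowtail B$ there is a distinguished square with top $\varnothing\rightarrowtail B/A$, left $\varnothing\hookrightarrow A$, right $c(f)$, bottom $f$, and for every e-morphism $g:A\hookrightarrow B$ one with top $\varnothing\rightarrowtail A$, left $\varnothing\hookrightarrow B\backslash A$, right $g$, bottom $k(g)$. A *★-pushout* of a span $C\leftarrow A\to B$ of m-morphisms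 (or of e-morphisms) is an initial object $B\star_A C$ of the category of good squares $(A,B,C,D)$ on the span, whose maps are the maps $D\to D'$ under $B$ and $C$. A *★-CGW category* is a g-CGW category such that: (GS) a square in $\mathcal M$ or in $\mathcal E$ is good in one direction iff it is good in the other; (★) if a span of m-morphisms or of e-morphisms admits a good square, then it has a ★-pushout, and the maps which a ★-pushout of m-morphisms induces on cokernels, $B/A\rightarrowtail (B\star_AC)/C$ and $C/A\rightarrowtail(B\star_AC)/B$, are isomorphisms, and dually for kernels of e-morphisms; (PO) every span of m-morphisms admits a good square; (PBL) if a horizontal composite boundary and its right-hand part bound mixed squares, then so does its left-hand part, and similarly for vertical composites; (POL) given a commutative diagram in $\mathcal M$ or in $\mathcal E$ whose left square is a ★-pushout and whose outer square is good, the right square is good. A *good cube* (in $\mathcal M$ or in $\mathcal E$) is a commutative cube from a face $(A,B,C,D)$ to a parallel face $(A',B',C',D')$ all of whose faces are good and for which the induced square from $B\star_AC\to B'\star_{A'}C'$ to $D\to D'$ is good. For a ★-CGW category $\mathcal C$ and a double category $\mathcal D$, let $\mathcal C^{\mathcal D}$ be the double category whose objects are all double functors $\mathcal D\to\mathcal C$;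 whose m-morphisms are the m-natural (i.e. horizontal natural) transformations whose naturality squares at m-morphisms of $\mathcal D$ are good; whose e-morphisms are the e-natural (i.e. vertical natural) transformations whose naturality squares at e-morphisms of $\mathcal D$ are good; and whose squares are all modifications between these. **Theorem.** Let $\mathcal C$ be a ★-CGW category and let $\mathcal D$ be any double category. Then the double category $\mathcal C^{\mathcal D}$ admits the structure of a ★-CGW category in which: 1. a commutative square of m-morphisms of $\mathcal C^{\mathcal D}$ is good iff, for every m-morphism $i\rightarrowtail j$ of $\mathcal D$, its component cube (from the component square at $i$ to the one at $j$) is a good cube in $\mathcal C$; dually, a commutative square of e-morphisms of $\mathcal C^{\mathcal D}$ is good iff its component cube at every e-morphism of $\mathcal D$ is a good cube; 2. the functors $k$ and $c$ (on objects and on morphisms) and the identification of m- with e-isomorphisms are given pointwise by those of $\mathcal C$; 3. ★-pushouts are pointwise: a square of m-morphisms (or of e-morphisms) of $\mathcal C^{\mathcal D}$ is a ★-pushout iff its component at every object $i$ of $\mathcal D$ is a ★-pushout in $\mathcal C$. -/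

import Mathlib

open CategoryTheory

namespace CGW

universe u v₁ v₂ w u' v₁' v₂' w'

/-! ## Double categories -/

/-- A (strict) double category: two categories (of m-morphisms and of e-morphisms) on the same
objects, and squares

```
  A  --f-->  B
  |          |
  a          b        α : Sq f a b f'     (f, f' m-morphisms, a, b e-morphisms)
  v          v
  A' --f'--> B'
```
which compose horizontally and vertically, associatively and unitally, subject to interchange.
The associativity and unit laws relate squares whose boundaries are only propositionally equal,
hence the heterogeneous equalities. -/
structure DoubleCat where
  Obj : Type u
  catM : Category.{v₁} Obj
  catE : Category.{v₂} Obj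
  Sq : ∀ {A B A' B' : Obj},
    catM.Hom A B → catE.Hom A A' → catE.Hom B B' → catM.Hom A' B' → Type w
  /-- The identity square on an e-morphism, for horizontal composition. -/
  hId : ∀ {A A' : Obj} (a : catE.Hom A A'), Sq (catM.id A) a a (catM.id A')
  /-- The identity square on an m-morphism, for vertical composition. -/
  vId : ∀ {A B : Obj} (f : catM.Hom A B), Sq f (catE.id A) (catE.id B) f
  hComp : ∀ {A B C A' B' C' : Obj} {f : catM.Hom A B} {g : catM.Hom B C}
    {a : catE.Hom A A'} {b : catE.Hom B B'} {c : catE.Hom C C'}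
    {f' : catM.Hom A' B'} {g' : catM.Hom B' C'},
    Sq f a b f' → Sq g b c g' → Sq (catM.comp f g) a c (catM.comp f' g')
  vComp : ∀ {A B A' B' A'' B'' : Obj} {f : catM.Hom A B} {f' : catM.Hom A' B'}
    {f'' : catM.Hom A'' B''} {a : catE.Hom A A'} {b : catE.Hom B B'}
    {a' : catE.Hom A' A''} {b' : catE.Hom B' B''},
    Sq f a b f' → Sq f' a' b' f'' → Sq f (catE.comp a a') (catE.comp b b') f''
  hId_hComp : ∀ {A B A' B' : Obj} {f : catM.Hom A B} {a : catE.Hom A A'} {b : catE.Hom B B'}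
    {f' : catM.Hom A' B'} (α : Sq f a b f'), HEq (hComp (hId a) α) α
  hComp_hId : ∀ {A B A' B' : Obj} {f : catM.Hom A B} {a : catE.Hom A A'} {b : catE.Hom B B'}
    {f' : catM.Hom A' B'} (α : Sq f a b f'), HEq (hComp α (hId b)) α
  vId_vComp : ∀ {A B A' B' : Obj} {f : catM.Hom A B} {a : catE.Hom A A'} {b : catE.Hom B B'}
    {f' : catM.Hom A' B'} (α : Sq f a b f'), HEq (vComp (vId f) α) α
  vComp_vId : ∀ {A B A' B' : Obj} {f : catM.Hom A B} {a : catE.Hom A A'} {b : catE.Hom B B'}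
    {f' : catM.Hom A' B'} (α : Sq f a b f'), HEq (vComp α (vId f')) α
  hAssoc : ∀ {A B C D A' B' C' D' : Obj}
    {f : catM.Hom A B} {g : catM.Hom B C} {h : catM.Hom C D}
    {a : catE.Hom A A'} {b : catE.Hom B B'} {c : catE.Hom C C'} {d : catE.Hom D D'}
    {f' : catM.Hom A' B'} {g' : catM.Hom B' C'} {h' : catM.Hom C' D'}
    (α : Sq f a b f') (β : Sq g b c g') (γ : Sq h c d h'),
    HEq (hComp (hComp α β) γ) (hComp α (hComp β γ))
  vAssoc : ∀ {A B A' B' A'' B'' A''' B''' : Obj}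
    {f : catM.Hom A B} {f' : catM.Hom A' B'} {f'' : catM.Hom A'' B''} {f''' : catM.Hom A''' B'''}
    {a : catE.Hom A A'} {b : catE.Hom B B'} {a' : catE.Hom A' A''} {b' : catE.Hom B' B''}
    {a'' : catE.Hom A'' A'''} {b'' : catE.Hom B'' B'''}
    (α : Sq f a b f') (β : Sq f' a' b' f'') (γ : Sq f'' a'' b'' f'''),
    HEq (vComp (vComp α β) γ) (vComp α (vComp β γ))
  interchange : ∀ {A B C A' B' C' A'' B'' C'' : Obj}
    {f : catM.Hom A B} {g : catM.Hom B C} {f' : catM.Hom A' B'} {g' : catM.Hom B' C'}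
    {f'' : catM.Hom A'' B''} {g'' : catM.Hom B'' C''}
    {a : catE.Hom A A'} {b : catE.Hom B B'} {c : catE.Hom C C'}
    {a' : catE.Hom A' A''} {b' : catE.Hom B' B''} {c' : catE.Hom C' C''}
    (α : Sq f a b f') (β : Sq g b c g') (γ : Sq f' a' b' f'') (δ : Sq g' b' c' g''),
    vComp (hComp α β) (hComp γ δ) = hComp (vComp α γ) (vComp β δ)
  hId_comp : ∀ {A A' A'' : Obj} (a : catE.Hom A A') (a' : catE.Hom A' A''),
    hId (catE.comp a a') = vComp (hId a) (hId a')
  vId_comp : ∀ {A B C : Obj} (f : catM.Hom A B) (g : catM.Hom B C),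
    vId (catM.comp f g) = hComp (vId f) (vId g)
  hId_id : ∀ A : Obj, hId (catE.id A) = vId (catM.id A)

namespace DoubleCat

/-- The transpose of a double category: m- and e-morphisms are exchanged. -/
def tr (C : DoubleCat.{u, v₁, v₂, w}) : DoubleCat.{u, v₂, v₁, w} where
  Obj := C.Obj
  catM := C.catE
  catE := C.catM
  Sq f a b f' := C.Sq a f f' b
  hId := C.vId
  vId := C.hId
  hComp := C.vComp
  vComp := C.hComp
  hId_hComp := C.vId_vComp
  hComp_hId := C.vComp_vId
  vId_vComp := C.hId_hComp
  vComp_vId := C.hComp_hId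
  hAssoc := C.vAssoc
  vAssoc := C.hAssoc
  interchange α β γ δ := (C.interchange α γ β δ).symm
  hId_comp := C.vId_comp
  vId_comp := C.hId_comp
  hId_id A := (C.hId_id A).symm

/-- The category of m-morphisms (its objects are wrapped copies of the objects of `C`). -/
@[ext]
structure M (C : DoubleCat.{u, v₁, v₂, w}) where
  obj : C.Obj

instance (C : DoubleCat.{u, v₁, v₂, w}) : Category.{v₁} C.M where
  Hom A B := C.catM.Hom A.obj B.obj
  id A := C.catM.id A.obj
  comp f g := C.catM.comp f g
  id_comp f := C.catM.id_comp f
  comp_id f := C.catM.comp_id f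
  assoc f g h := C.catM.assoc f g h

/-- The category of e-morphisms. -/
abbrev E (C : DoubleCat.{u, v₁, v₂, w}) : Type u := C.tr.M

/-- m-morphisms `A ⟶ B`. -/
abbrev HomM (C : DoubleCat.{u, v₁, v₂, w}) (A B : C.Obj) : Type v₁ := (⟨A⟩ : C.M) ⟶ ⟨B⟩

/-- e-morphisms `A ⟶ B`. -/
abbrev HomE (C : DoubleCat.{u, v₁, v₂, w}) (A B : C.Obj) : Type v₂ := (⟨A⟩ : C.E) ⟶ ⟨B⟩

/-- The identity m-morphism of `A`. -/
abbrev idM (C : DoubleCat.{u, v₁, v₂, w}) (A : C.Obj) : C.HomM A A := 𝟙 (⟨A⟩ : C.M)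

/-- The identity e-morphism of `A`. -/
abbrev idE (C : DoubleCat.{u, v₁, v₂, w}) (A : C.Obj) : C.HomE A A := 𝟙 (⟨A⟩ : C.E)

/-- m-isomorphisms `A ≅ B`. -/
abbrev IsoM (C : DoubleCat.{u, v₁, v₂, w}) (A B : C.Obj) : Type v₁ := (⟨A⟩ : C.M) ≅ ⟨B⟩

/-- e-isomorphisms `A ≅ B`. -/
abbrev IsoE (C : DoubleCat.{u, v₁, v₂, w}) (A B : C.Obj) : Type v₂ := (⟨A⟩ : C.E) ≅ ⟨B⟩

end DoubleCat

/-! ## The category of m-morphisms and squares -/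

/-- Objects of the category `Ar_↻ M`: the m-morphisms of `C`. (`Ar_↻ E` is `ArSq C.tr`.) -/
structure ArSq (C : DoubleCat.{u, v₁, v₂, w}) where
  left : C.Obj
  right : C.Obj
  hom : C.HomM left right

/-- Morphisms of `Ar_↻ M`: the squares of `C`. -/
@[ext]
structure ArSq.Hom {C : DoubleCat.{u, v₁, v₂, w}} (f f' : ArSq C) where
  left : C.HomE f.left f'.left
  right : C.HomE f.right f'.right
  sq : C.Sq f.hom left right f'.hom

instance (C : DoubleCat.{u, v₁, v₂, w}) : Category (ArSq C) where
  Hom f f' := ArSq.Hom f f'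
  id f := ⟨𝟙 _, 𝟙 _, C.vId f.hom⟩
  comp α β := ⟨α.left ≫ β.left, α.right ≫ β.right, C.vComp α.sq β.sq⟩
  id_comp α := ArSq.Hom.ext (Category.id_comp _) (Category.id_comp _) (C.vId_vComp α.sq)
  comp_id α := ArSq.Hom.ext (Category.comp_id _) (Category.comp_id _) (C.vComp_vId α.sq)
  assoc α β γ := ArSq.Hom.ext (Category.assoc _ _ _) (Category.assoc _ _ _)
    (C.vAssoc α.sq β.sq γ.sq)

/-! ## Shared isomorphisms -/

/-- Shared isomorphisms: the m-isomorphisms and the e-isomorphisms form the same groupoid on the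
objects of `C` (an identity-on-objects isomorphism between the groupoid of isomorphisms of `M` and
that of `E`), and a square with two parallel isomorphisms exists, uniquely, if and only if
it commutes after the isomorphisms are read in the category of the other two sides. -/
structure SharedIsos (C : DoubleCat.{u, v₁, v₂, w}) where
  equiv : ∀ {A B : C.Obj}, C.IsoM A B ≃ C.IsoE A B
  equiv_trans : ∀ {A B D : C.Obj} (f : C.IsoM A B) (g : C.IsoM B D),
    equiv (f ≪≫ g) = equiv f ≪≫ equiv g
  sq_iff_m : ∀ {A B A' B' : C.Obj} (f : C.IsoM A A') (f' : C.IsoM B B')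
    (g : C.HomM A B) (g' : C.HomM A' B'),
    Nonempty (C.Sq g (equiv f).hom (equiv f').hom g') ↔ g ≫ f'.hom = f.hom ≫ g'
  sq_unique_m : ∀ {A B A' B' : C.Obj} (f : C.IsoM A A') (f' : C.IsoM B B')
    (g : C.HomM A B) (g' : C.HomM A' B'),
    Subsingleton (C.Sq g (equiv f).hom (equiv f').hom g')
  sq_iff_e : ∀ {A B A' B' : C.Obj} (f : C.IsoM A A') (f' : C.IsoM B B')
    (g : C.HomE A B) (g' : C.HomE A' B'),
    Nonempty (C.Sq f.hom g g' f'.hom) ↔ g ≫ (equiv f').hom = (equiv f).hom ≫ g'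
  sq_unique_e : ∀ {A B A' B' : C.Obj} (f : C.IsoM A A') (f' : C.IsoM B B')
    (g : C.HomE A B) (g' : C.HomE A' B'),
    Subsingleton (C.Sq f.hom g g' f'.hom)

/-- The shared isomorphisms of the transpose. -/
def SharedIsos.tr {C : DoubleCat.{u, v₁, v₂, w}} (I : SharedIsos C) : SharedIsos C.tr where
  equiv {A B} := (I.equiv (A := A) (B := B)).symm
  equiv_trans {A B D} f g := by
    have h := I.equiv_trans (I.equiv.symm f) (I.equiv.symm g)
    rw [Equiv.apply_symm_apply, Equiv.apply_symm_apply] at h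
    exact (Equiv.symm_apply_eq _).2 h.symm
  sq_iff_m {A B A' B'} f f' g g' := by
    have h := I.sq_iff_e (I.equiv.symm f) (I.equiv.symm f') g g'
    rw [Equiv.apply_symm_apply, Equiv.apply_symm_apply] at h
    exact h
  sq_unique_m f f' g g' := I.sq_unique_e (I.equiv.symm f) (I.equiv.symm f') g g'
  sq_iff_e f f' g g' := by
    have h := I.sq_iff_m (I.equiv.symm f) (I.equiv.symm f') g g'
    rw [Equiv.apply_symm_apply, Equiv.apply_symm_apply] at h
    exact h
  sq_unique_e f f' g g' := by
    have h := I.sq_unique_m (I.equiv.symm f) (I.equiv.symm f') g g'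
    rw [Equiv.apply_symm_apply, Equiv.apply_symm_apply] at h
    exact h

/-! ## Good squares and ★-pushouts -/

section Good

variable {X : Type u} [Category.{v₁} X]

/-- Weak triangles: the commutative squares, as morphisms from `f : A ⟶ B` to `f' : A' ⟶ B'`,
for which `A ⟶ A'` is an isomorphism. -/
def weakTriangles (X : Type u) [Category.{v₁} X] : MorphismProperty (Arrow X) :=
  fun _ _ φ => IsIso φ.left

/-- The commutative squares that are pullback squares. -/
def pullbackSquares (X : Type u) [Category.{v₁} X] : MorphismProperty (Arrow X) :=
  fun f f' φ => IsPullback φ.left f.hom f'.hom φ.right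

/-- The square with top `f`, left `g`, right `p` and bottom `q` commutes, and it is good
as a morphism from `f` to `q` in the arrow category. -/
def GoodSq (W : MorphismProperty (Arrow X)) {A B C D : X}
    (f : A ⟶ B) (g : A ⟶ C) (p : B ⟶ D) (q : C ⟶ D) : Prop :=
  ∃ h : g ≫ q = f ≫ p, W (Arrow.homMk g p h : Arrow.mk f ⟶ Arrow.mk q)

/-- `D`, with `p : B ⟶ D` and `q : C ⟶ D`, is a ★-pushout of `C ⟵ A ⟶ B`: it is an initial object
of the category of good squares on this span, whose morphisms are the maps under `B` and `C`. -/
structure IsStarPushout (W : MorphismProperty (Arrow X)) {A B C D : X}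
    (f : A ⟶ B) (g : A ⟶ C) (p : B ⟶ D) (q : C ⟶ D) : Prop where
  good : GoodSq W f g p q
  desc : ∀ {D' : X} (p' : B ⟶ D') (q' : C ⟶ D'), GoodSq W f g p' q' →
    ∃! d : D ⟶ D', p ≫ d = p' ∧ q ≫ d = q'

/-- A cube with left face `(f, g, p, q)` on `A, B, C, D`, right face `(f', g', p', q')` on
`A', B', C', D'` and connecting maps `a, b, c, d` is good: its six faces are good, and so is its
southern square
```
  B ★_A C ----> B' ★_A' C'
     |              |
     v              v
     D ----------> D'
```
-/
structure IsGoodCube (W : MorphismProperty (Arrow X)) {A B C D A' B' C' D' : X}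
    (f : A ⟶ B) (g : A ⟶ C) (p : B ⟶ D) (q : C ⟶ D)
    (f' : A' ⟶ B') (g' : A' ⟶ C') (p' : B' ⟶ D') (q' : C' ⟶ D')
    (a : A ⟶ A') (b : B ⟶ B') (c : C ⟶ C') (d : D ⟶ D') : Prop where
  face_left : GoodSq W f g p q
  face_right : GoodSq W f' g' p' q'
  face_f : GoodSq W f a b f'
  face_g : GoodSq W g a c g'
  face_p : GoodSq W p b d p'
  face_q : GoodSq W q c d q'
  southern : ∃ (P P' : X) (s : B ⟶ P) (t : C ⟶ P) (s' : B' ⟶ P') (t' : C' ⟶ P')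
    (x : P ⟶ D) (x' : P' ⟶ D') (r : P ⟶ P'),
    IsStarPushout W f g s t ∧ IsStarPushout W f' g' s' t' ∧
    s ≫ x = p ∧ t ≫ x = q ∧ s' ≫ x' = p' ∧ t' ≫ x' = q' ∧
    s ≫ r = b ≫ s' ∧ t ≫ r = c ≫ t' ∧ GoodSq W r x x' d

end Good

/-! ## g-CGW categories -/

/-- A functor `c : Ar_↻ M ⥤ Ar_g E` over the codomain functors to `E`: it sends an m-morphism
`f : A ⟶ B` to an e-morphism `c(f) : B/A ⟶ B` with the same codomain, and a square with
e-morphisms `a : A ⟶ A'`, `b : B ⟶ B'` as sides to a good square whose second side is `b`.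
(`CokernelData C.tr W` is then the data of a functor `k : Ar_↻ E ⥤ Ar_g M`.) -/
structure CokernelData (C : DoubleCat.{u, v₁, v₂, w}) (W : MorphismProperty (Arrow C.E)) where
  obj : ∀ {A B : C.Obj}, C.HomM A B → C.Obj
  hom : ∀ {A B : C.Obj} (f : C.HomM A B), C.HomE (obj f) B
  sqMap : ∀ {A B A' B' : C.Obj} {f : C.HomM A B} {a : C.HomE A A'} {b : C.HomE B B'}
    {f' : C.HomM A' B'}, C.Sq f a b f' → C.HomE (obj f) (obj f')
  sqMap_comm : ∀ {A B A' B' : C.Obj} {f : C.HomM A B} {a : C.HomE A A'} {b : C.HomE B B'}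
    {f' : C.HomM A' B'} (α : C.Sq f a b f'), sqMap α ≫ hom f' = hom f ≫ b
  sqMap_good : ∀ {A B A' B' : C.Obj} {f : C.HomM A B} {a : C.HomE A A'} {b : C.HomE B B'}
    {f' : C.HomM A' B'} (α : C.Sq f a b f'),
    W (Arrow.homMk (sqMap α) b (sqMap_comm α) : Arrow.mk (hom f) ⟶ Arrow.mk (hom f'))
  sqMap_id : ∀ {A B : C.Obj} (f : C.HomM A B), sqMap (C.vId f) = C.idE (obj f)
  sqMap_comp : ∀ {A B A' B' A'' B'' : C.Obj} {f : C.HomM A B} {f' : C.HomM A' B'}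
    {f'' : C.HomM A'' B''} {a : C.HomE A A'} {b : C.HomE B B'}
    {a' : C.HomE A' A''} {b' : C.HomE B' B''} (α : C.Sq f a b f') (β : C.Sq f' a' b' f''),
    sqMap (C.vComp α β) = sqMap α ≫ sqMap β

/-- The functor `Ar_↻ M ⥤ Ar_g E` given by a `CokernelData`. -/
def CokernelData.functor {C : DoubleCat.{u, v₁, v₂, w}} {W : MorphismProperty (Arrow C.E)}
    [W.IsMultiplicative] (c : CokernelData C W) : ArSq C ⥤ WideSubcategory W where
  obj f := ⟨Arrow.mk (c.hom f.hom)⟩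
  map α := ⟨Arrow.homMk (c.sqMap α.sq) α.right (c.sqMap_comm α.sq), c.sqMap_good α.sq⟩
  map_id f := by
    apply WideSubcategory.hom_ext
    apply Arrow.hom_ext
    · exact c.sqMap_id f.hom
    · rfl
  map_comp α β := by
    apply WideSubcategory.hom_ext
    apply Arrow.hom_ext
    · exact c.sqMap_comp α.sq β.sq
    · rfl

/-- The data of a g-CGW category: shared isomorphisms, an object `∅`, classes of good squares
(wide subcategories of the arrow categories of `M` and `E`), and functors
`c : Ar_↻ M ⥤ Ar_g E` and `k : Ar_↻ E ⥤ Ar_g M`. -/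
structure GCGWData (C : DoubleCat.{u, v₁, v₂, w}) where
  isos : SharedIsos C
  zero : C.Obj
  goodM : MorphismProperty (Arrow C.M)
  goodE : MorphismProperty (Arrow C.E)
  goodM_mult : goodM.IsMultiplicative
  goodE_mult : goodE.IsMultiplicative
  c : CokernelData C goodE
  k : CokernelData C.tr goodM

namespace GCGWData

variable {C : DoubleCat.{u, v₁, v₂, w}}

instance (S : GCGWData C) : S.goodM.IsMultiplicative := S.goodM_mult

instance (S : GCGWData C) : S.goodE.IsMultiplicative := S.goodE_mult

/-- The same data with m- and e-morphisms exchanged. -/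
def tr (S : GCGWData C) : GCGWData C.tr where
  isos := S.isos.tr
  zero := S.zero
  goodM := S.goodE
  goodE := S.goodM
  goodM_mult := S.goodE_mult
  goodE_mult := S.goodM_mult
  c := S.k
  k := S.c

/-- A square is distinguished if `c` sends it to a weak triangle. -/
def Distinguished (S : GCGWData C) {A B A' B' : C.Obj} {f : C.HomM A B} {a : C.HomE A A'}
    {b : C.HomE B B'} {f' : C.HomM A' B'} (α : C.Sq f a b f') : Prop :=
  IsIso (S.c.sqMap α)

/-- The kernel object `B \ A` of an e-morphism `A ⟶ B`. -/
abbrev kerObj (S : GCGWData C) {A B : C.Obj} (a : C.HomE A B) : C.Obj := S.k.obj a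

/-- The kernel `k(a) : B \ A ⟶ B` of an e-morphism `a : A ⟶ B`. -/
abbrev kerHom (S : GCGWData C) {A B : C.Obj} (a : C.HomE A B) : C.HomM (S.kerObj a) B :=
  S.k.hom a

/-- The m-morphism that a square induces between the kernels of its e-sides. -/
abbrev kerMap (S : GCGWData C) {A B A' B' : C.Obj} {f : C.HomM A B} {a : C.HomE A A'}
    {b : C.HomE B B'} {f' : C.HomM A' B'} (α : C.Sq f a b f') :
    C.HomM (S.kerObj a) (S.kerObj b) :=
  S.k.sqMap (f := a) (a := f) (b := f') (f' := b) α

/-- One half of the axioms of a g-CGW category; the other half is the same for `S.tr`. -/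
structure GCGWHalf (S : GCGWData C) : Prop where
  /-- `c : Ar_↻ M ⥤ Ar_g E` is an equivalence of categories. -/
  c_equivalence : S.c.functor.IsEquivalence
  /-- (Z) -/
  zero_initial : Nonempty (Limits.IsInitial (⟨S.zero⟩ : C.M))
  /-- (M) -/
  mono : ∀ {A B : C.Obj} (f : C.HomM A B), Mono f
  /-- (G) -/
  weakTriangles_le : weakTriangles C.M ≤ S.goodM
  le_pullbackSquares : S.goodM ≤ pullbackSquares C.M
  /-- (D): `c` sends a square to a weak triangle if and only if `k` does. -/
  distinguished_iff : ∀ {A B A' B' : C.Obj} {f : C.HomM A B} {a : C.HomE A A'}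
    {b : C.HomE B B'} {f' : C.HomM A' B'} (α : C.Sq f a b f'),
    S.Distinguished α ↔ S.tr.Distinguished (A := A) (B := A') (A' := B) (B' := B') α
  /-- (K): for `f : A ⟶ B` there is a distinguished square with top `∅ ⟶ B/A`, left side `∅ ⟶ A`,
  right side `c(f)` and bottom `f`. -/
  cokernel_sq : ∀ {A B : C.Obj} (f : C.HomM A B),
    ∃ (t : C.HomM S.zero (S.c.obj f)) (l : C.HomE S.zero A) (α : C.Sq t l (S.c.hom f) f),
      S.Distinguished α

/-- The axioms of a g-CGW category. -/
structure IsGCGW (S : GCGWData C) : Prop where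
  m : S.GCGWHalf
  e : S.tr.GCGWHalf

/-- One half of the axioms, other than (PO), that make a g-CGW category a ★-CGW category;
the other half is the same for `S.tr`. -/
structure StarHalf (S : GCGWData C) : Prop where
  /-- (GS) -/
  good_symm : ∀ {A B A' B' : C.Obj} (f : C.HomM A B) (g : C.HomM A A') (h : C.HomM B B')
    (k : C.HomM A' B'), GoodSq S.goodM f g h k ↔ GoodSq S.goodM g f k h
  /-- (★), existence -/
  star_exists : ∀ {A B A' : C.Obj} (f : C.HomM A B) (g : C.HomM A A'),
    (∃ (D : C.Obj) (p : C.HomM B D) (q : C.HomM A' D), GoodSq S.goodM f g p q) →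
    ∃ (D : C.Obj) (p : C.HomM B D) (q : C.HomM A' D), IsStarPushout S.goodM f g p q
  /-- (★), the induced maps on cokernels `B/A ⟶ (B ★_A A')/A'` and `A'/A ⟶ (B ★_A A')/B`
  are isomorphisms -/
  star_cokernel : ∀ {A B A' D : C.Obj} (f : C.HomM A B) (g : C.HomM A A') (p : C.HomM B D)
    (q : C.HomM A' D), IsStarPushout S.goodM f g p q →
    (∃ x : C.HomM (S.c.obj f) (S.c.obj q),
      IsIso x ∧ Nonempty (C.Sq x (S.c.hom f) (S.c.hom q) p)) ∧
    (∃ x : C.HomM (S.c.obj g) (S.c.obj p),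
      IsIso x ∧ Nonempty (C.Sq x (S.c.hom g) (S.c.hom p) q))
  /-- (PBL) -/
  pullback_lemma : ∀ {A B D A' B' D' : C.Obj} (f : C.HomM A B) (g : C.HomM B D)
    (a : C.HomE A A') (b : C.HomE B B') (d : C.HomE D D') (f' : C.HomM A' B')
    (g' : C.HomM B' D'), Nonempty (C.Sq g b d g') → 
    Nonempty (C.Sq (f ≫ g : C.HomM A D) a d (f' ≫ g' : C.HomM A' D')) →
    Nonempty (C.Sq f a b f')
  /-- (POL) -/
  pushout_lemma : ∀ {A B A' P D D' : C.Obj} (f : C.HomM A B) (g : C.HomM A A') (p : C.HomM B P)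
    (q : C.HomM A' P) (d : C.HomM B D) (e : C.HomM P D') (h : C.HomM D D'),
    IsStarPushout S.goodM f g p q → d ≫ h = p ≫ e → GoodSq S.goodM (f ≫ d) g h (q ≫ e) →
    GoodSq S.goodM d p h e

end GCGWData

/-- The structure of a ★-CGW category on a double category. -/
structure StarCGW (C : DoubleCat.{u, v₁, v₂, w}) extends GCGWData C where
  gcgw : toGCGWData.IsGCGW
  star_m : toGCGWData.StarHalf
  star_e : toGCGWData.tr.StarHalf
  /-- (PO), for m-morphisms only -/
  pushout_exists : ∀ {A B A' : C.Obj} (f : C.HomM A B) (g : C.HomM A A'),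
    ∃ (D : C.Obj) (p : C.HomM B D) (q : C.HomM A' D), GoodSq goodM f g p q

/-! ## Double functors, natural transformations, modifications -/

/-- Double functors. -/
structure DoubleFunctor (D : DoubleCat.{u', v₁', v₂', w'}) (C : DoubleCat.{u, v₁, v₂, w}) where
  obj : D.Obj → C.Obj
  mapM : ∀ {A B : D.Obj}, D.HomM A B → C.HomM (obj A) (obj B)
  mapE : ∀ {A B : D.Obj}, D.HomE A B → C.HomE (obj A) (obj B)
  mapSq : ∀ {A B A' B' : D.Obj} {f : D.HomM A B} {a : D.HomE A A'} {b : D.HomE B B'}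
    {f' : D.HomM A' B'}, D.Sq f a b f' → C.Sq (mapM f) (mapE a) (mapE b) (mapM f')
  mapM_id : ∀ A : D.Obj, mapM (D.idM A) = C.idM (obj A)
  mapE_id : ∀ A : D.Obj, mapE (D.idE A) = C.idE (obj A)
  mapM_comp : ∀ {X Y Z : D.Obj} (f : D.HomM X Y) (g : D.HomM Y Z),
    mapM (f ≫ g) = mapM f ≫ mapM g
  mapE_comp : ∀ {X Y Z : D.Obj} (f : D.HomE X Y) (g : D.HomE Y Z),
    mapE (f ≫ g) = mapE f ≫ mapE g
  mapSq_hId : ∀ {A A' : D.Obj} (a : D.HomE A A'), HEq (mapSq (D.hId a)) (C.hId (mapE a))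
  mapSq_vId : ∀ {A B : D.Obj} (f : D.HomM A B), HEq (mapSq (D.vId f)) (C.vId (mapM f))
  mapSq_hComp : ∀ {X Y Z X' Y' Z' : D.Obj} {f : D.HomM X Y} {g : D.HomM Y Z}
    {a : D.HomE X X'} {b : D.HomE Y Y'} {c : D.HomE Z Z'} {f' : D.HomM X' Y'}
    {g' : D.HomM Y' Z'} (α : D.Sq f a b f') (β : D.Sq g b c g'),
    HEq (mapSq (D.hComp α β)) (C.hComp (mapSq α) (mapSq β))
  mapSq_vComp : ∀ {X Y X' Y' X'' Y'' : D.Obj} {f : D.HomM X Y} {f' : D.HomM X' Y'}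
    {f'' : D.HomM X'' Y''} {a : D.HomE X X'} {b : D.HomE Y Y'} {a' : D.HomE X' X''}
    {b' : D.HomE Y' Y''} (α : D.Sq f a b f') (β : D.Sq f' a' b' f''),
    HEq (mapSq (D.vComp α β)) (C.vComp (mapSq α) (mapSq β))

/-- The transpose of a double functor. -/
def DoubleFunctor.tr {D : DoubleCat.{u', v₁', v₂', w'}} {C : DoubleCat.{u, v₁, v₂, w}}
    (F : DoubleFunctor D C) : DoubleFunctor D.tr C.tr where
  obj := F.obj
  mapM := F.mapE
  mapE := F.mapM
  mapSq := F.mapSq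
  mapM_id := F.mapE_id
  mapE_id := F.mapM_id
  mapM_comp := F.mapE_comp
  mapE_comp := F.mapM_comp
  mapSq_hId := F.mapSq_vId
  mapSq_vId := F.mapSq_hId
  mapSq_hComp := F.mapSq_vComp
  mapSq_vComp := F.mapSq_hComp

section Transformations

variable {D : DoubleCat.{u', v₁', v₂', w'}} {C : DoubleCat.{u, v₁, v₂, w}}

/-- m-natural transformations `F ⟶ G`. -/
structure MNatTrans (F G : DoubleFunctor D C) where
  app : ∀ A : D.Obj, C.HomM (F.obj A) (G.obj A)
  sq : ∀ {A A' : D.Obj} (a : D.HomE A A'), C.Sq (app A) (F.mapE a) (G.mapE a) (app A')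
  sq_id : ∀ A : D.Obj, HEq (sq (D.idE A)) (C.vId (app A))
  sq_comp : ∀ {X Y Z : D.Obj} (a : D.HomE X Y) (a' : D.HomE Y Z),
    HEq (sq (a ≫ a')) (C.vComp (sq a) (sq a'))
  naturality : ∀ {A B : D.Obj} (f : D.HomM A B), F.mapM f ≫ app B = app A ≫ G.mapM f
  naturality_sq : ∀ {A B A' B' : D.Obj} {f : D.HomM A B} {a : D.HomE A A'} {b : D.HomE B B'}
    {f' : D.HomM A' B'} (α : D.Sq f a b f'),
    HEq (C.hComp (F.mapSq α) (sq b)) (C.hComp (sq a) (G.mapSq α))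

/-- e-natural transformations `F ⟶ G`: the m-natural transformations of the transposes. -/
abbrev ENatTrans (F G : DoubleFunctor D C) := MNatTrans F.tr G.tr

/-- The component at `A` of an e-natural transformation, as an e-morphism of `C`. -/
abbrev ENatTrans.appE {F G : DoubleFunctor D C} (η : ENatTrans F G) (A : D.Obj) :
    C.HomE (F.obj A) (G.obj A) := MNatTrans.app η A

/-- The component at an m-morphism `f : A ⟶ B` of an e-natural transformation, as a square
of `C`. -/
abbrev ENatTrans.sqE {F G : DoubleFunctor D C} (η : ENatTrans F G) {A B : D.Obj}
    (f : D.HomM A B) : C.Sq (F.mapM f) (η.appE A) (η.appE B) (G.mapM f) :=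
  MNatTrans.sq η f

/-- Modifications
```
  F  --μ-->  G
  |          |
  η          η'
  v          v
  F' --μ'--> G'
```
-/
structure Modification {F G F' G' : DoubleFunctor D C} (μ : MNatTrans F G) (η : ENatTrans F F')
    (η' : ENatTrans G G') (μ' : MNatTrans F' G') where
  app : ∀ A : D.Obj, C.Sq (μ.app A) (η.appE A) (η'.appE A) (μ'.app A)
  coherence_m : ∀ {A B : D.Obj} (f : D.HomM A B),
    HEq (C.hComp (η.sqE f) (app B)) (C.hComp (app A) (η'.sqE f))
  coherence_e : ∀ {A A' : D.Obj} (a : D.HomE A A'),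
    HEq (C.vComp (μ.sq a) (app A')) (C.vComp (app A) (μ'.sq a))

/-- An m-natural transformation is good (for a class of good squares in `M`) if its naturality
squares at m-morphisms are good. -/
def MNatTrans.IsGood (W : MorphismProperty (Arrow C.M)) {F G : DoubleFunctor D C}
    (μ : MNatTrans F G) : Prop :=
  ∀ {A B : D.Obj} (f : D.HomM A B), GoodSq W (F.mapM f) (μ.app A) (μ.app B) (G.mapM f)

end Transformations

/-! ## The double category `C^D` -/

section FunctorDoubleCat

variable {D : DoubleCat.{u', v₁', v₂', w'}} {C : DoubleCat.{u, v₁, v₂, w}}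

/-- In a g-CGW category, a square is determined by its boundary. -/
theorem GCGWData.IsGCGW.sq_subsingleton {S : GCGWData C} (hS : S.IsGCGW) {A B A' B' : C.Obj}
    (f : C.HomM A B) (a : C.HomE A A') (b : C.HomE B B') (f' : C.HomM A' B') :
    Subsingleton (C.Sq f a b f') := by
  refine ⟨fun α β => ?_⟩
  have := hS.m.c_equivalence
  let x : ArSq C := ⟨A, B, f⟩
  let y : ArSq C := ⟨A', B', f'⟩
  let α' : x ⟶ y := (⟨a, b, α⟩ : ArSq.Hom x y)
  let β' : x ⟶ y := (⟨a, b, β⟩ : ArSq.Hom x y)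
  have key : S.c.functor.map α' = S.c.functor.map β' := by
    apply WideSubcategory.hom_ext
    apply Arrow.hom_ext
    · have hm : @Mono C.E _ _ _ (S.c.hom f') := hS.e.mono (S.c.hom f')
      refine hm.right_cancellation _ _ ?_
      exact (S.c.sqMap_comm α).trans (S.c.sqMap_comm β).symm
    · rfl
  have h : α' = β' := S.c.functor.map_injective key
  have h' : ArSq.Hom.mk (f := x) (f' := y) a b α = ArSq.Hom.mk a b β := h
  simpa using h'

/-- Squares with equal boundaries are equal when squares are determined by their boundary. -/
theorem sq_heq
    (hC : ∀ {A B A' B' : C.Obj} (f : C.HomM A B) (a : C.HomE A A') (b : C.HomE B B')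
      (f' : C.HomM A' B'), Subsingleton (C.Sq f a b f'))
    {A B A' B' : C.Obj} {f g : C.HomM A B} {a c : C.HomE A A'} {b d : C.HomE B B'}
    {f' g' : C.HomM A' B'} (α : C.Sq f a b f') (β : C.Sq g c d g')
    (h₁ : f = g) (h₂ : a = c) (h₃ : b = d) (h₄ : f' = g') : HEq α β := by
  subst h₁ h₂ h₃ h₄
  have := hC f a b f'
  exact heq_of_eq (Subsingleton.elim _ _)

theorem MNatTrans.ext_app
    (hC : ∀ {A B A' B' : C.Obj} (f : C.HomM A B) (a : C.HomE A A') (b : C.HomE B B')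
      (f' : C.HomM A' B'), Subsingleton (C.Sq f a b f'))
    {F G : DoubleFunctor D C} {μ ν : MNatTrans F G} (h : ∀ A, μ.app A = ν.app A) : μ = ν := by
  obtain ⟨app, sq, _, _, _, _⟩ := μ
  obtain ⟨app', sq', _, _, _, _⟩ := ν
  obtain rfl : app = app' := funext h
  have : @sq = @sq' := by
    funext A A' a
    have := hC (app A) (F.mapE a) (G.mapE a) (app A')
    exact Subsingleton.elim _ _
  subst this
  rfl

theorem Modification.subsingleton
    (hC : ∀ {A B A' B' : C.Obj} (f : C.HomM A B) (a : C.HomE A A') (b : C.HomE B B')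
      (f' : C.HomM A' B'), Subsingleton (C.Sq f a b f'))
    {F G F' G' : DoubleFunctor D C} (μ : MNatTrans F G) (η : ENatTrans F F')
    (η' : ENatTrans G G') (μ' : MNatTrans F' G') : Subsingleton (Modification μ η η' μ') := by
  refine ⟨fun α β => ?_⟩
  obtain ⟨app, _, _⟩ := α
  obtain ⟨app', _, _⟩ := β
  have : app = app' := by
    funext A
    have := hC (μ.app A) (η.appE A) (η'.appE A) (μ'.app A)
    exact Subsingleton.elim _ _
  subst this
  rfl

/-- A pointwise family of squares is a modification when squares are determined by their boundary. -/
def Modification.ofApp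
    (hC : ∀ {A B A' B' : C.Obj} (f : C.HomM A B) (a : C.HomE A A') (b : C.HomE B B')
      (f' : C.HomM A' B'), Subsingleton (C.Sq f a b f'))
    {F G F' G' : DoubleFunctor D C} {μ : MNatTrans F G} {η : ENatTrans F F'}
    {η' : ENatTrans G G'} {μ' : MNatTrans F' G'}
    (app : ∀ A : D.Obj, C.Sq (μ.app A) (η.appE A) (η'.appE A) (μ'.app A)) :
    Modification μ η η' μ' where
  app := app
  coherence_m f := sq_heq hC _ _ (μ.naturality f) rfl rfl (μ'.naturality f)
  coherence_e a := sq_heq hC _ _ rfl (η.naturality a) (η'.naturality a) rfl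

theorem Modification.heq
    (hC : ∀ {A B A' B' : C.Obj} (f : C.HomM A B) (a : C.HomE A A') (b : C.HomE B B')
      (f' : C.HomM A' B'), Subsingleton (C.Sq f a b f'))
    {F G F' G' : DoubleFunctor D C} {μ ν : MNatTrans F G} {η θ : ENatTrans F F'}
    {η' θ' : ENatTrans G G'} {μ' ν' : MNatTrans F' G'}
    (α : Modification μ η η' μ') (β : Modification ν θ θ' ν')
    (h₁ : μ = ν) (h₂ : η = θ) (h₃ : η' = θ') (h₄ : μ' = ν') : HEq α β := by
  subst h₁ h₂ h₃ h₄
  have := Modification.subsingleton hC μ η η' μ'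
  exact heq_of_eq (Subsingleton.elim _ _)

/-- The category of double functors `D → C` and good m-natural transformations. -/
@[reducible]
def goodMCat (S : GCGWData C) (hS : S.IsGCGW) (D : DoubleCat.{u', v₁', v₂', w'}) :
    Category (DoubleFunctor D C) where
  Hom F G := {μ : MNatTrans F G // μ.IsGood S.goodM}
  id F := ⟨{ app := fun A => C.idM (F.obj A)
             sq := fun a => C.hId (F.mapE a)
             sq_id := fun A => sq_heq hS.sq_subsingleton _ _ rfl (F.mapE_id A) (F.mapE_id A) rfl
             sq_comp := fun a a' => sq_heq hS.sq_subsingleton _ _ rfl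
               (F.mapE_comp a a') (F.mapE_comp a a') rfl
             naturality := fun f => by rw [Category.comp_id, Category.id_comp]
             naturality_sq := fun {A B A' B' f a b f'} α => by
               have h : ∀ {X Y : D.Obj} (g : D.HomM X Y),
                   F.mapM g ≫ C.idM (F.obj Y) = C.idM (F.obj X) ≫ F.mapM g := by
                 intro X Y g
                 rw [Category.comp_id, Category.id_comp]
               exact sq_heq hS.sq_subsingleton _ _ (h f) rfl rfl (h f') },
    fun f => ⟨by rw [Category.comp_id, Category.id_comp],
      S.goodM.id_mem (Arrow.mk (F.mapM f))⟩⟩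
  comp {F G H} μ ν := ⟨
    { app := fun A => μ.1.app A ≫ ν.1.app A
      sq := fun a => C.hComp (μ.1.sq a) (ν.1.sq a)
      sq_id := fun A => sq_heq hS.sq_subsingleton _ _ rfl (F.mapE_id A) (H.mapE_id A) rfl
      sq_comp := fun a a' => sq_heq hS.sq_subsingleton _ _ rfl
        (F.mapE_comp a a') (H.mapE_comp a a') rfl
      naturality := fun f => by
        rw [← Category.assoc, μ.1.naturality, Category.assoc, ν.1.naturality, Category.assoc]
      naturality_sq := fun {A B A' B' f a b f'} α => by
        have h : ∀ {X Y : D.Obj} (g : D.HomM X Y),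
            F.mapM g ≫ (μ.1.app Y ≫ ν.1.app Y) = (μ.1.app X ≫ ν.1.app X) ≫ H.mapM g := by
          intro X Y g
          rw [← Category.assoc, μ.1.naturality, Category.assoc, ν.1.naturality, Category.assoc]
        exact sq_heq hS.sq_subsingleton _ _ (h f) rfl rfl (h f') },
    fun f => by
      obtain ⟨h₁, h₂⟩ := μ.2 f
      obtain ⟨h₃, h₄⟩ := ν.2 f
      refine ⟨by rw [Category.assoc, h₃, ← Category.assoc, h₁, Category.assoc], ?_⟩
      exact S.goodM.comp_mem _ _ h₂ h₄⟩
  id_comp μ := Subtype.ext (MNatTrans.ext_app hS.sq_subsingleton fun _ => Category.id_comp _)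
  comp_id μ := Subtype.ext (MNatTrans.ext_app hS.sq_subsingleton fun _ => Category.comp_id _)
  assoc μ ν ρ :=
    Subtype.ext (MNatTrans.ext_app hS.sq_subsingleton fun _ => Category.assoc _ _ _)

theorem GCGWData.IsGCGW.tr {S : GCGWData C} (hS : S.IsGCGW) : S.tr.IsGCGW := ⟨hS.e, hS.m⟩

/-- The category of double functors `D → C` and good e-natural transformations. -/
@[reducible]
def goodECat (S : GCGWData C) (hS : S.IsGCGW) (D : DoubleCat.{u', v₁', v₂', w'}) :
    Category (DoubleFunctor D C) where
  Hom F G := {η : ENatTrans F G // MNatTrans.IsGood S.goodE η}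
  id F := (goodMCat S.tr hS.tr D.tr).id F.tr
  comp η θ := (goodMCat S.tr hS.tr D.tr).comp η θ
  id_comp η := (goodMCat S.tr hS.tr D.tr).id_comp η
  comp_id η := (goodMCat S.tr hS.tr D.tr).comp_id η
  assoc η θ ξ := (goodMCat S.tr hS.tr D.tr).assoc η θ ξ

/-- The double category `C^D`: its objects are all double functors `D → C`, its m-morphisms
(e-morphisms) are the good m-natural (e-natural) transformations, and its squares are all the
modifications between these. Compositions and identities are pointwise. -/
def functorDoubleCat (S : StarCGW C) (D : DoubleCat.{u', v₁', v₂', w'}) : DoubleCat where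
  Obj := DoubleFunctor D C
  catM := goodMCat S.toGCGWData S.gcgw D
  catE := goodECat S.toGCGWData S.gcgw D
  Sq μ η η' μ' := Modification μ.1 η.1 η'.1 μ'.1
  hId η := Modification.ofApp S.gcgw.sq_subsingleton fun A => C.hId (η.1.appE A)
  vId μ := Modification.ofApp S.gcgw.sq_subsingleton fun A => C.vId (μ.1.app A)
  hComp α β := Modification.ofApp S.gcgw.sq_subsingleton fun A => C.hComp (α.app A) (β.app A)
  vComp α β := Modification.ofApp S.gcgw.sq_subsingleton fun A => C.vComp (α.app A) (β.app A)
  hId_hComp _ := Modification.heq S.gcgw.sq_subsingleton _ _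
    (congrArg Subtype.val ((goodMCat S.toGCGWData S.gcgw D).id_comp _)) rfl rfl
    (congrArg Subtype.val ((goodMCat S.toGCGWData S.gcgw D).id_comp _))
  hComp_hId _ := Modification.heq S.gcgw.sq_subsingleton _ _
    (congrArg Subtype.val ((goodMCat S.toGCGWData S.gcgw D).comp_id _)) rfl rfl
    (congrArg Subtype.val ((goodMCat S.toGCGWData S.gcgw D).comp_id _))
  vId_vComp _ := Modification.heq S.gcgw.sq_subsingleton _ _ rfl
    (congrArg Subtype.val ((goodECat S.toGCGWData S.gcgw D).id_comp _))
    (congrArg Subtype.val ((goodECat S.toGCGWData S.gcgw D).id_comp _)) rfl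
  vComp_vId _ := Modification.heq S.gcgw.sq_subsingleton _ _ rfl
    (congrArg Subtype.val ((goodECat S.toGCGWData S.gcgw D).comp_id _))
    (congrArg Subtype.val ((goodECat S.toGCGWData S.gcgw D).comp_id _)) rfl
  hAssoc _ _ _ := Modification.heq S.gcgw.sq_subsingleton _ _
    (congrArg Subtype.val ((goodMCat S.toGCGWData S.gcgw D).assoc _ _ _)) rfl rfl
    (congrArg Subtype.val ((goodMCat S.toGCGWData S.gcgw D).assoc _ _ _))
  vAssoc _ _ _ := Modification.heq S.gcgw.sq_subsingleton _ _ rfl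
    (congrArg Subtype.val ((goodECat S.toGCGWData S.gcgw D).assoc _ _ _))
    (congrArg Subtype.val ((goodECat S.toGCGWData S.gcgw D).assoc _ _ _)) rfl
  interchange _ _ _ _ := eq_of_heq (Modification.heq S.gcgw.sq_subsingleton _ _ rfl rfl rfl rfl)
  hId_comp _ _ := eq_of_heq (Modification.heq S.gcgw.sq_subsingleton _ _ rfl rfl rfl rfl)
  vId_comp _ _ := eq_of_heq (Modification.heq S.gcgw.sq_subsingleton _ _ rfl rfl rfl rfl)
  hId_id _ := eq_of_heq (Modification.heq S.gcgw.sq_subsingleton _ _ rfl rfl rfl rfl)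

namespace functorDoubleCat

variable {S : StarCGW C} {F G F' G' : DoubleFunctor D C}

/-- The component at `i` of an m-morphism of `C^D`. -/
def appM (μ : (functorDoubleCat S D).HomM F G) (i : D.Obj) : C.HomM (F.obj i) (G.obj i) :=
  MNatTrans.app (Subtype.val μ) i

/-- The component at `i` of an e-morphism of `C^D`. -/
def appE (η : (functorDoubleCat S D).HomE F G) (i : D.Obj) : C.HomE (F.obj i) (G.obj i) :=
  ENatTrans.appE (Subtype.val η) i

/-- The component at `i` of a square of `C^D`. -/
def appSq {μ : (functorDoubleCat S D).HomM F G} {η : (functorDoubleCat S D).HomE F F'}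
    {η' : (functorDoubleCat S D).HomE G G'} {μ' : (functorDoubleCat S D).HomM F' G'}
    (α : (functorDoubleCat S D).Sq μ η η' μ') (i : D.Obj) :
    C.Sq (appM μ i) (appE η i) (appE η' i) (appM μ' i) :=
  Modification.app α i

end functorDoubleCat

end FunctorDoubleCat

end CGW

/-! All structure on `C^D` is pointwise, so the work lies in showing that pointwise constructions
are natural in both kinds of morphisms of `D`, with good naturality squares. Squares of `C` are
determined by their boundaries, so only their existence matters (`Mixed`); moreover the left side,
and likewise the top side, is determined by the other three (`mixed_left_unique`,
`mixed_top_unique`).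

The central device is the relation `Compl`: an m-morphism `f` and an e-morphism `z` are
complementary if `z ≅ c(f)`. By (K) and (D) this is the same as `f ≅ k(z)` (`Compl.tr`). As `c` and
`k` are fully faithful, mixed squares correspond to good squares between complements, in `M` or in
`E` (`Compl.good_e`, `Compl.mixed_e` and their transposes). Together with (PBL) this yields the
pullback lemma for good squares (`cancel`).

A good square inducing an isomorphism on cokernels is a ★-pushout (`star_of_mixed`), whence the
pasting laws. For mixed maps the decisive facts are: a mixed map of good squares induces one of
★-pushouts (`exists_star_mixed`); it is unique (`star_mixed_unique`); its complement is the
★-pushout of the complements (`star_compl`); and conversely a ★-pushout of the source can be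
recovered as a cokernel (`star_of_compl`), which is how (PO) is transferred. Hence the complement of
a mixed map of good squares is a good cube, and a good cube of complements forces the source square
to be good (`cube_of_mixed`, `good_of_cube`). This is why good cubes are the right good squares of
`C^D`. Goodness of a cube does not depend on the order of its three directions (`cube_symm`,
`cube_rotate`), and good cubes compose and satisfy a version of (POL).

Each axiom comes with its transpose. The transpose of `C^D` has double functors `D → C`, not `D.tr →
C.tr`, as objects, so it is not literally a double category of the same form. The argument is
therefore carried out for any `Model` of `C^D`, a notion closed under transposition, and each axiom
is proved once. -/

namespace CGW

universe u v₁ v₂ w u' v₁' v₂' w' u'' v₁'' v₂'' w''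

/-! ## Mixed squares -/

section Mixed

variable {C : DoubleCat.{u, v₁, v₂, w}}

/-- The boundary `(f, a, b, f')` bounds a mixed square. -/
def Mixed (C : DoubleCat.{u, v₁, v₂, w}) {A B A' B' : C.Obj} (f : C.HomM A B) (a : C.HomE A A')
    (b : C.HomE B B') (f' : C.HomM A' B') : Prop :=
  Nonempty (C.Sq f a b f')

theorem Mixed.tr {A B A' B' : C.Obj} {f : C.HomM A B} {a : C.HomE A A'}
    {b : C.HomE B B'} {f' : C.HomM A' B'} (h : Mixed C f a b f') : Mixed C.tr a f f' b := h

theorem Mixed.hcomp {X Y Z X' Y' Z' : C.Obj} {f : C.HomM X Y} {g : C.HomM Y Z}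
    {a : C.HomE X X'} {b : C.HomE Y Y'} {c : C.HomE Z Z'} {f' : C.HomM X' Y'} {g' : C.HomM Y' Z'}
    (h : Mixed C f a b f') (h' : Mixed C g b c g') : Mixed C (f ≫ g) a c (f' ≫ g') :=
  ⟨C.hComp h.some h'.some⟩

theorem Mixed.vcomp {X Y X' Y' X'' Y'' : C.Obj} {f : C.HomM X Y} {f' : C.HomM X' Y'}
    {f'' : C.HomM X'' Y''} {a : C.HomE X X'} {b : C.HomE Y Y'} {a' : C.HomE X' X''}
    {b' : C.HomE Y' Y''} (h : Mixed C f a b f') (h' : Mixed C f' a' b' f'') :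
    Mixed C f (a ≫ a') (b ≫ b') f'' :=
  ⟨C.vComp h.some h'.some⟩

theorem Mixed.id_m {A A' : C.Obj} (a : C.HomE A A') : Mixed C (C.idM A) a a (C.idM A') :=
  ⟨C.hId a⟩

theorem Mixed.id_e {A A' : C.Obj} (f : C.HomM A A') : Mixed C f (C.idE A) (C.idE A') f :=
  ⟨C.vId f⟩

theorem Mixed.congr {A B A' B' : C.Obj} {f g : C.HomM A B} {a a' : C.HomE A A'}
    {b b' : C.HomE B B'} {f' g' : C.HomM A' B'} (h : Mixed C f a b f')
    (h₁ : g = f := by rfl) (h₂ : a' = a := by rfl) (h₃ : b' = b := by rfl)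
    (h₄ : g' = f' := by rfl) : Mixed C g a' b' g' := by
  subst h₁ h₂ h₃ h₄; exact h

/-- The image of an identity is an idempotent isomorphism, hence an identity. -/
theorem SharedIsos.equiv_refl (I : SharedIsos C) (A : C.Obj) :
    I.equiv (Iso.refl (⟨A⟩ : C.M)) = Iso.refl (⟨A⟩ : C.E) := by
  have h := I.equiv_trans (Iso.refl (⟨A⟩ : C.M)) (Iso.refl _)
  rw [Iso.trans_refl] at h
  have h' := congrArg (fun e => (I.equiv (Iso.refl (⟨A⟩ : C.M))).symm ≪≫ e) h
  simpa using h'.symm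

theorem SharedIsos.equiv_symm (I : SharedIsos C) {A B : C.Obj} (e : C.IsoM A B) :
    I.equiv e.symm = (I.equiv e).symm := by
  have h := I.equiv_trans e e.symm
  rw [Iso.self_symm_id, I.equiv_refl] at h
  have h' := congrArg (fun x => (I.equiv e).symm ≪≫ x) h
  simpa using h'.symm

theorem SharedIsos.mixed_m (I : SharedIsos C) {A B A' B' : C.Obj} (f : C.IsoM A A')
    (f' : C.IsoM B B') {g : C.HomM A B} {g' : C.HomM A' B'} :
    Mixed C g (I.equiv f).hom (I.equiv f').hom g' ↔ g ≫ f'.hom = f.hom ≫ g' :=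
  I.sq_iff_m f f' g g'

theorem SharedIsos.mixed_e (I : SharedIsos C) {A B A' B' : C.Obj} (f : C.IsoM A A')
    (f' : C.IsoM B B') {g : C.HomE A B} {g' : C.HomE A' B'} :
    Mixed C f.hom g g' f'.hom ↔ g ≫ (I.equiv f').hom = (I.equiv f).hom ≫ g' :=
  I.sq_iff_e f f' g g'

theorem SharedIsos.m_eq_of_mixed (I : SharedIsos C) {A B A' : C.Obj} (a : C.HomE A A') (ha : IsIso a)
    {g : C.HomM A B} {g' : C.HomM A' B} (h : Mixed C g a (C.idE B) g') :
    ∃ x : C.HomM A A', IsIso x ∧ g = x ≫ g' := by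
  refine ⟨(I.equiv.symm (asIso a)).hom, inferInstance, ?_⟩
  have := (I.mixed_m (I.equiv.symm (asIso a)) (Iso.refl (⟨B⟩ : C.M)) (g := g) (g' := g')).1
    (h.congr rfl (by simp) (by rw [I.equiv_refl]; rfl) rfl)
  simpa using this

/-- An m-isomorphism over `B` is read as an e-isomorphism in a mixed square. -/
theorem SharedIsos.mixed_of_m_eq (I : SharedIsos C) {A B A' : C.Obj} (x : C.HomM A A') (hx : IsIso x)
    {g : C.HomM A B} {g' : C.HomM A' B} (h : g = x ≫ g') :
    ∃ a : C.HomE A A', IsIso a ∧ Mixed C g a (C.idE B) g' := by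
  refine ⟨(I.equiv (asIso x)).hom, inferInstance, ?_⟩
  have := (I.mixed_m (asIso x) (Iso.refl (⟨B⟩ : C.M)) (g := g) (g' := g')).2 (by simpa using h)
  exact this.congr rfl rfl (by rw [I.equiv_refl]; rfl) rfl

theorem SharedIsos.mixed_of_e_eq (I : SharedIsos C) {A B A' : C.Obj} (x : C.HomE A A') (hx : IsIso x)
    {g : C.HomE A B} {g' : C.HomE A' B} (h : g = x ≫ g') :
    ∃ a : C.HomM A A', IsIso a ∧ Mixed C a g g' (C.idM B) :=
  I.tr.mixed_of_m_eq (C := C.tr) x hx h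

/-- A mixed square with two identity m-sides is an equality. -/
theorem SharedIsos.eq_of_mixed_id (I : SharedIsos C) {A B : C.Obj} {g g' : C.HomE A B}
    (h : Mixed C (C.idM A) g g' (C.idM B)) : g = g' := by
  have := (I.mixed_e (Iso.refl (⟨A⟩ : C.M)) (Iso.refl (⟨B⟩ : C.M)) (g := g) (g' := g')).1 h
  rw [I.equiv_refl, I.equiv_refl] at this
  simpa using this

theorem SharedIsos.mixed_inv_m (I : SharedIsos C) {A B A' B' : C.Obj} {x : C.HomM A A'}
    {y : C.HomM B B'} {a : C.HomE A B} {b : C.HomE A' B'} (hx : IsIso x) (hy : IsIso y)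
    (h : Mixed C x a b y) : Mixed C (inv x) b a (inv y) := by
  have h₁ := (I.mixed_e (asIso x) (asIso y) (g := a) (g' := b)).1 h
  have h₂ := (I.mixed_e (asIso x).symm (asIso y).symm (g := b) (g' := a)).2 (by
    rw [I.equiv_symm, I.equiv_symm, Iso.symm_hom, Iso.symm_hom, Iso.comp_inv_eq, Category.assoc,
      h₁, Iso.inv_hom_id_assoc])
  simpa using h₂

end Mixed

/-! ## Faithfulness and fullness of the cokernel functor -/

section Cokernels

variable {C : DoubleCat.{u, v₁, v₂, w}} {S : GCGWData C}

theorem GCGWData.IsGCGW.mono_m (h : S.IsGCGW) {A B : C.Obj} (f : C.HomM A B) : Mono f := h.m.mono f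

theorem GCGWData.IsGCGW.mono_e (h : S.IsGCGW) {A B : C.Obj} (f : C.HomE A B) : Mono f := h.e.mono f

theorem GCGWData.IsGCGW.cancel_m (h : S.IsGCGW) {A B D : C.Obj} {x y : C.HomM A B}
    (f : C.HomM B D) (e : x ≫ f = y ≫ f) : x = y := (h.mono_m f).right_cancellation _ _ e

theorem GCGWData.IsGCGW.cancel_e (h : S.IsGCGW) {A B D : C.Obj} {x y : C.HomE A B}
    (f : C.HomE B D) (e : x ≫ f = y ≫ f) : x = y := (h.mono_e f).right_cancellation _ _ e

/-- The images under `c` of the two squares have the same right side `b`, hence the same left side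
because `c(f')` is monic; `c` is faithful. -/
theorem GCGWData.IsGCGW.mixed_left_unique (h : S.IsGCGW) {A B A' B' : C.Obj} {f : C.HomM A B}
    {a a' : C.HomE A A'} {b : C.HomE B B'} {f' : C.HomM A' B'} (h₁ : Mixed C f a b f')
    (h₂ : Mixed C f a' b f') : a = a' := by
  obtain ⟨α⟩ := h₁
  obtain ⟨β⟩ := h₂
  have := h.m.c_equivalence
  let x : ArSq C := ⟨A, B, f⟩
  let y : ArSq C := ⟨A', B', f'⟩
  let α' : x ⟶ y := (⟨a, b, α⟩ : ArSq.Hom x y)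
  let β' : x ⟶ y := (⟨a', b, β⟩ : ArSq.Hom x y)
  have key : S.c.functor.map α' = S.c.functor.map β' := by
    apply WideSubcategory.hom_ext
    apply Arrow.hom_ext
    · exact h.cancel_e (S.c.hom f') ((S.c.sqMap_comm α).trans (S.c.sqMap_comm β).symm)
    · rfl
  exact congrArg ArSq.Hom.left (S.c.functor.map_injective key)

/-- The transpose of the previous lemma. It is the standard way to prove an equation between
m-morphisms on cokernels: both sides bound squares with the same three other sides. -/
theorem GCGWData.IsGCGW.mixed_top_unique (h : S.IsGCGW) {A B A' B' : C.Obj} {f g : C.HomM A B}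
    {a : C.HomE A A'} {b : C.HomE B B'} {f' : C.HomM A' B'} (h₁ : Mixed C f a b f')
    (h₂ : Mixed C g a b f') : f = g :=
  h.tr.mixed_left_unique (C := C.tr) h₁.tr h₂.tr

/-- Fullness of `c`; the right side `b` is preserved since `c` lies over the codomain functors. -/
theorem GCGWData.IsGCGW.exists_sq (h : S.IsGCGW) {A B A' B' : C.Obj} {f : C.HomM A B}
    {f' : C.HomM A' B'} {b : C.HomE B B'} {x : C.HomE (S.c.obj f) (S.c.obj f')}
    (hx : GoodSq S.goodE (S.c.hom f) x b (S.c.hom f')) :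
    ∃ (a : C.HomE A A') (α : C.Sq f a b f'), S.c.sqMap α = x := by
  have := h.m.c_equivalence
  let X : ArSq C := ⟨A, B, f⟩
  let Y : ArSq C := ⟨A', B', f'⟩
  let φ : S.c.functor.obj X ⟶ S.c.functor.obj Y := ⟨Arrow.homMk x b hx.1, hx.2⟩
  obtain ⟨ψ, hψ⟩ := S.c.functor.map_surjective φ
  obtain ⟨a, b', α⟩ := ψ
  have hb : b' = b := congrArg (fun t => t.1.right) hψ
  subst hb
  exact ⟨a, α, congrArg (fun t => t.1.left) hψ⟩

theorem GCGWData.good_sqMap (S : GCGWData C) {A B A' B' : C.Obj} {f : C.HomM A B}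
    {a : C.HomE A A'} {b : C.HomE B B'} {f' : C.HomM A' B'} (α : C.Sq f a b f') :
    GoodSq S.goodE (S.c.hom f) (S.c.sqMap α) b (S.c.hom f') :=
  ⟨S.c.sqMap_comm α, S.c.sqMap_good α⟩

/-- A good square whose sides over the codomains are isomorphisms over one object. -/
theorem GCGWData.IsGCGW.good_of_isIso_left (h : S.IsGCGW) {A B A' B' : C.Obj} {f : C.HomM A B}
    {g : C.HomM A A'} {p : C.HomM B B'} {q : C.HomM A' B'} (hg : IsIso g)
    (e : g ≫ q = f ≫ p) :
    GoodSq S.goodM f g p q :=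
  ⟨e, h.m.weakTriangles_le _ hg⟩

/-- m-morphisms over `B` whose cokernels are isomorphic over `B` are isomorphic over `B`. -/
theorem GCGWData.IsGCGW.iso_of_cokernel_iso (h : S.IsGCGW) {A A' B : C.Obj} {f : C.HomM A B}
    {f' : C.HomM A' B} (x : C.HomE (S.c.obj f) (S.c.obj f')) (hx : IsIso x)
    (e : x ≫ S.c.hom f' = S.c.hom f) : ∃ y : C.HomM A A', IsIso y ∧ f = y ≫ f' := by
  have e' : inv x ≫ S.c.hom f = S.c.hom f' := by rw [← e, IsIso.inv_hom_id_assoc]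
  obtain ⟨a, α, hα⟩ := h.exists_sq (b := C.idE B) (h.tr.good_of_isIso_left (C := C.tr) hx
    (f := S.c.hom f) (q := S.c.hom f') (p := C.idE B) (e.trans (Category.comp_id _).symm))
  obtain ⟨a', α', hα'⟩ := h.exists_sq (b := C.idE B) (h.tr.good_of_isIso_left (C := C.tr)
    (g := inv x) inferInstance (f := S.c.hom f') (q := S.c.hom f) (p := C.idE B)
    (e'.trans (Category.comp_id _).symm))
  -- The lifts are mutually inverse: each composite square shares its other three sides with an
  -- identity square.
  have h₁ : a ≫ a' = 𝟙 _ := h.mixed_left_unique (f := f) (f' := f) (b := C.idE B ≫ C.idE B)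
    ⟨C.vComp α α'⟩ ((Mixed.id_e f).congr rfl rfl (Category.comp_id _) rfl)
  have h₂ : a' ≫ a = 𝟙 _ := h.mixed_left_unique (f := f') (f' := f') (b := C.idE B ≫ C.idE B)
    ⟨C.vComp α' α⟩ ((Mixed.id_e f').congr rfl rfl (Category.comp_id _) rfl)
  have : IsIso a := ⟨a', h₁, h₂⟩
  exact S.isos.m_eq_of_mixed a this ⟨α⟩

/-- m-morphisms that are isomorphic over `B` have cokernels that are isomorphic over `B`. -/
theorem GCGWData.IsGCGW.cokernel_iso_of_iso (h : S.IsGCGW) {A A' B : C.Obj} {f : C.HomM A B}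
    {f' : C.HomM A' B} (y : C.HomM A A') (hy : IsIso y) (e : f = y ≫ f') :
    ∃ x : C.HomE (S.c.obj f) (S.c.obj f'), IsIso x ∧ x ≫ S.c.hom f' = S.c.hom f := by
  obtain ⟨a, ha, ⟨α⟩⟩ := S.isos.mixed_of_m_eq y hy e
  have e' : f' = inv y ≫ f := by rw [e, IsIso.inv_hom_id_assoc]
  obtain ⟨a', ha', ⟨α'⟩⟩ := S.isos.mixed_of_m_eq (inv y) inferInstance e'
  have c₁ : S.c.sqMap α ≫ S.c.hom f' = S.c.hom f := (S.c.sqMap_comm α).trans (Category.comp_id _)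
  have c₂ : S.c.sqMap α' ≫ S.c.hom f = S.c.hom f' :=
    (S.c.sqMap_comm α').trans (Category.comp_id _)
  refine ⟨S.c.sqMap α, ⟨S.c.sqMap α', ?_, ?_⟩, c₁⟩
  · exact h.cancel_e (S.c.hom f) (by rw [Category.assoc, c₂, c₁, Category.id_comp])
  · exact h.cancel_e (S.c.hom f') (by rw [Category.assoc, c₁, c₂, Category.id_comp])

end Cokernels

/-! ## Complements -/

section Complements

variable {C : DoubleCat.{u, v₁, v₂, w}} {S : GCGWData C}

theorem GoodSq.vcomp {X : Type u} [Category.{v₁} X] {W : MorphismProperty (Arrow X)}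
    [W.IsMultiplicative] {A B A' B' A'' B'' : X} {f : A ⟶ B} {g : A ⟶ A'} {p : B ⟶ B'}
    {q : A' ⟶ B'} {g' : A' ⟶ A''} {p' : B' ⟶ B''} {r : A'' ⟶ B''} (h : GoodSq W f g p q)
    (h' : GoodSq W q g' p' r) : GoodSq W f (g ≫ g') (p ≫ p') r := by
  obtain ⟨h₁, h₂⟩ := h
  obtain ⟨h₃, h₄⟩ := h'
  exact ⟨by rw [Category.assoc, h₃, ← Category.assoc, h₁, Category.assoc], W.comp_mem _ _ h₂ h₄⟩

theorem GoodSq.congr {X : Type u} [Category.{v₁} X] {W : MorphismProperty (Arrow X)}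
    {A B C D : X} {f f' : A ⟶ B} {g g' : A ⟶ C} {p p' : B ⟶ D} {q q' : C ⟶ D}
    (h : GoodSq W f g p q) (h₁ : f' = f := by rfl) (h₂ : g' = g := by rfl)
    (h₃ : p' = p := by rfl) (h₄ : q' = q := by rfl) : GoodSq W f' g' p' q' := by
  subst h₁ h₂ h₃ h₄; exact h

theorem exists_isIso_over {X : Type u} [Category.{v₁} X] {I K L K' A : X} (y₀ : I ⟶ K) (x : K ⟶ L)
    (y : I ⟶ K') (hy₀ : IsIso y₀) (hx : IsIso x) (hy : IsIso y) (l : L ⟶ A) (k : K' ⟶ A)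
    (e : y₀ ≫ x ≫ l = y ≫ k) : ∃ z : L ⟶ K', IsIso z ∧ z ≫ k = l :=
  ⟨inv x ≫ inv y₀ ≫ y, inferInstance, by
    rw [Category.assoc, Category.assoc, ← e, IsIso.inv_hom_id_assoc, IsIso.inv_hom_id_assoc]⟩

theorem GCGWData.IsGCGW.zero_ext_m (h : S.IsGCGW) {A : C.Obj} (x y : C.HomM S.zero A) : x = y :=
  h.m.zero_initial.some.hom_ext x y

theorem GCGWData.IsGCGW.zero_ext_e (h : S.IsGCGW) {A : C.Obj} (x y : C.HomE S.zero A) : x = y :=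
  h.e.zero_initial.some.hom_ext x y

/-- The (K) square of `id_A` has top `∅ → A`, right side `id_A` and bottom `k(id_A)`. By (D) it
induces an isomorphism of cokernels over `A`, so its top and bottom are isomorphic over `A`. -/
theorem GCGWData.IsGCGW.exists_iso_ker_id (h : S.IsGCGW) (A : C.Obj) :
    ∃ y : C.HomM S.zero (S.k.obj (C.idE A)), IsIso y := by
  obtain ⟨t, l, α, hα⟩ := h.e.cokernel_sq (C.idE A)
  let β : C.Sq l t (C.idE A) (S.k.hom (C.idE A)) := α
  have hβ : IsIso (S.c.sqMap β) := (h.m.distinguished_iff β).2 hα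
  obtain ⟨y, hy, -⟩ := h.iso_of_cokernel_iso _ hβ ((S.c.sqMap_comm β).trans (Category.comp_id _))
  exact ⟨y, hy⟩

/-- The left side of the (K) square of `f` is `id_∅` by initiality. By (D) the kernels of `id_∅` and
of `c(f)` are isomorphic, so `c(f)` has kernel `∅`, just as `id_A` has. E-morphisms into `A` with
kernels isomorphic over `A` are isomorphic over `A`, so `c(f) ≅ id_A`. -/
theorem GCGWData.IsGCGW.isIso_cokernel_zero (h : S.IsGCGW) {A : C.Obj} (f : C.HomM S.zero A) :
    IsIso (S.c.hom f) := by
  obtain ⟨t, l, α, hα⟩ := h.m.cokernel_sq f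
  obtain rfl : l = C.idE S.zero := h.zero_ext_e _ _
  have h₁ := (h.m.distinguished_iff α).1 hα
  obtain ⟨y₀, hy₀⟩ := h.exists_iso_ker_id S.zero
  obtain ⟨y, hy⟩ := h.exists_iso_ker_id A
  let x : C.HomM (S.k.obj (C.idE S.zero)) (S.k.obj (S.c.hom f)) := S.kerMap α
  have hx : IsIso x := h₁
  have e : y₀ ≫ x ≫ S.k.hom (S.c.hom f) = y ≫ S.k.hom (C.idE A) := h.zero_ext_m _ _
  obtain ⟨w, hw, e'⟩ := exists_isIso_over y₀ x y hy₀ hx hy _ _ e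
  obtain ⟨z, hz, hz'⟩ := h.tr.iso_of_cokernel_iso (C := C.tr) (f := S.c.hom f) (f' := C.idE A)
    w hw e'
  have : S.c.hom f = z := hz'.trans (Category.comp_id (X := (⟨_⟩ : C.E)) z)
  rw [this]
  exact hz

/-- The m-morphism `f` and the e-morphism `z` with the same codomain are complementary: `z` is
isomorphic to the cokernel of `f`. -/
def Compl (S : GCGWData C) {A B Z : C.Obj} (f : C.HomM A B) (z : C.HomE Z B) : Prop :=
  ∃ θ : C.HomE Z (S.c.obj f), IsIso θ ∧ θ ≫ S.c.hom f = z

theorem compl_c (S : GCGWData C) {A B : C.Obj} (f : C.HomM A B) : Compl S f (S.c.hom f) :=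
  ⟨𝟙 _, inferInstance, Category.id_comp _⟩

/-- A distinguished square on `∅` with right side `z` and bottom `f`. -/
def DistZero (S : GCGWData C) {A B Z : C.Obj} (f : C.HomM A B) (z : C.HomE Z B) : Prop :=
  ∃ (t : C.HomM S.zero Z) (l : C.HomE S.zero A) (α : C.Sq t l z f), S.Distinguished α

theorem DistZero.tr (h : S.IsGCGW) {A B Z : C.Obj} {f : C.HomM A B} {z : C.HomE Z B}
    (hz : DistZero S f z) : DistZero (C := C.tr) S.tr z f := by
  obtain ⟨t, l, α, hα⟩ := hz
  exact ⟨l, t, α, (h.m.distinguished_iff α).1 hα⟩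

/-- On cokernels the square gives an isomorphism `Z/∅ → B/A`, and `c(t) : Z/∅ → Z` is an isomorphism
as well. -/
theorem DistZero.compl (h : S.IsGCGW) {A B Z : C.Obj} {f : C.HomM A B} {z : C.HomE Z B}
    (hz : DistZero S f z) : Compl S f z := by
  obtain ⟨t, l, α, hα⟩ := hz
  have : IsIso (S.c.sqMap α) := hα
  have := h.isIso_cokernel_zero t
  refine ⟨inv (S.c.hom t) ≫ S.c.sqMap α, inferInstance, ?_⟩
  rw [Category.assoc, S.c.sqMap_comm α, IsIso.inv_hom_id_assoc]

/-- The symmetry of complements. By (D) the distinguished (K) square of `f` is also distinguished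
for the transpose, which exhibits `f` as a kernel of `c(f)`; then `c(f)` is replaced by the
isomorphic `z`. -/
theorem Compl.tr (h : S.IsGCGW) {A B Z : C.Obj} {f : C.HomM A B} {z : C.HomE Z B}
    (hz : Compl S f z) : Compl (C := C.tr) S.tr z f := by
  obtain ⟨θ, hθ, rfl⟩ := hz
  obtain ⟨φ, hφ, e⟩ := DistZero.compl (C := C.tr) h.tr (DistZero.tr h (h.m.cokernel_sq f))
  obtain ⟨x, hx, e'⟩ := h.tr.cokernel_iso_of_iso (C := C.tr) (f := θ ≫ S.c.hom f)
    (f' := S.c.hom f) θ hθ rfl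
  refine ⟨φ ≫ inv x, inferInstance, ?_⟩
  rw [← e', Category.assoc, IsIso.inv_hom_id_assoc]
  exact e

theorem Compl.untr (h : S.IsGCGW) {A B Z : C.Obj} {f : C.HomM A B} {z : C.HomE Z B}
    (hz : Compl (C := C.tr) S.tr z f) : Compl S f z :=
  hz.tr (C := C.tr) h.tr

theorem compl_k (h : S.IsGCGW) {A B : C.Obj} (z : C.HomE A B) : Compl S (S.k.hom z) z :=
  (compl_c (C := C.tr) S.tr z).untr h

theorem exists_compl_e (S : GCGWData C) {A B : C.Obj} (f : C.HomM A B) :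
    ∃ (Z : C.Obj) (z : C.HomE Z B), Compl S f z := ⟨_, _, compl_c S f⟩

theorem exists_compl_m (h : S.IsGCGW) {A B : C.Obj} (z : C.HomE A B) :
    ∃ (K : C.Obj) (f : C.HomM K B), Compl S f z := ⟨_, _, compl_k h z⟩

theorem Compl.iso_e {A B Z Z' : C.Obj} {f : C.HomM A B} {z : C.HomE Z B}
    (hz : Compl S f z) (x : C.HomE Z' Z) (hx : IsIso x) {z' : C.HomE Z' B} (e : z' = x ≫ z) :
    Compl S f z' := by
  obtain ⟨θ, hθ, rfl⟩ := hz
  exact ⟨x ≫ θ, inferInstance, by rw [e, Category.assoc]⟩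

theorem Compl.iso_m (h : S.IsGCGW) {A A' B Z : C.Obj} {f : C.HomM A B} {z : C.HomE Z B}
    (hz : Compl S f z) (x : C.HomM A' A) (hx : IsIso x) {f' : C.HomM A' B} (e : f' = x ≫ f) :
    Compl S f' z :=
  ((hz.tr h).iso_e (C := C.tr) x hx e).untr h

theorem Compl.unique_e {A B Z Z' : C.Obj} {f : C.HomM A B} {z : C.HomE Z B}
    {z' : C.HomE Z' B} (hz : Compl S f z) (hz' : Compl S f z') :
    ∃ x : C.HomE Z Z', IsIso x ∧ z = x ≫ z' := by
  obtain ⟨θ, hθ, rfl⟩ := hz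
  obtain ⟨φ, hφ, rfl⟩ := hz'
  exact ⟨θ ≫ inv φ, inferInstance, by rw [Category.assoc, IsIso.inv_hom_id_assoc]⟩

/-- Any initial object is allowed, because the zero functor of a model is only known to be pointwise
initial. -/
theorem compl_zero (h : S.IsGCGW) {X A : C.Obj}
    (hX : Nonempty (Limits.IsInitial (⟨X⟩ : C.M))) (f : C.HomM X A) : Compl S f (C.idE A) := by
  obtain ⟨i⟩ := hX
  obtain ⟨j⟩ := h.m.zero_initial
  have h₀ : ∀ t : C.HomM S.zero A, Compl S t (C.idE A) := fun t => by
    have := h.isIso_cokernel_zero t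
    exact ⟨inv (S.c.hom t), inferInstance, IsIso.inv_hom_id _⟩
  exact (h₀ (j.to _)).iso_m h (i.uniqueUpToIso j).hom inferInstance (i.hom_ext _ _)

theorem compl_id (h : S.IsGCGW) {X A : C.Obj}
    (hX : Nonempty (Limits.IsInitial (⟨X⟩ : C.E))) (z : C.HomE X A) : Compl S (C.idM A) z :=
  (compl_zero (C := C.tr) h.tr hX z).untr h

theorem Compl.isIso_e (h : S.IsGCGW) {A B Z : C.Obj} {f : C.HomM A B} {z : C.HomE Z B}
    (hz : Compl S f z) (hX : Nonempty (Limits.IsInitial (⟨A⟩ : C.M))) : IsIso z := by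
  obtain ⟨x, hx, e⟩ := hz.unique_e (compl_zero h hX f)
  rw [e]
  infer_instance

theorem Compl.isIso_m (h : S.IsGCGW) {A B Z : C.Obj} {f : C.HomM A B} {z : C.HomE Z B}
    (hz : Compl S f z) (hX : Nonempty (Limits.IsInitial (⟨Z⟩ : C.E))) : IsIso f :=
  (hz.tr h).isIso_e (C := C.tr) h.tr hX

/-- A mixed square induces a good square between the complements of its m-sides. -/
theorem Compl.good_e (h : S.IsGCGW) {A B A' B' Z Z' : C.Obj} {f : C.HomM A B} {a : C.HomE A A'}
    {b : C.HomE B B'} {f' : C.HomM A' B'} {z : C.HomE Z B} {z' : C.HomE Z' B'}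
    (hz : Compl S f z) (hz' : Compl S f' z') (hm : Mixed C f a b f') :
    ∃ x : C.HomE Z Z', GoodSq S.goodE z x b z' := by
  obtain ⟨θ, hθ, e⟩ := hz
  obtain ⟨φ, hφ, e'⟩ := hz'
  obtain ⟨α⟩ := hm
  have h₁ : GoodSq S.goodE z θ (𝟙 _) (S.c.hom f) :=
    h.tr.good_of_isIso_left (C := C.tr) hθ (e.trans (Category.comp_id _).symm)
  have h₂ : GoodSq S.goodE (S.c.hom f') (inv φ) (𝟙 _) z' :=
    h.tr.good_of_isIso_left (C := C.tr) (g := inv φ) inferInstance (f := S.c.hom f') (q := z')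
      (p := 𝟙 _) (by
        refine Eq.trans ?_ (Category.comp_id _).symm
        exact (IsIso.inv_comp_eq φ).2 e'.symm)
  exact ⟨_, ((h₁.vcomp (S.good_sqMap α)).vcomp h₂).congr rfl rfl
    (by rw [Category.id_comp, Category.comp_id]) rfl⟩

/-- Fullness of `c`, transported along the isomorphisms from `z` and `z'` to the chosen cokernels.
-/
theorem Compl.mixed_e (h : S.IsGCGW) {A B A' B' Z Z' : C.Obj} {f : C.HomM A B}
    {b : C.HomE B B'} {f' : C.HomM A' B'} {z : C.HomE Z B} {z' : C.HomE Z' B'}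
    {x : C.HomE Z Z'} (hz : Compl S f z) (hz' : Compl S f' z') (hg : GoodSq S.goodE z x b z') :
    ∃ a : C.HomE A A', Mixed C f a b f' := by
  obtain ⟨θ, hθ, e⟩ := hz
  obtain ⟨φ, hφ, e'⟩ := hz'
  have h₁ : GoodSq S.goodE z' φ (𝟙 _) (S.c.hom f') :=
    h.tr.good_of_isIso_left (C := C.tr) hφ (e'.trans (Category.comp_id _).symm)
  have h₂ : GoodSq S.goodE (S.c.hom f) (inv θ) (𝟙 _) z :=
    h.tr.good_of_isIso_left (C := C.tr) (g := inv θ) inferInstance (f := S.c.hom f) (q := z)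
      (p := 𝟙 _) (by
        refine Eq.trans ?_ (Category.comp_id _).symm
        exact (IsIso.inv_comp_eq θ).2 e.symm)
  obtain ⟨a, α, -⟩ := h.exists_sq (((h₂.vcomp hg).vcomp h₁).congr rfl rfl (p' := b)
    (by rw [Category.id_comp, Category.comp_id]) rfl)
  exact ⟨a, ⟨α⟩⟩

theorem Compl.good_m (h : S.IsGCGW) {A B A' B' Z Z' : C.Obj} {f : C.HomM A B}
    {p : C.HomM B B'} {f' : C.HomM A' B'} {z : C.HomE Z B} {z' : C.HomE Z' B'} {x : C.HomM Z Z'}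
    (hz : Compl S f z) (hz' : Compl S f' z') (hm : Mixed C x z z' p) :
    ∃ g : C.HomM A A', GoodSq S.goodM f g p f' :=
  (hz.tr h).good_e (C := C.tr) h.tr (hz'.tr h) hm.tr

theorem Compl.mixed_m (h : S.IsGCGW) {A B A' B' Z Z' : C.Obj} {f : C.HomM A B}
    {p : C.HomM B B'} {f' : C.HomM A' B'} {z : C.HomE Z B} {z' : C.HomE Z' B'} {g : C.HomM A A'}
    (hz : Compl S f z) (hz' : Compl S f' z') (hg : GoodSq S.goodM f g p f') :
    ∃ x : C.HomM Z Z', Mixed C x z z' p :=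
  (hz.tr h).mixed_e (C := C.tr) h.tr (hz'.tr h) hg

/-- The mixed square on `∅` given by complementary morphisms. -/
theorem Compl.mixed_zero (h : S.IsGCGW) {A B Z : C.Obj} {f : C.HomM A B} {z : C.HomE Z B}
    (hz : Compl S f z) (t : C.HomM S.zero Z) (l : C.HomE S.zero A) : Mixed C t l z f := by
  obtain ⟨θ, hθ, e⟩ := hz
  obtain ⟨t', l', α, -⟩ := h.m.cokernel_sq f
  -- The (K) square is pasted with the square that reads the isomorphism `c(f) ≅ z` in `M`; the
  -- sides starting at `∅` are forced.
  obtain ⟨y, hy, hm⟩ := S.isos.mixed_of_e_eq (inv θ) inferInstance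
    (g := S.c.hom f) (g' := z) ((IsIso.eq_inv_comp θ).2 e)
  have hα : Mixed C t' l' (S.c.hom f) f := ⟨α⟩
  exact (hα.hcomp hm).congr (h.zero_ext_m _ _) (h.zero_ext_e _ _) rfl (Category.comp_id _).symm

/-- The mixed square on an e-morphism given by initial maps. -/
theorem mixed_initial (h : S.IsGCGW) {X X' B B' : C.Obj}
    (hX : Nonempty (Limits.IsInitial (⟨X⟩ : C.M))) (hX' : Nonempty (Limits.IsInitial (⟨X'⟩ : C.M)))
    (hE : Nonempty (Limits.IsInitial (⟨X⟩ : C.E))) (t : C.HomM X B) (l : C.HomE X X')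
    (b : C.HomE B B') (t' : C.HomM X' B') (hg : GoodSq S.goodE (C.idE B) b b (C.idE B')) :
    Mixed C t l b t' := by
  obtain ⟨a, ha⟩ := (compl_zero h hX t).mixed_e h (compl_zero h hX' t') hg
  exact ha.congr rfl (hE.some.hom_ext _ _)

end Complements

/-! ## Good squares and ★-pushouts -/

section StarPushouts

variable {C : DoubleCat.{u, v₁, v₂, w}} {S : GCGWData C}

/-- The axioms of a ★-CGW category other than (PO); they are invariant under transposition. -/
structure GCGWData.StarAxioms (S : GCGWData C) : Prop where
  gcgw : S.IsGCGW
  m : S.StarHalf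
  e : S.tr.StarHalf

theorem StarCGW.starAxioms (S : StarCGW C) : S.toGCGWData.StarAxioms :=
  ⟨S.gcgw, S.star_m, S.star_e⟩

theorem isIso_of_isIso_of_comp {X : Type u} [Category.{v₁} X] {B A K K' P D : X} {θ : B ⟶ K}
    {φ : A ⟶ K'} {k : K ⟶ K'} {w : K ⟶ P} {w' : K' ⟶ D} {t : B ⟶ P} {q : A ⟶ D} {d : P ⟶ D}
    {g : B ⟶ A} (e₁ : θ ≫ w = t) (e₂ : φ ≫ w' = q) (hk : k ≫ w' = w ≫ d) (e : g ≫ q = t ≫ d)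
    (hw' : Mono w') (hθ : IsIso θ) (hφ : IsIso φ) (hg : IsIso g) : IsIso k := by
  have : θ ≫ k = g ≫ φ := by
    rw [← cancel_mono w', Category.assoc, Category.assoc, hk, e₂, ← Category.assoc, e₁, e]
  have : IsIso (θ ≫ k) := by rw [this]; infer_instance
  exact IsIso.of_isIso_comp_left θ k

namespace GCGWData.StarAxioms

theorem tr (h : S.StarAxioms) : S.tr.StarAxioms := ⟨h.gcgw.tr, h.e, h.m⟩

theorem symm (h : S.StarAxioms) {A B A' B' : C.Obj} {f : C.HomM A B} {g : C.HomM A A'}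
    {p : C.HomM B B'} {q : C.HomM A' B'} (hg : GoodSq S.goodM f g p q) :
    GoodSq S.goodM g f q p := (h.m.good_symm f g p q).1 hg

theorem hcomp (h : S.StarAxioms) {X Y Z X' Y' Z' : C.Obj} {f : C.HomM X Y} {f₂ : C.HomM Y Z}
    {g : C.HomM X X'} {p : C.HomM Y Y'} {p₂ : C.HomM Z Z'} {q : C.HomM X' Y'} {q₂ : C.HomM Y' Z'}
    (h₁ : GoodSq S.goodM f g p q) (h₂ : GoodSq S.goodM f₂ p p₂ q₂) :
    GoodSq S.goodM (f ≫ f₂) g p₂ (q ≫ q₂) :=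
  h.symm ((h.symm h₁).vcomp (h.symm h₂))

theorem good_of_isIso_top (h : S.StarAxioms) {A B A' B' : C.Obj} {f : C.HomM A B} {g : C.HomM A A'}
    {p : C.HomM B B'} {q : C.HomM A' B'} (hf : IsIso f) (e : g ≫ q = f ≫ p) :
    GoodSq S.goodM f g p q :=
  h.symm (h.gcgw.good_of_isIso_left hf e.symm)

theorem good_id_left (h : S.StarAxioms) {A B : C.Obj} (f : C.HomM A B) :
    GoodSq S.goodM f (C.idM A) (C.idM B) f :=
  h.gcgw.good_of_isIso_left (inferInstanceAs (IsIso (𝟙 _)))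
    ((Category.id_comp _).trans (Category.comp_id _).symm)

theorem good_id_top (h : S.StarAxioms) {A B : C.Obj} (f : C.HomM A B) :
    GoodSq S.goodM (C.idM A) f f (C.idM B) := h.symm (h.good_id_left f)

/-- Pasting with the weak triangle from `f` to `f ≫ b` shrinks the corner `B` to `B₀`. -/
theorem restrict (h : S.StarAxioms) {A B₀ B A' B' : C.Obj} {f : C.HomM A B₀} {b : C.HomM B₀ B}
    {g : C.HomM A A'} {p : C.HomM B B'} {q : C.HomM A' B'}
    (hg : GoodSq S.goodM (f ≫ b) g p q) : GoodSq S.goodM f g (b ≫ p) q := by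
  have h₁ : GoodSq S.goodM f (C.idM A) b (f ≫ b) :=
    h.gcgw.good_of_isIso_left (inferInstanceAs (IsIso (𝟙 _))) (Category.id_comp _)
  exact (h₁.vcomp hg).congr rfl (Category.id_comp _).symm

/-- Pasting with the weak triangle from `q` to `q ≫ x` enlarges the corner `D` to `D'`. -/
theorem extend (h : S.StarAxioms) {A B A' D D' : C.Obj} {f : C.HomM A B}
    {g : C.HomM A A'} {p : C.HomM B D} {q : C.HomM A' D}
    (hg : GoodSq S.goodM f g p q) (x : C.HomM D D') : GoodSq S.goodM f g (p ≫ x) (q ≫ x) := by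
  have h₁ : GoodSq S.goodM q (C.idM A') x (q ≫ x) :=
    h.gcgw.good_of_isIso_left (inferInstanceAs (IsIso (𝟙 _))) (Category.id_comp _)
  exact (hg.vcomp h₁).congr rfl (Category.comp_id _).symm

theorem isPullback (h : S.StarAxioms) {A B A' B' : C.Obj} {f : C.HomM A B} {g : C.HomM A A'}
    {p : C.HomM B B'} {q : C.HomM A' B'} (hg : GoodSq S.goodM f g p q) : IsPullback g f q p :=
  h.gcgw.m.le_pullbackSquares _ hg.2

theorem pbl (h : S.StarAxioms) {A B D A' B' D' : C.Obj} {f : C.HomM A B} {g : C.HomM B D}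
    {a : C.HomE A A'} {b : C.HomE B B'} {d : C.HomE D D'} {f' : C.HomM A' B'} {g' : C.HomM B' D'}
    (h₁ : Mixed C g b d g') (h₂ : Mixed C (f ≫ g) a d (f' ≫ g')) : Mixed C f a b f' :=
  h.m.pullback_lemma f g a b d f' g' h₁ h₂

theorem pbl_v (h : S.StarAxioms) {A B D A' B' D' : C.Obj} {f : C.HomE A B} {g : C.HomE B D}
    {a : C.HomM A A'} {b : C.HomM B B'} {d : C.HomM D D'} {f' : C.HomE A' B'} {g' : C.HomE B' D'}
    (h₁ : Mixed C b g g' d) (h₂ : Mixed C a (f ≫ g) (f' ≫ g') d) : Mixed C a f f' b :=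
  h.e.pullback_lemma f g a b d f' g' h₁ h₂

theorem mixed_initial (h : S.StarAxioms) {X X' B B' : C.Obj}
    (hX : Nonempty (Limits.IsInitial (⟨X⟩ : C.M))) (hX' : Nonempty (Limits.IsInitial (⟨X'⟩ : C.M)))
    (hE : Nonempty (Limits.IsInitial (⟨X⟩ : C.E))) (t : C.HomM X B) (l : C.HomE X X')
    (b : C.HomE B B') (t' : C.HomM X' B') : Mixed C t l b t' :=
  CGW.mixed_initial h.gcgw hX hX' hE t l b t' (h.tr.good_id_top (C := C.tr) b)

theorem mixed_initial_e (h : S.StarAxioms) {X X' B B' : C.Obj}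
    (hX : Nonempty (Limits.IsInitial (⟨X⟩ : C.E))) (hX' : Nonempty (Limits.IsInitial (⟨X'⟩ : C.E)))
    (hE : Nonempty (Limits.IsInitial (⟨X⟩ : C.M))) (t : C.HomE X B) (l : C.HomM X X')
    (b : C.HomM B B') (t' : C.HomE X' B') : Mixed C l t t' b :=
  h.tr.mixed_initial (C := C.tr) hX hX' hE t l b t'

/-- The pullback lemma for good squares. -/
theorem cancel (h : S.StarAxioms) {X₁ X₂ F₁ F₂ G₁ G₂ : C.Obj} {x : C.HomM X₁ X₂}
    {y : C.HomM F₁ F₂} {w : C.HomM G₁ G₂} {s₁ : C.HomM X₁ F₁} {s₂ : C.HomM X₂ F₂}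
    {t₁ : C.HomM F₁ G₁} {t₂ : C.HomM F₂ G₂} (hr : GoodSq S.goodM y t₁ t₂ w)
    (ho : GoodSq S.goodM x (s₁ ≫ t₁) (s₂ ≫ t₂) w) : GoodSq S.goodM x s₁ s₂ y := by
  obtain ⟨X, cx, hcx⟩ := exists_compl_e S x
  obtain ⟨F, cy, hcy⟩ := exists_compl_e S y
  obtain ⟨G, cw, hcw⟩ := exists_compl_e S w
  obtain ⟨v, hv⟩ := hcy.mixed_m h.gcgw hcw hr
  obtain ⟨o, ho'⟩ := hcx.mixed_m h.gcgw hcw ho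
  -- In order to cancel by (PBL), `o` must be factored through `v`. The idea is that `o` meets the
  -- complement `cv` of `v` trivially: a square on `∅` over `s₂ ≫ t₂` is built from initial maps and
  -- the complement of `t₂`, and then restricted along the square of `o`.
  obtain ⟨Z, cv, hcv⟩ := exists_compl_e S v
  obtain ⟨T, ct, hct⟩ := exists_compl_e S t₂
  obtain ⟨u, hu⟩ := hcv.good_e h.gcgw hct hv
  have hzm := h.gcgw.m.zero_initial
  have hze : Nonempty (Limits.IsInitial (⟨S.zero⟩ : C.E)) := h.gcgw.e.zero_initial
  let iM : ∀ A : C.Obj, C.HomM S.zero A := fun A => hzm.some.to _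
  let iE : ∀ A : C.Obj, C.HomE S.zero A := fun A => hze.some.to _
  have m₁ : Mixed C (iM Z) (C.idE _) u (iM T) := h.mixed_initial hzm hzm hze _ _ _ _
  have m₂ : Mixed C (C.idM _) (iE X₂) (iE F₂) s₂ := h.mixed_initial_e hze hze hzm _ _ _ _
  have m₃ : Mixed C (iM T) (iE F₂) ct t₂ := hct.mixed_zero h.gcgw _ _
  have m₄ : Mixed C (iM Z) (iE X ≫ cx) (cv ≫ cw) (s₂ ≫ t₂) :=
    (m₁.vcomp ((m₂.hcomp m₃).congr (Category.id_comp _).symm)).congr rfl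
      (h.gcgw.zero_ext_e _ _) hu.1.symm rfl
  have m₅ : Mixed C (iM Z) (iE X) cv o := h.pbl_v ho' m₄
  -- `∅ → X` is complementary to `id_X` and `cv` to `v`; the resulting good square commutes, which
  -- says that `o = g ≫ v`.
  obtain ⟨g, hg⟩ := (compl_id h.gcgw hze (iE X)).good_m h.gcgw hcv m₅
  have e : o = g ≫ v := by
    have := hg.1
    rw [Category.id_comp] at this
    exact this.symm
  subst e
  obtain ⟨g', hg'⟩ := hcx.good_m h.gcgw hcy (h.pbl hv ho')
  have e₁ : s₁ = g' := by
    apply h.gcgw.cancel_m t₁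
    apply h.gcgw.cancel_m w
    rw [ho.1, Category.assoc, hr.1, ← Category.assoc, ← Category.assoc, hg'.1]
  rw [e₁]
  exact hg'

/-- The legs of a ★-pushout are jointly epic: both maps factor the good square extended along `y`.
-/
theorem star_ext (h : S.StarAxioms) {A B A' P D : C.Obj} {f : C.HomM A B} {g : C.HomM A A'}
    {p : C.HomM B P} {q : C.HomM A' P} (hs : IsStarPushout S.goodM f g p q) {x y : C.HomM P D}
    (e₁ : p ≫ x = p ≫ y) (e₂ : q ≫ x = q ≫ y) : x = y :=
  (hs.desc _ _ (h.extend hs.good y)).unique ⟨e₁, e₂⟩ ⟨rfl, rfl⟩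

theorem star_iso (h : S.StarAxioms) {A B A' P P' : C.Obj} {f : C.HomM A B} {g : C.HomM A A'}
    {p : C.HomM B P} {q : C.HomM A' P} {p' : C.HomM B P'} {q' : C.HomM A' P'}
    (hs : IsStarPushout S.goodM f g p q) (hs' : IsStarPushout S.goodM f g p' q') :
    ∃ x : C.HomM P P', IsIso x ∧ p ≫ x = p' ∧ q ≫ x = q' := by
  obtain ⟨x, ⟨hx₁, hx₂⟩, -⟩ := hs.desc _ _ hs'.good
  obtain ⟨y, ⟨hy₁, hy₂⟩, -⟩ := hs'.desc _ _ hs.good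
  refine ⟨x, ⟨y, h.star_ext hs ?_ ?_, h.star_ext hs' ?_ ?_⟩, hx₁, hx₂⟩
  · rw [← Category.assoc, hx₁, hy₁, Category.comp_id]
  · rw [← Category.assoc, hx₂, hy₂, Category.comp_id]
  · rw [← Category.assoc, hy₁, hx₁, Category.comp_id]
  · rw [← Category.assoc, hy₂, hx₂, Category.comp_id]

theorem star_of_iso (h : S.StarAxioms) {A B A' P P' : C.Obj} {f : C.HomM A B} {g : C.HomM A A'}
    {p : C.HomM B P} {q : C.HomM A' P} (hs : IsStarPushout S.goodM f g p q) (x : C.HomM P P')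
    (hx : IsIso x) {p' : C.HomM B P'} {q' : C.HomM A' P'} (e₁ : p ≫ x = p') (e₂ : q ≫ x = q') :
    IsStarPushout S.goodM f g p' q' := by
  subst e₁ e₂
  refine ⟨h.extend hs.good x, fun p' q' hg => ?_⟩
  obtain ⟨d, ⟨h₁, h₂⟩, -⟩ := hs.desc p' q' hg
  refine ⟨inv x ≫ d, ⟨by simp [h₁], by simp [h₂]⟩, fun y hy => ?_⟩
  rw [IsIso.eq_inv_comp]
  apply h.star_ext hs
  · rw [← Category.assoc, hy.1, h₁]
  · rw [← Category.assoc, hy.2, h₂]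

theorem star_symm (h : S.StarAxioms) {A B A' P : C.Obj} {f : C.HomM A B} {g : C.HomM A A'}
    {p : C.HomM B P} {q : C.HomM A' P} (hs : IsStarPushout S.goodM f g p q) :
    IsStarPushout S.goodM g f q p := by
  refine ⟨h.symm hs.good, fun p' q' hg => ?_⟩
  obtain ⟨d, ⟨h₁, h₂⟩, hu⟩ := hs.desc _ _ (h.symm hg)
  exact ⟨d, ⟨h₂, h₁⟩, fun y hy => hu y ⟨hy.2, hy.1⟩⟩

theorem star_of_good (h : S.StarAxioms) {A B A' D : C.Obj} {f : C.HomM A B} {g : C.HomM A A'}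
    {p : C.HomM B D} {q : C.HomM A' D} (hg : GoodSq S.goodM f g p q) :
    ∃ (P : C.Obj) (s : C.HomM B P) (t : C.HomM A' P) (x : C.HomM P D),
      IsStarPushout S.goodM f g s t ∧ s ≫ x = p ∧ t ≫ x = q := by
  obtain ⟨P, s, t, hs⟩ := h.m.star_exists f g ⟨D, p, q, hg⟩
  obtain ⟨x, ⟨h₁, h₂⟩, -⟩ := hs.desc _ _ hg
  exact ⟨P, s, t, x, hs, h₁, h₂⟩

/-- The induced map on cokernels of a ★-pushout is an isomorphism. -/
theorem star_mixed (h : S.StarAxioms) {A B A' P Z W : C.Obj} {f : C.HomM A B} {g : C.HomM A A'}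
    {p : C.HomM B P} {q : C.HomM A' P} {z : C.HomE Z B} {w : C.HomE W P}
    (hs : IsStarPushout S.goodM f g p q) (hz : Compl S f z) (hw : Compl S q w) :
    ∃ x : C.HomM Z W, IsIso x ∧ Mixed C x z w p := by
  obtain ⟨⟨x, hx, hm⟩, -⟩ := h.m.star_cokernel f g p q hs
  obtain ⟨θ, hθ, e⟩ := hz
  obtain ⟨φ, hφ, e'⟩ := hw
  obtain ⟨y, hy, hym⟩ := S.isos.mixed_of_e_eq θ hθ e.symm
  obtain ⟨y', hy', hym'⟩ := S.isos.mixed_of_e_eq (inv φ) inferInstance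
    (g := S.c.hom q) (g' := w) ((IsIso.eq_inv_comp φ).2 e')
  have hm' : Mixed C x (S.c.hom f) (S.c.hom q) p := hm
  exact ⟨y ≫ x ≫ y', inferInstance, (hym.hcomp (hm'.hcomp hym')).congr rfl rfl rfl
    (by rw [Category.id_comp, Category.comp_id])⟩

/-- Up to the complement isomorphisms the square induces `g` on kernels, so it is distinguished, and
(D) gives an isomorphism between the cokernels of `v` and `d`. With `g` an identity this is the
third isomorphism theorem. -/
theorem isIso_of_mixed (h : S.StarAxioms) {A B P D W W' : C.Obj} {t : C.HomM B P} {q : C.HomM A D}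
    {d : C.HomM P D} {w : C.HomE W P} {w' : C.HomE W' D} {v : C.HomM W W'} {g : C.HomM B A}
    (hw : Compl S t w) (hw' : Compl S q w') (hm : Mixed C v w w' d) (e : g ≫ q = t ≫ d)
    (hg : IsIso g) {X X' : C.Obj} {cv : C.HomE X W'} {cd : C.HomE X' D} (hv : Compl S v cv)
    (hd : Compl S d cd) : ∃ τ : C.HomE X X', IsIso τ ∧ GoodSq S.goodE cv τ w' cd := by
  obtain ⟨α⟩ := hm
  obtain ⟨θ, hθ, e₁⟩ := hw.tr h.gcgw
  obtain ⟨φ, hφ, e₂⟩ := hw'.tr h.gcgw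
  have hki : IsIso (S.tr.c.sqMap (C := C.tr) (f := w) (f' := w') α) :=
    isIso_of_isIso_of_comp (X := C.M) e₁ e₂
      (S.k.sqMap_comm (f := w) (f' := w') α) e (h.gcgw.mono_m _) hθ hφ hg
  have hc : IsIso (S.c.sqMap α) := (h.gcgw.m.distinguished_iff α).2 hki
  obtain ⟨θ', hθ', e₃⟩ := hv
  obtain ⟨φ', hφ', e₄⟩ := hd
  refine ⟨θ' ≫ S.c.sqMap α ≫ inv φ', inferInstance, ?_⟩
  have h₁ : GoodSq S.goodE cv θ' (𝟙 _) (S.c.hom v) :=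
    h.gcgw.tr.good_of_isIso_left (C := C.tr) hθ' (e₃.trans (Category.comp_id _).symm)
  have h₂ : GoodSq S.goodE (S.c.hom d) (inv φ') (𝟙 _) cd :=
    h.gcgw.tr.good_of_isIso_left (C := C.tr) (g := inv φ') inferInstance (f := S.c.hom d)
      (q := cd) (p := 𝟙 _) (by
        refine Eq.trans ?_ (Category.comp_id _).symm
        exact (IsIso.inv_comp_eq φ').2 e₄.symm)
  exact ((h₁.vcomp (S.good_sqMap α)).vcomp h₂).congr rfl (Category.assoc _ _ _).symm
    (by rw [Category.id_comp, Category.comp_id]) rfl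

/-- The cokernel of `v` is `∅`, hence so is that of `d`. -/
theorem isIso_of_isIso_top (h : S.StarAxioms) {A B P D W W' : C.Obj} {t : C.HomM B P}
    {q : C.HomM A D} {d : C.HomM P D} {w : C.HomE W P} {w' : C.HomE W' D} {v : C.HomM W W'}
    {g : C.HomM B A} (hw : Compl S t w) (hw' : Compl S q w') (hm : Mixed C v w w' d)
    (e : g ≫ q = t ≫ d) (hg : IsIso g) (hv : IsIso v) : IsIso d := by
  obtain ⟨X', cd, hd⟩ := exists_compl_e S d
  let z : C.HomE S.zero W' := h.gcgw.e.zero_initial.some.to _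
  have hz : Nonempty (Limits.IsInitial (⟨S.zero⟩ : C.E)) := h.gcgw.e.zero_initial
  have hz' : Compl S v z := (compl_id h.gcgw hz z).iso_m h.gcgw v hv (Category.comp_id v).symm
  obtain ⟨τ, hτ, -⟩ := h.isIso_of_mixed hw hw' hm e hg hz' hd
  exact hd.isIso_m h.gcgw ⟨hz.some.ofIso (asIso τ)⟩

/-- A good square that induces an isomorphism on cokernels is a ★-pushout. -/
theorem star_of_mixed (h : S.StarAxioms) {A B A' D Z W : C.Obj} {f : C.HomM A B}
    {g : C.HomM A A'} {p : C.HomM B D} {q : C.HomM A' D} {z : C.HomE Z B} {w : C.HomE W D}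
    (hg : GoodSq S.goodM f g p q) (hz : Compl S f z) (hw : Compl S q w) {x : C.HomM Z W}
    (hx : IsIso x) (hm : Mixed C x z w p) : IsStarPushout S.goodM f g p q := by
  -- The square is compared with the ★-pushout `P` of its span. By (★) the cokernels of `f` and `t`
  -- agree, so `d : P → D` induces an isomorphism `v` on cokernels relative to `A'`, and therefore
  -- is one itself.
  obtain ⟨P, s, t, d, hs, h₁, h₂⟩ := h.star_of_good hg
  obtain ⟨W', w', hw'⟩ := exists_compl_e S t
  obtain ⟨y, hy, hym⟩ := h.star_mixed hs hz hw'
  obtain ⟨v, hv⟩ := hw'.mixed_m h.gcgw hw (h.gcgw.good_of_isIso_left (g := C.idM A')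
    (inferInstanceAs (IsIso (𝟙 _))) ((Category.id_comp q).trans h₂.symm))
  have e : y ≫ v = x := h.gcgw.mixed_top_unique ((hym.hcomp hv).congr rfl rfl rfl h₁.symm) hm
  have hvi : IsIso v := by
    have : IsIso (y ≫ v) := by rw [e]; exact hx
    exact IsIso.of_isIso_comp_left y v
  exact h.star_of_iso hs d (h.isIso_of_isIso_top hw' hw hv
    ((Category.id_comp q).trans h₂.symm) (inferInstanceAs (IsIso (𝟙 _))) hvi) h₁ h₂

/-- The composite square induces the composite of two isomorphisms on cokernels. -/
theorem star_paste (h : S.StarAxioms) {A B A' P D D' : C.Obj} {f : C.HomM A B} {g : C.HomM A A'}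
    {p : C.HomM B P} {q : C.HomM A' P} {d : C.HomM B D} {e : C.HomM P D'} {k : C.HomM D D'}
    (h₁ : IsStarPushout S.goodM f g p q) (h₂ : IsStarPushout S.goodM d p k e) :
    IsStarPushout S.goodM (f ≫ d) g k (q ≫ e) := by
  obtain ⟨Z, z, hz⟩ := exists_compl_e S g
  obtain ⟨W, w, hw⟩ := exists_compl_e S p
  obtain ⟨W', w', hw'⟩ := exists_compl_e S k
  obtain ⟨x, hx, hxm⟩ := h.star_mixed (h.star_symm h₁) hz hw
  obtain ⟨y, hy, hym⟩ := h.star_mixed (h.star_symm h₂) hw hw'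
  exact h.star_symm (h.star_of_mixed (h.symm (h.hcomp h₁.good h₂.good)) hz hw'
    (x := x ≫ y) inferInstance (hxm.hcomp hym))

theorem pol (h : S.StarAxioms) {A B A' P D D' : C.Obj} {f : C.HomM A B} {g : C.HomM A A'}
    {p : C.HomM B P} {q : C.HomM A' P} {d : C.HomM B D} {e : C.HomM P D'} {k : C.HomM D D'}
    (h₁ : IsStarPushout S.goodM f g p q) (c : d ≫ k = p ≫ e)
    (h₂ : GoodSq S.goodM (f ≫ d) g k (q ≫ e)) : GoodSq S.goodM d p k e :=
  h.m.pushout_lemma f g p q d e k h₁ c h₂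

/-- (POL) makes the right square good; its map on cokernels is an isomorphism by two-out-of-three.
-/
theorem star_paste_right (h : S.StarAxioms) {A B A' P D D' : C.Obj} {f : C.HomM A B}
    {g : C.HomM A A'} {p : C.HomM B P} {q : C.HomM A' P} {d : C.HomM B D} {e : C.HomM P D'}
    {k : C.HomM D D'} (h₁ : IsStarPushout S.goodM f g p q) (c : d ≫ k = p ≫ e)
    (h₂ : IsStarPushout S.goodM (f ≫ d) g k (q ≫ e)) : IsStarPushout S.goodM d p k e := by
  have hg := h.pol h₁ c h₂.good
  obtain ⟨Z, z, hz⟩ := exists_compl_e S g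
  obtain ⟨W, w, hw⟩ := exists_compl_e S p
  obtain ⟨W', w', hw'⟩ := exists_compl_e S k
  obtain ⟨x, hx, hxm⟩ := h.star_mixed (h.star_symm h₁) hz hw
  obtain ⟨y, hy, hym⟩ := h.star_mixed (h.star_symm h₂) hz hw'
  obtain ⟨v, hv⟩ := hw.mixed_m h.gcgw hw' (h.symm hg)
  have e : x ≫ v = y := h.gcgw.mixed_top_unique (hxm.hcomp hv) hym
  have hvi : IsIso v := by
    have : IsIso (x ≫ v) := by rw [e]; exact hy
    exact IsIso.of_isIso_comp_left x v
  exact h.star_symm (h.star_of_mixed (h.symm hg) hw hw' hvi hv)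

/-- ★-pushouts are functorial along good squares. -/
theorem star_map (h : S.StarAxioms) {A B A' P B₂ A₂ A₂' P₂ : C.Obj} {f : C.HomM A B}
    {g : C.HomM A A'} {p : C.HomM B P} {q : C.HomM A' P} {f₂ : C.HomM A₂ B₂}
    {g₂ : C.HomM A₂ A₂'} {p₂ : C.HomM B₂ P₂} {q₂ : C.HomM A₂' P₂} {a : C.HomM A A₂}
    {b : C.HomM B B₂} {c : C.HomM A' A₂'} (hs : IsStarPushout S.goodM f g p q)
    (hg₂ : GoodSq S.goodM f₂ g₂ p₂ q₂) (hf : GoodSq S.goodM f a b f₂) (e : g ≫ c = a ≫ g₂) :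
    ∃ r : C.HomM P P₂, p ≫ r = b ≫ p₂ ∧ q ≫ r = c ≫ q₂ := by
  have h₁ : GoodSq S.goodM f (g ≫ c) (b ≫ p₂) q₂ := (hf.vcomp hg₂).congr rfl e
  obtain ⟨r, hr, -⟩ := hs.desc _ _ (h.symm (h.restrict (h.symm h₁)))
  exact ⟨r, hr⟩

end GCGWData.StarAxioms

end StarPushouts

/-! ## Mixed maps of ★-pushouts -/

section MixedPushouts

variable {C : DoubleCat.{u, v₁, v₂, w}} {S : GCGWData C}

namespace GCGWData.StarAxioms

/-- The complement of the map induced between the complements of the e-sides of a mixed square. -/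
theorem exists_compl_ker (h : S.StarAxioms) {A B B₀ A₁ B₁ K₀ K K₁ : C.Obj}
    {a : C.HomE A B} {β : C.HomM B₀ B} {α₁ : C.HomE A₁ A} {β₁ : C.HomE B₁ B} {u : C.HomE A₁ B₁}
    {κ₀ : C.HomM K₀ B₀} {κ : C.HomM K B} {κ₁ : C.HomM K₁ B₁} {g : C.HomM K₀ K}
    (hβ : Compl S β β₁) (hu : GoodSq S.goodE α₁ u a β₁) (hκ : Compl S κ a)
    (hg : GoodSq S.goodM κ₀ g β κ) (hκ₁ : Compl S κ₁ u) :
    ∃ k : C.HomE K₁ K, Compl S g k ∧ Mixed C κ₁ k β₁ κ := by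
  obtain ⟨k, hk⟩ := hκ₁.mixed_e h.gcgw hκ (h.tr.symm (C := C.tr) hu)
  obtain ⟨K', g', hg'⟩ := exists_compl_m h.gcgw k
  obtain ⟨w, hw⟩ := hg'.good_m h.gcgw hβ hk
  -- The given `g` and the complement `g'` of `k` are both pullbacks of `κ` along `β`, hence
  -- isomorphic over `K`.
  have h₁ := h.isPullback hg
  have h₂ := (h.isPullback hw).flip
  exact ⟨k, hg'.iso_m h.gcgw (h₁.isoIsPullback _ _ h₂).hom inferInstance
    (h₁.isoIsPullback_hom_fst _ _ h₂).symm, hk⟩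

theorem exists_compl_cok (h : S.StarAxioms) {A B B₀ A₁ B₁ K₀ K K₁ : C.Obj}
    {a : C.HomM A B} {β : C.HomE B₀ B} {α₁ : C.HomM A₁ A} {β₁ : C.HomM B₁ B} {u : C.HomM A₁ B₁}
    {κ₀ : C.HomE K₀ B₀} {κ : C.HomE K B} {κ₁ : C.HomE K₁ B₁} {g : C.HomE K₀ K}
    (hβ : Compl S β₁ β) (hu : GoodSq S.goodM α₁ u a β₁) (hκ : Compl S a κ)
    (hg : GoodSq S.goodE κ₀ g β κ) (hκ₁ : Compl S u κ₁) :
    ∃ k : C.HomM K₁ K, Compl S k g ∧ Mixed C k κ₁ κ β₁ := by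
  obtain ⟨k, hk, hm⟩ := h.tr.exists_compl_ker (C := C.tr) (hβ.tr h.gcgw) hu (hκ.tr h.gcgw) hg
    (hκ₁.tr h.gcgw)
  exact ⟨k, hk.untr h.gcgw, hm⟩

theorem isIso_of_good (h : S.StarAxioms) {A B A' B' : C.Obj} {f : C.HomM A B} {g : C.HomM A A'}
    {p : C.HomM B B'} {q : C.HomM A' B'} (hg : GoodSq S.goodM f g p q) (hp : IsIso p) :
    IsIso g := (h.isPullback hg).isIso_fst_of_isIso

theorem isIso_top_of_mixed (h : S.StarAxioms) {A B A' B' : C.Obj} {x : C.HomM A A'}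
    {x' : C.HomM A' A} {y : C.HomM B B'} {a : C.HomE A B} {b : C.HomE A' B'} (hy : IsIso y)
    (h₁ : Mixed C x a b y) (h₂ : Mixed C x' b a (inv y)) : IsIso x :=
  ⟨x', h.gcgw.mixed_top_unique (h₁.hcomp h₂) ((Mixed.id_m a).congr rfl rfl rfl (by simp)),
    h.gcgw.mixed_top_unique (h₂.hcomp h₁) ((Mixed.id_m b).congr rfl rfl rfl (by simp))⟩

/-- A mixed map of ★-pushouts induces a ★-pushout of complements. -/
theorem star_compl (h : S.StarAxioms) {A₀ B₀ C₀ P₀ A B D P A₁ B₁ C₁ R : C.Obj}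
    {f₀ : C.HomM A₀ B₀} {g₀ : C.HomM A₀ C₀} {p₀ : C.HomM B₀ P₀} {q₀ : C.HomM C₀ P₀}
    {f : C.HomM A B} {g : C.HomM A D} {p : C.HomM B P} {q : C.HomM D P}
    (hs₀ : IsStarPushout S.goodM f₀ g₀ p₀ q₀) (hs : IsStarPushout S.goodM f g p q)
    {a : C.HomE A₀ A} {b : C.HomE B₀ B} {c : C.HomE C₀ D} {ν : C.HomE P₀ P}
    (hf : Mixed C f₀ a b f) (hp : Mixed C p₀ b ν p)
    (hq : Mixed C q₀ c ν q) {a₁ : C.HomM A₁ A} {b₁ : C.HomM B₁ B} {c₁ : C.HomM C₁ D}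
    {r : C.HomM R P} (hb : Compl S b₁ b) (hc : Compl S c₁ c)
    (hr : Compl S r ν) {f₁ : C.HomM A₁ B₁} {g₁ : C.HomM A₁ C₁} (hf₁ : GoodSq S.goodM a₁ f₁ f b₁)
    (hg₁ : GoodSq S.goodM a₁ g₁ g c₁) :
    ∃ (p₁ : C.HomM B₁ R) (q₁ : C.HomM C₁ R), GoodSq S.goodM b₁ p₁ p r ∧
      GoodSq S.goodM c₁ q₁ q r ∧ IsStarPushout S.goodM f₁ g₁ p₁ q₁ := by
  obtain ⟨p₁, hp₁⟩ := hb.good_m h.gcgw hr hp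
  obtain ⟨q₁, hq₁⟩ := hc.good_m h.gcgw hr hq
  have good₁ : GoodSq S.goodM f₁ g₁ p₁ q₁ :=
    h.cancel (h.symm hq₁) (((h.symm hf₁).vcomp hs.good).congr rfl hg₁.1 hp₁.1)
  -- It remains to compare cokernels. Those of `f₁` and `q₁` are the complements of the e-morphisms
  -- `ζ : Z₀ → Z` and `ω : W₀ → W`. By (★) the ★-pushouts give isomorphisms `x₀` and `x`, and the
  -- induced map `x₁` is a pullback of `x`.
  obtain ⟨Z₀, z₀, hz₀⟩ := exists_compl_e S f₀
  obtain ⟨Z, z, hz⟩ := exists_compl_e S f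
  obtain ⟨Z₁, z₁, hz₁⟩ := exists_compl_e S f₁
  obtain ⟨W₀, w₀, hw₀⟩ := exists_compl_e S q₀
  obtain ⟨W, w, hw⟩ := exists_compl_e S q
  obtain ⟨W₁, w₁, hw₁⟩ := exists_compl_e S q₁
  obtain ⟨ζ, hζ⟩ := hz₀.good_e h.gcgw hz hf
  obtain ⟨ω, hω⟩ := hw₀.good_e h.gcgw hw hq
  obtain ⟨ζ', hζ', mζ⟩ := h.exists_compl_cok hb hf₁ hz hζ hz₁
  obtain ⟨ω', hω', mω⟩ := h.exists_compl_cok hr hq₁ hw hω hw₁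
  obtain ⟨x, hx, mx⟩ := h.star_mixed hs hz hw
  obtain ⟨x₀, hx₀, mx₀⟩ := h.star_mixed hs₀ hz₀ hw₀
  have m₁ : Mixed C x₀ ζ ω x := h.pbl_v mx ((mx₀.vcomp hp).congr rfl hζ.1 hω.1)
  obtain ⟨x₁, hx₁⟩ := hζ'.good_m h.gcgw hω' m₁
  have m₂ : Mixed C x₁ z₁ w₁ p₁ := h.pbl mω ((mζ.hcomp mx).congr hx₁.1 rfl rfl hp₁.1)
  exact ⟨p₁, q₁, hp₁, hq₁, h.star_of_mixed good₁ hz₁ hw₁ (h.isIso_of_good hx₁ hx) m₂⟩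

/-- A mixed map between ★-pushouts is unique. -/
theorem star_mixed_unique (h : S.StarAxioms) {A₀ B₀ C₀ P₀ A B D P : C.Obj}
    {f₀ : C.HomM A₀ B₀} {g₀ : C.HomM A₀ C₀} {p₀ : C.HomM B₀ P₀} {q₀ : C.HomM C₀ P₀}
    {f : C.HomM A B} {g : C.HomM A D} {p : C.HomM B P} {q : C.HomM D P}
    (hs₀ : IsStarPushout S.goodM f₀ g₀ p₀ q₀) (hs : IsStarPushout S.goodM f g p q)
    {a : C.HomE A₀ A} {b : C.HomE B₀ B} {c : C.HomE C₀ D} {ν ν' : C.HomE P₀ P}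
    (hf : Mixed C f₀ a b f) (hg : Mixed C g₀ a c g) (hp : Mixed C p₀ b ν p)
    (hq : Mixed C q₀ c ν q) (hp' : Mixed C p₀ b ν' p) (hq' : Mixed C q₀ c ν' q) : ν = ν' := by
  obtain ⟨A₁, a₁, ha⟩ := exists_compl_m h.gcgw a
  obtain ⟨B₁, b₁, hb⟩ := exists_compl_m h.gcgw b
  obtain ⟨C₁, c₁, hc⟩ := exists_compl_m h.gcgw c
  obtain ⟨R, r, hr⟩ := exists_compl_m h.gcgw ν
  obtain ⟨R', r', hr'⟩ := exists_compl_m h.gcgw ν'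
  obtain ⟨f₁, hf₁⟩ := ha.good_m h.gcgw hb hf
  obtain ⟨g₁, hg₁⟩ := ha.good_m h.gcgw hc hg
  -- The complements of `ν` and `ν'` are ★-pushouts of one and the same span, hence isomorphic over
  -- `P`. So `ν` and `ν'` differ by an automorphism of `P₀`; read in `M` it fixes both legs and is
  -- the identity.
  obtain ⟨p₁, q₁, e₁, e₂, hs₁⟩ := h.star_compl hs₀ hs hf hp hq hb hc hr hf₁ hg₁
  obtain ⟨p₂, q₂, e₃, e₄, hs₂⟩ := h.star_compl hs₀ hs hf hp' hq' hb hc hr' hf₁ hg₁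
  obtain ⟨θ, hθ, e₅, e₆⟩ := h.star_iso hs₁ hs₂
  have e : r = θ ≫ r' := by
    apply h.star_ext hs₁
    · rw [← Category.assoc, e₅, e₁.1, e₃.1]
    · rw [← Category.assoc, e₆, e₂.1, e₄.1]
  obtain ⟨x, hx, ex⟩ := hr.unique_e (hr'.iso_m h.gcgw θ hθ e)
  obtain ⟨y, hy, hm⟩ := S.isos.mixed_of_e_eq x hx ex
  have e₇ : y = C.idM P₀ := by
    apply h.star_ext hs₀
    · exact (h.gcgw.mixed_top_unique (hp.hcomp hm)
        (hp'.congr rfl rfl rfl (Category.comp_id _))).trans (Category.comp_id _).symm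
    · exact (h.gcgw.mixed_top_unique (hq.hcomp hm)
        (hq'.congr rfl rfl rfl (Category.comp_id _))).trans (Category.comp_id _).symm
  rw [e₇] at hm
  exact S.isos.eq_of_mixed_id hm

/-- The cokernel of the induced map from the ★-pushout of the complements of a mixed map of spans
to the ★-pushout of its target is a ★-pushout of its source. -/
theorem star_of_compl (h : S.StarAxioms) {A₀ B₀ C₀ P₀ A B D P A₁ B₁ C₁ R : C.Obj}
    {f₀ : C.HomM A₀ B₀} {g₀ : C.HomM A₀ C₀} {f : C.HomM A B} {g : C.HomM A D} {p : C.HomM B P}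
    {q : C.HomM D P} (hs : IsStarPushout S.goodM f g p q)
    {a : C.HomE A₀ A} {b : C.HomE B₀ B} {c : C.HomE C₀ D} {ν : C.HomE P₀ P}
    (hf : Mixed C f₀ a b f) (hg : Mixed C g₀ a c g) {a₁ : C.HomM A₁ A} {b₁ : C.HomM B₁ B}
    {c₁ : C.HomM C₁ D} {r : C.HomM R P} (hb : Compl S b₁ b) (hc : Compl S c₁ c)
    (hr : Compl S r ν) {f₁ : C.HomM A₁ B₁} {g₁ : C.HomM A₁ C₁} (hf₁ : GoodSq S.goodM a₁ f₁ f b₁)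
    (hg₁ : GoodSq S.goodM a₁ g₁ g c₁) {p₁ : C.HomM B₁ R} {q₁ : C.HomM C₁ R}
    (hs₁ : IsStarPushout S.goodM f₁ g₁ p₁ q₁) (e₁ : p₁ ≫ r = b₁ ≫ p) (e₂ : q₁ ≫ r = c₁ ≫ q) :
    ∃ (p₀ : C.HomM B₀ P₀) (q₀ : C.HomM C₀ P₀), Mixed C p₀ b ν p ∧ Mixed C q₀ c ν q ∧
      IsStarPushout S.goodM f₀ g₀ p₀ q₀ := by
  -- By (POL) the maps into `r` are good squares, so they turn into mixed squares between the
  -- complements.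
  have hp₁ : GoodSq S.goodM b₁ p₁ p r :=
    h.pol hs₁ e₁.symm ((h.hcomp hg₁ hs.good).congr hf₁.1 rfl rfl e₂)
  have hq₁ : GoodSq S.goodM c₁ q₁ q r :=
    h.pol (h.star_symm hs₁) e₂.symm ((h.hcomp hf₁ (h.symm hs.good)).congr hg₁.1 rfl rfl e₁)
  obtain ⟨p₀, hp⟩ := hb.mixed_m h.gcgw hr hp₁
  obtain ⟨q₀, hq⟩ := hc.mixed_m h.gcgw hr hq₁
  have comm : g₀ ≫ q₀ = f₀ ≫ p₀ := h.gcgw.mixed_top_unique (hg.hcomp hq)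
    ((hf.hcomp hp).congr rfl rfl rfl hs.good.1)
  obtain ⟨Z₀, z₀, hz₀⟩ := exists_compl_e S f₀
  obtain ⟨Z, z, hz⟩ := exists_compl_e S f
  obtain ⟨Z₁, z₁, hz₁⟩ := exists_compl_e S f₁
  obtain ⟨W₀, w₀, hw₀⟩ := exists_compl_e S q₀
  obtain ⟨W, w, hw⟩ := exists_compl_e S q
  obtain ⟨W₁, w₁, hw₁⟩ := exists_compl_e S q₁
  obtain ⟨ζ, hζ⟩ := hz₀.good_e h.gcgw hz hf
  obtain ⟨ω, hω⟩ := hw₀.good_e h.gcgw hw hq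
  obtain ⟨ζ', hζ', mζ⟩ := h.exists_compl_cok hb hf₁ hz hζ hz₁
  obtain ⟨ω', hω', mω⟩ := h.exists_compl_cok hr hq₁ hw hω hw₁
  obtain ⟨x, hx, mx⟩ := h.star_mixed hs hz hw
  obtain ⟨x₁, hx₁, mx₁⟩ := h.star_mixed hs₁ hz₁ hw₁
  have ex : x₁ ≫ ω' = ζ' ≫ x := h.gcgw.mixed_top_unique (mx₁.hcomp mω)
    ((mζ.hcomp mx).congr rfl rfl rfl e₁)
  -- The complements of `ζ'` and `ω'` inherit an isomorphism from `x₁` and `x`; its inverse comes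
  -- from the inverse square.
  obtain ⟨x₀, mx₀⟩ := hζ'.mixed_m h.gcgw hω' (h.gcgw.good_of_isIso_left hx₁ ex)
  obtain ⟨y₀, my₀⟩ := hω'.mixed_m h.gcgw hζ' (h.gcgw.good_of_isIso_left (g := inv x₁)
    inferInstance (p := inv x) (by rw [IsIso.inv_comp_eq, ← Category.assoc, ex, Category.assoc,
      IsIso.hom_inv_id, Category.comp_id]))
  have hx₀ : IsIso x₀ := h.isIso_top_of_mixed hx mx₀ my₀
  have m₀ : Mixed C x₀ z₀ w₀ p₀ :=
    h.pbl_v hp ((mx₀.vcomp mx).congr rfl hζ.1.symm hω.1.symm)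
  -- Goodness of the candidate square is read off from the mixed square on the cokernels of `f₀` and
  -- `q₀`; its left side is `g₀` since `q₀` is monic.
  obtain ⟨g', hg'⟩ := hz₀.good_m h.gcgw hw₀ m₀
  have eg : g' = g₀ := h.gcgw.cancel_m q₀ (hg'.1.trans comm.symm)
  rw [eg] at hg'
  exact ⟨p₀, q₀, hp, hq, h.star_of_mixed hg' hz₀ hw₀ hx₀ m₀⟩

/-- A mixed map of good squares induces a mixed map of ★-pushouts. -/
theorem exists_star_mixed (h : S.StarAxioms) {A₀ B₀ C₀ P₀ D₀ A B D P D' : C.Obj}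
    {f₀ : C.HomM A₀ B₀} {g₀ : C.HomM A₀ C₀} {p₀ : C.HomM B₀ P₀} {q₀ : C.HomM C₀ P₀}
    {f : C.HomM A B} {g : C.HomM A D} {p : C.HomM B P} {q : C.HomM D P}
    (hs₀ : IsStarPushout S.goodM f₀ g₀ p₀ q₀) (hs : IsStarPushout S.goodM f g p q)
    {a : C.HomE A₀ A} {b : C.HomE B₀ B} {c : C.HomE C₀ D} {δ : C.HomE D₀ D'}
    (hf : Mixed C f₀ a b f) {x₀ : C.HomM P₀ D₀} {x : C.HomM P D'}
    (hp : Mixed C (p₀ ≫ x₀) b δ (p ≫ x)) (hq : Mixed C (q₀ ≫ x₀) c δ (q ≫ x)) :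
    ∃ ν : C.HomE P₀ P, Mixed C x₀ ν δ x ∧ Mixed C p₀ b ν p ∧ Mixed C q₀ c ν q := by
  obtain ⟨Z₀, z₀, hz₀⟩ := exists_compl_e S f₀
  obtain ⟨Z, z, hz⟩ := exists_compl_e S f
  obtain ⟨V₀, v₀, hv₀⟩ := exists_compl_e S (q₀ ≫ x₀ : C.HomM C₀ D₀)
  obtain ⟨V, v, hv⟩ := exists_compl_e S (q ≫ x : C.HomM D D')
  obtain ⟨W₀, w₀, hw₀⟩ := exists_compl_e S q₀
  obtain ⟨W, w, hw⟩ := exists_compl_e S q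
  obtain ⟨ξ, hξ, mξ⟩ := h.star_mixed hs hz hw
  obtain ⟨ξ₀, hξ₀, mξ₀⟩ := h.star_mixed hs₀ hz₀ hw₀
  have iid : ∀ X : C.Obj, IsIso (C.idM X) := fun X => inferInstanceAs (IsIso (𝟙 _))
  -- To produce `ν` it suffices to find a good square over `δ` between the cokernels of `x₀` and
  -- `x`. By the third isomorphism theorem the cokernel of `x` is that of `n`, the map from the
  -- cokernel of `q` to that of `q ≫ x`, and (★) identifies the source of `n` with the cokernel of
  -- `f`, where the mixed map is already given.
  obtain ⟨n, mn⟩ := hw.mixed_m h.gcgw hv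
    (h.gcgw.good_of_isIso_left (g := C.idM D) (iid D) (Category.id_comp _))
  obtain ⟨n₀, mn₀⟩ := hw₀.mixed_m h.gcgw hv₀
    (h.gcgw.good_of_isIso_left (g := C.idM C₀) (iid C₀) (Category.id_comp _))
  obtain ⟨ζ, hζ⟩ := hz₀.good_e h.gcgw hz hf
  obtain ⟨φ, hφ⟩ := hv₀.good_e h.gcgw hv hq
  have m₁ : Mixed C (ξ₀ ≫ n₀) ζ φ (ξ ≫ n) :=
    h.pbl_v (mξ.hcomp mn) (((mξ₀.hcomp mn₀).vcomp hp).congr rfl hζ.1 hφ.1)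
  obtain ⟨N, cn, hn⟩ := exists_compl_e S n
  obtain ⟨N₀, cn₀, hn₀⟩ := exists_compl_e S n₀
  obtain ⟨X, cx, hx⟩ := exists_compl_e S x
  obtain ⟨X₀, cx₀, hx₀⟩ := exists_compl_e S x₀
  obtain ⟨τ, hτ, gτ⟩ := h.isIso_of_mixed hw hv mn (Category.id_comp _) (iid D) hn hx
  obtain ⟨τ₀, hτ₀, gτ₀⟩ := h.isIso_of_mixed hw₀ hv₀ mn₀ (Category.id_comp _) (iid C₀) hn₀ hx₀
  obtain ⟨u, hu⟩ := (hn₀.iso_m h.gcgw ξ₀ hξ₀ rfl).good_e h.gcgw (hn.iso_m h.gcgw ξ hξ rfl) m₁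
  have g₁ : GoodSq S.goodE (cn₀ ≫ v₀) u δ (cn ≫ v) := h.tr.hcomp (C := C.tr) hu hφ
  have g₂ : GoodSq S.goodE cx₀ (inv τ₀) (𝟙 _) (cn₀ ≫ v₀) :=
    h.gcgw.tr.good_of_isIso_left (C := C.tr) (g := inv τ₀) inferInstance (f := cx₀)
      (q := cn₀ ≫ v₀) (p := 𝟙 _) (by
        refine Eq.trans ?_ (Category.comp_id _).symm
        exact (IsIso.inv_comp_eq τ₀).2 gτ₀.1.symm)
  have g₃ : GoodSq S.goodE (cn ≫ v) τ (𝟙 _) cx :=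
    h.gcgw.tr.good_of_isIso_left (C := C.tr) hτ (f := cn ≫ v) (q := cx) (p := 𝟙 _)
      (gτ.1.trans (Category.comp_id _).symm)
  have g₄ : GoodSq S.goodE cx₀ ((inv τ₀ ≫ u) ≫ τ) δ cx := ((g₂.vcomp g₁).vcomp g₃).congr rfl rfl
    (by rw [Category.id_comp, Category.comp_id]) rfl
  obtain ⟨ν, hν⟩ := hx₀.mixed_e h.gcgw hx g₄
  exact ⟨ν, hν, h.pbl hν hp, h.pbl hν hq⟩

end GCGWData.StarAxioms

end MixedPushouts

/-! ## Good cubes -/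

section Cubes

variable {C : DoubleCat.{u, v₁, v₂, w}} {S : GCGWData C}

namespace GCGWData.StarAxioms

theorem star_of_isIso (h : S.StarAxioms) {A B D : C.Obj} (f : C.HomM A B) (g : C.HomM A D)
    (hg : IsIso g) : IsStarPushout S.goodM f g (𝟙 _) (inv g ≫ f) := by
  refine ⟨h.gcgw.good_of_isIso_left hg (by simp), fun p' q' hp => ⟨p', ⟨Category.id_comp _, ?_⟩,
    fun y hy => (Category.id_comp y).symm.trans hy.1⟩⟩
  rw [Category.assoc, IsIso.inv_comp_eq, hp.1]

section Cube

variable {X₁ X₂ X₃ X₄ Y₁ Y₂ Y₃ Y₄ : C.Obj}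
  {f : C.HomM X₁ X₂} {g : C.HomM X₁ X₃} {p : C.HomM X₂ X₄} {q : C.HomM X₃ X₄}
  {f' : C.HomM Y₁ Y₂} {g' : C.HomM Y₁ Y₃} {p' : C.HomM Y₂ Y₄} {q' : C.HomM Y₃ Y₄}
  {a : C.HomM X₁ Y₁} {b : C.HomM X₂ Y₂} {c : C.HomM X₃ Y₃} {d : C.HomM X₄ Y₄}

/-- The southern square of a good cube is good for every choice of ★-pushouts. -/
theorem southern (h : S.StarAxioms) (hc : IsGoodCube S.goodM f g p q f' g' p' q' a b c d)
    {P P' : C.Obj} {s : C.HomM X₂ P} {t : C.HomM X₃ P} {s' : C.HomM Y₂ P'} {t' : C.HomM Y₃ P'}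
    {x : C.HomM P X₄} {x' : C.HomM P' Y₄} (hs : IsStarPushout S.goodM f g s t)
    (hs' : IsStarPushout S.goodM f' g' s' t') (e₁ : s ≫ x = p) (e₂ : t ≫ x = q)
    (e₃ : s' ≫ x' = p') (e₄ : t' ≫ x' = q') :
    ∃ r : C.HomM P P', s ≫ r = b ≫ s' ∧ t ≫ r = c ≫ t' ∧ GoodSq S.goodM r x x' d := by
  obtain ⟨⟨Q⟩, ⟨Q'⟩, i, j, i', j', y, y', r, hi, hi', h₁, h₂, h₃, h₄, h₅, h₆, hr⟩ := hc.southern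
  obtain ⟨θ, hθ, h₇, h₈⟩ := h.star_iso hs hi
  obtain ⟨φ, hφ, h₉, h₀⟩ := h.star_iso hi' hs'
  have e₅ : θ ≫ y = x := h.star_ext hs (by rw [← Category.assoc, h₇, h₁, e₁])
    (by rw [← Category.assoc, h₈, h₂, e₂])
  have e₆ : φ ≫ x' = y' := h.star_ext hi' (by rw [← Category.assoc, h₉, h₃, e₃])
    (by rw [← Category.assoc, h₀, h₄, e₄])
  refine ⟨θ ≫ r ≫ φ, ?_, ?_, ?_⟩
  · rw [← Category.assoc, h₇, ← Category.assoc, h₅, Category.assoc, h₉]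
  · rw [← Category.assoc, h₈, ← Category.assoc, h₆, Category.assoc, h₀]
  · have h' : GoodSq S.goodM (θ ≫ r ≫ φ : C.HomM P P') θ (inv φ) r :=
      h.gcgw.good_of_isIso_left hθ (by simp)
    exact (h'.vcomp hr).congr rfl e₅.symm ((IsIso.eq_inv_comp φ).2 e₆)

theorem cube_symm (h : S.StarAxioms) (hc : IsGoodCube S.goodM f g p q f' g' p' q' a b c d) :
    IsGoodCube S.goodM g f q p g' f' q' p' a c b d := by
  obtain ⟨Q, Q', i, j, i', j', y, y', r, hi, hi', h₁, h₂, h₃, h₄, h₅, h₆, hr⟩ := hc.southern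
  exact ⟨h.symm hc.face_left, h.symm hc.face_right, hc.face_g, hc.face_f, hc.face_q, hc.face_p,
    Q, Q', j, i, j', i', y, y', r, h.star_symm hi, h.star_symm hi', h₂, h₁, h₄, h₃, h₆, h₅, hr⟩

/-- Along isomorphisms `g` and `g'` the ★-pushouts are `X₂` and `Y₂`, so the southern square is the
face of `p` and `p'`. -/
theorem cube_of_isIso (h : S.StarAxioms) (hg : IsIso g) (hg' : IsIso g') (e : g ≫ q = f ≫ p)
    (e' : g' ≫ q' = f' ≫ p') (ff : GoodSq S.goodM f a b f') (fg : GoodSq S.goodM g a c g')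
    (fp : GoodSq S.goodM p b d p') (fq : GoodSq S.goodM q c d q') :
    IsGoodCube S.goodM f g p q f' g' p' q' a b c d := by
  refine ⟨h.gcgw.good_of_isIso_left hg e, h.gcgw.good_of_isIso_left hg' e', ff, fg, fp, fq,
    ⟨_⟩, ⟨_⟩, _, _, _, _, p, p', b, h.star_of_isIso f g hg, h.star_of_isIso f' g' hg', Category.id_comp _, ?_,
    Category.id_comp _, ?_, ?_, ?_, h.symm fp⟩
  · rw [Category.assoc, IsIso.inv_comp_eq, e]
  · rw [Category.assoc, IsIso.inv_comp_eq, e']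
  · rw [Category.comp_id, Category.id_comp]
  · rw [Category.assoc, IsIso.inv_comp_eq, ← ff.1, ← Category.assoc, ← fg.1, Category.assoc,
      IsIso.hom_inv_id_assoc]

/-- A good cube is good when its connecting maps are exchanged with a direction of its faces. -/
theorem cube_rotate (h : S.StarAxioms) (hc : IsGoodCube S.goodM f g p q f' g' p' q' a b c d) :
    IsGoodCube S.goodM f a b f' q c d q' g p g' p' := by
  obtain ⟨⟨P⟩, ⟨P'⟩, s, t, s', t', x, x', r, hs, hs', e₁, e₂, e₃, e₄, e₅, e₆, hr⟩ := hc.southern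
  obtain ⟨Q, i, j, y, hi, iy, jy⟩ := h.star_of_good hc.face_f
  obtain ⟨Q', i', j', y', hi', iy', jy'⟩ := h.star_of_good hc.face_q
  -- With `R = P ★_{X₃} Y₃` and `V = P' ★_P X₄`, pasting gives `Q' = X₄ ★_P R`, `V = P' ★_R Q'`, `R
  -- = X₂ ★_{X₁} Y₃ = Q ★_{Y₁} Y₃` and `P' = Y₂ ★_Q R`.
  obtain ⟨R, m, n, ρ, hm, mρ, nρ⟩ := h.star_of_good (h.restrict (hi'.good.congr e₂))
  have s₁ : IsStarPushout S.goodM x m i' ρ := h.star_paste_right hm mρ.symm (by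
    rw [e₂, nρ]; exact hi')
  obtain ⟨V, α, β, z, hV, αz, βz⟩ := h.star_of_good hr
  have ct : GoodSq S.goodM c t t' r := h.cancel hr ((h.symm hc.face_q).congr rfl e₂ e₄)
  obtain ⟨σ, ⟨mσ, nσ⟩, -⟩ := hm.desc _ _ (h.symm ct)
  obtain ⟨τ, ⟨iτ, ρτ⟩, -⟩ := s₁.desc _ _ (h.symm (h.restrict (hV.good.congr mσ)))
  have s₂ : IsStarPushout S.goodM σ ρ α τ := h.star_paste_right (h.star_symm s₁) ρτ.symm (by
    rw [mσ, iτ]; exact hV)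
  have s₃ : IsStarPushout S.goodM (g ≫ c) f n (s ≫ m) :=
    h.star_paste (h.star_symm hs) (h.star_symm hm)
  have s₃' : IsStarPushout S.goodM (a ≫ g') f n (s ≫ m) := by rw [hc.face_g.1]; exact s₃
  obtain ⟨κ, ⟨iκ, jκ⟩, -⟩ := hi.desc _ _ (h.symm (h.restrict s₃'.good))
  have s₄ : IsStarPushout S.goodM g' j n κ := h.star_paste_right (h.star_symm hi) jκ.symm (by
    rw [iκ]; exact s₃')
  have ey : y ≫ s' = κ ≫ σ := by
    apply h.star_ext hi
    · rw [← Category.assoc, iy, ← Category.assoc, iκ, Category.assoc, mσ, e₅]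
    · rw [← Category.assoc, jy, ← Category.assoc, jκ, Category.assoc, nσ, hs'.good.1]
  have s₅ : IsStarPushout S.goodM y κ s' σ := h.star_paste_right (h.star_symm s₄) ey (by
    rw [jy, nσ]; exact hs')
  -- Hence `V = Y₂ ★_Q Q'`. The southern square of the rotated cube is this ★-pushout extended along
  -- `z : V → Y₄`.
  have s₆ : IsStarPushout S.goodM (κ ≫ ρ) y τ (s' ≫ α) :=
    h.star_paste (h.star_symm s₅) (h.star_symm s₂)
  have ez : τ ≫ z = y' := by
    apply h.star_ext hi'
    · rw [← Category.assoc, iτ, βz, iy']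
    · rw [← nρ, Category.assoc, Category.assoc, ← Category.assoc ρ τ z, ρτ, Category.assoc, αz,
        ← Category.assoc, nσ, e₄, ← jy', ← nρ, Category.assoc]
  refine ⟨hc.face_f, hc.face_q, hc.face_left, h.symm hc.face_g, h.symm hc.face_p, hc.face_right,
    ⟨Q⟩, ⟨Q'⟩, i, j, i', j', y, y', κ ≫ ρ, hi, hi', iy, jy, iy', jy', ?_, ?_, ?_⟩
  · rw [← Category.assoc, iκ, Category.assoc, mρ, ← Category.assoc, e₁]
  · rw [← Category.assoc, jκ, Category.assoc, nρ]
  · exact (h.extend s₆.good z).congr rfl rfl ez.symm (by rw [Category.assoc, αz, e₃])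

end Cube

/-- Good cubes compose. -/
theorem cube_vcomp (h : S.StarAxioms) {X₁ X₂ X₃ X₄ X₅ X₆ Y₁ Y₂ Y₃ Y₄ Y₅ Y₆ : C.Obj}
    {f : C.HomM X₁ X₂} {g : C.HomM X₁ X₃} {p : C.HomM X₂ X₄} {q : C.HomM X₃ X₄}
    {f' : C.HomM Y₁ Y₂} {g' : C.HomM Y₁ Y₃} {p' : C.HomM Y₂ Y₄} {q' : C.HomM Y₃ Y₄}
    {a : C.HomM X₁ Y₁} {b : C.HomM X₂ Y₂} {c : C.HomM X₃ Y₃} {d : C.HomM X₄ Y₄}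
    {g₂ : C.HomM X₃ X₅} {p₂ : C.HomM X₄ X₆} {q₂ : C.HomM X₅ X₆}
    {g₂' : C.HomM Y₃ Y₅} {p₂' : C.HomM Y₄ Y₆} {q₂' : C.HomM Y₅ Y₆}
    {e : C.HomM X₅ Y₅} {k : C.HomM X₆ Y₆}
    (h₁ : IsGoodCube S.goodM f g p q f' g' p' q' a b c d)
    (h₂ : IsGoodCube S.goodM q g₂ p₂ q₂ q' g₂' p₂' q₂' c d e k) :
    IsGoodCube S.goodM f (g ≫ g₂) (p ≫ p₂) q₂ f' (g' ≫ g₂') (p' ≫ p₂') q₂' a b e k := by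
  obtain ⟨⟨P⟩, ⟨P'⟩, s, t, s', t', x, x', r, hs, hs', sx, tx, sx', tx', sr, tr, hr⟩ :=
    h₁.southern
  obtain ⟨⟨Q⟩, ⟨Q'⟩, u, v, u', v', y, y', ρ, hu, hu', uy, vy, uy', vy', uρ, vρ, hρ⟩ :=
    h₂.southern
  -- `U = P ★_{X₃} X₅` is the ★-pushout for the composite face, and it maps to `X₆` through `Q = X₄
  -- ★_P U`. So the new southern square is the square from `w` to `w'`, pasted with the southern
  -- square of the second cube.
  obtain ⟨U, m, n, w, hm, mw, nw⟩ := h.star_of_good (h.restrict (hu.good.congr tx))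
  obtain ⟨U', m', n', w', hm', mw', nw'⟩ := h.star_of_good (h.restrict (hu'.good.congr tx'))
  have s₁ : IsStarPushout S.goodM f (g ≫ g₂) (s ≫ m) n :=
    h.star_symm (h.star_paste (h.star_symm hs) (h.star_symm hm))
  have s₁' : IsStarPushout S.goodM f' (g' ≫ g₂') (s' ≫ m') n' :=
    h.star_symm (h.star_paste (h.star_symm hs') (h.star_symm hm'))
  have ct : GoodSq S.goodM c t t' r := h.cancel hr ((h.symm h₁.face_q).congr rfl tx tx')
  obtain ⟨ρU, mρ, nρ⟩ := h.star_map hm hm'.good (h.symm ct) h₂.face_g.1.symm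
  have eU : ρU ≫ w' = w ≫ ρ := by
    apply h.star_ext hm
    · rw [← Category.assoc, mρ, Category.assoc, mw', ← Category.assoc, ← hr.1, ← Category.assoc,
        mw, Category.assoc, Category.assoc, uρ]
    · rw [← Category.assoc, nρ, Category.assoc, nw', ← Category.assoc, nw, vρ]
  have s₂ : IsStarPushout S.goodM x m u w := h.star_paste_right hm mw.symm (by
    rw [tx, nw]; exact hu)
  have s₂' : IsStarPushout S.goodM x' m' u' w' := h.star_paste_right hm' mw'.symm (by
    rw [tx', nw']; exact hu')
  -- (POL) for `Q = X₄ ★_P U`: the outer square is the southern square of the first cube pasted with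
  -- a ★-pushout.
  have g₁ : GoodSq S.goodM ρU w w' ρ := h.pol (h.star_symm s₂) eU
    ((h.hcomp hr (h.symm s₂'.good)).congr mρ rfl rfl uρ)
  refine ⟨h₁.face_left.vcomp h₂.face_left, h₁.face_right.vcomp h₂.face_right, h₁.face_f,
    h.hcomp h₁.face_g h₂.face_g, h.hcomp h₁.face_p h₂.face_p, h₂.face_q, ⟨U⟩, ⟨U'⟩, s ≫ m, n,
    s' ≫ m', n', w ≫ y, w' ≫ y', ρU, s₁, s₁', ?_, ?_, ?_, ?_, ?_, nρ, g₁.vcomp hρ⟩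
  · rw [Category.assoc, ← Category.assoc m w y, mw, Category.assoc, uy, ← Category.assoc, sx]
  · rw [← Category.assoc, nw, vy]
  · rw [Category.assoc, ← Category.assoc m' w' y', mw', Category.assoc, uy', ← Category.assoc, sx']
  · rw [← Category.assoc, nw', vy']
  · rw [Category.assoc, mρ, ← Category.assoc, sr, Category.assoc]

/-- The cube version of (POL). -/
theorem cube_pol (h : S.StarAxioms) {A B A' P D D' A₂ B₂ A₂' P₂ D₂ D₂' : C.Obj}
    {f : C.HomM A B} {g : C.HomM A A'} {p : C.HomM B P} {q : C.HomM A' P} {d : C.HomM B D}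
    {e : C.HomM P D'} {k : C.HomM D D'} {f₂ : C.HomM A₂ B₂} {g₂ : C.HomM A₂ A₂'}
    {p₂ : C.HomM B₂ P₂} {q₂ : C.HomM A₂' P₂} {d₂ : C.HomM B₂ D₂}
    {e₂ : C.HomM P₂ D₂'} {k₂ : C.HomM D₂ D₂'} {xA : C.HomM A A₂} {xB : C.HomM B B₂}
    {xA' : C.HomM A' A₂'} {xP : C.HomM P P₂} {xD : C.HomM D D₂} {xD' : C.HomM D' D₂'}
    (hs : IsStarPushout S.goodM f g p q) (hs₂ : IsStarPushout S.goodM f₂ g₂ p₂ q₂)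
    (c : d ≫ k = p ≫ e) (c₂ : d₂ ≫ k₂ = p₂ ≫ e₂)
    (ho : IsGoodCube S.goodM (f ≫ d) g k (q ≫ e) (f₂ ≫ d₂) g₂ k₂ (q₂ ≫ e₂) xA xD xA' xD')
    (hd : GoodSq S.goodM d xB xD d₂) (hp : GoodSq S.goodM p xB xP p₂)
    (hk : GoodSq S.goodM k xD xD' k₂) (he : GoodSq S.goodM e xP xD' e₂)
    (hq : xA' ≫ q₂ = q ≫ xP) :
    IsGoodCube S.goodM d p k e d₂ p₂ k₂ e₂ xB xD xP xD' := by
  have g₁ := h.pol hs c ho.face_left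
  have g₂ := h.pol hs₂ c₂ ho.face_right
  obtain ⟨U, m, n, x, hm, mx, nx⟩ := h.star_of_good g₁
  obtain ⟨U', m', n', x', hm', mx', nx'⟩ := h.star_of_good g₂
  -- By pasting, the ★-pushout of `d` and `p` is one of `f ≫ d` and `g`, so the southern square of
  -- the outer cube serves for the right cube.
  obtain ⟨r, mr, nr, hr⟩ := h.southern ho (h.star_paste hs hm) (h.star_paste hs₂ hm') mx
    (by rw [Category.assoc, nx]) mx' (by rw [Category.assoc, nx'])
  refine ⟨g₁, g₂, hd, hp, hk, he, ⟨U⟩, ⟨U'⟩, m, n, m', n', x, x', r, hm, hm', mx, nx, mx', nx', mr,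
    ?_, hr⟩
  apply h.star_ext hs
  · rw [← Category.assoc, hm.good.1, Category.assoc, mr, ← Category.assoc, ← hd.1, Category.assoc,
      ← hm'.good.1, ← Category.assoc, hp.1, Category.assoc]
  · rw [← Category.assoc, nr, ← Category.assoc, hq, Category.assoc]

/-- A mixed map of good squares induces a good cube of complements. -/
theorem cube_of_mixed (h : S.StarAxioms) {A₀ B₀ C₀ D₀ A B D E A₁ B₁ C₁ D₁ : C.Obj}
    {f₀ : C.HomM A₀ B₀} {g₀ : C.HomM A₀ C₀} {d₀ : C.HomM B₀ D₀} {e₀ : C.HomM C₀ D₀}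
    {f : C.HomM A B} {g : C.HomM A D} {d : C.HomM B E} {e : C.HomM D E}
    {f₁ : C.HomM A₁ B₁} {g₁ : C.HomM A₁ C₁} {d₁ : C.HomM B₁ D₁} {e₁ : C.HomM C₁ D₁}
    {a : C.HomE A₀ A} {b : C.HomE B₀ B} {c : C.HomE C₀ D} {δ : C.HomE D₀ E}
    {a₁ : C.HomM A₁ A} {b₁ : C.HomM B₁ B} {c₁ : C.HomM C₁ D} {δ₁ : C.HomM D₁ E}
    (h₀ : GoodSq S.goodM f₀ g₀ d₀ e₀) (hg : GoodSq S.goodM f g d e)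
    (hf : Mixed C f₀ a b f) (hd : Mixed C d₀ b δ d)
    (he : Mixed C e₀ c δ e) (hb : Compl S b₁ b) (hc : Compl S c₁ c)
    (hδ : Compl S δ₁ δ) (hf₁ : GoodSq S.goodM a₁ f₁ f b₁) (hg₁ : GoodSq S.goodM a₁ g₁ g c₁)
    (hd₁ : GoodSq S.goodM b₁ d₁ d δ₁) (he₁ : GoodSq S.goodM c₁ e₁ e δ₁) :
    IsGoodCube S.goodM f₁ g₁ d₁ e₁ f g d e a₁ b₁ c₁ δ₁ := by
  obtain ⟨P₀, p₀, q₀, x₀, hs₀, rfl, rfl⟩ := h.star_of_good h₀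
  obtain ⟨P, p, q, x, hs, rfl, rfl⟩ := h.star_of_good hg
  -- The complement of the induced map `ν` of ★-pushouts is the ★-pushout `R` of the complements,
  -- and the mixed square from `ν` to `δ` becomes the southern square.
  obtain ⟨ν, hν, hp, hq⟩ := h.exists_star_mixed hs₀ hs hf hd he
  obtain ⟨R, r, hr⟩ := exists_compl_m h.gcgw ν
  obtain ⟨p₁, q₁, hp₁, hq₁, hs₁⟩ := h.star_compl hs₀ hs hf hp hq hb hc hr hf₁ hg₁
  obtain ⟨x₁, hx₁⟩ := hr.good_m h.gcgw hδ hν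
  have i₁ : p₁ ≫ x₁ = d₁ := by
    apply h.gcgw.cancel_m δ₁
    rw [Category.assoc, hx₁.1, ← Category.assoc, hp₁.1, hd₁.1, Category.assoc]
  have i₂ : q₁ ≫ x₁ = e₁ := by
    apply h.gcgw.cancel_m δ₁
    rw [Category.assoc, hx₁.1, ← Category.assoc, hq₁.1, he₁.1, Category.assoc]
  exact ⟨(h.extend hs₁.good x₁).congr rfl rfl i₁.symm i₂.symm, hg, h.symm hf₁, h.symm hg₁,
    h.symm hd₁, h.symm he₁, ⟨R⟩, ⟨P⟩, p₁, q₁, p, q, x₁, x, r, hs₁, hs, i₁, i₂, rfl, rfl, hp₁.1,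
    hq₁.1, hx₁⟩

/-- If the cube of complements of a mixed map of squares is good, then its source is good. -/
theorem good_of_cube (h : S.StarAxioms) {A₀ B₀ C₀ D₀ A B D E A₁ B₁ C₁ D₁ : C.Obj}
    {f₀ : C.HomM A₀ B₀} {g₀ : C.HomM A₀ C₀} {d₀ : C.HomM B₀ D₀} {e₀ : C.HomM C₀ D₀}
    {f : C.HomM A B} {g : C.HomM A D} {d : C.HomM B E} {e : C.HomM D E}
    {f₁ : C.HomM A₁ B₁} {g₁ : C.HomM A₁ C₁} {d₁ : C.HomM B₁ D₁} {e₁ : C.HomM C₁ D₁}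
    {a : C.HomE A₀ A} {b : C.HomE B₀ B} {c : C.HomE C₀ D} {δ : C.HomE D₀ E}
    {a₁ : C.HomM A₁ A} {b₁ : C.HomM B₁ B} {c₁ : C.HomM C₁ D} {δ₁ : C.HomM D₁ E}
    (hf : Mixed C f₀ a b f) (hg : Mixed C g₀ a c g) (hd : Mixed C d₀ b δ d)
    (he : Mixed C e₀ c δ e) (hb : Compl S b₁ b) (hc : Compl S c₁ c) (hδ : Compl S δ₁ δ)
    (hcube : IsGoodCube S.goodM f₁ g₁ d₁ e₁ f g d e a₁ b₁ c₁ δ₁) :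
    GoodSq S.goodM f₀ g₀ d₀ e₀ := by
  obtain ⟨⟨R⟩, ⟨P⟩, p₁, q₁, p, q, x₁, x, r, hs₁, hs, i₁, i₂, i₃, i₄, i₅, i₆, hr⟩ := hcube.southern
  -- The cokernel of the southern map `r` is a ★-pushout of the source span, and goodness of the
  -- southern square makes it map to `D₀`.
  obtain ⟨P₀, π, hπ⟩ := exists_compl_e S r
  obtain ⟨p₀, q₀, hp, hq, hs₀⟩ := h.star_of_compl hs hf hg hb hc hπ (h.symm hcube.face_f)
    (h.symm hcube.face_g) hs₁ i₅ i₆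
  obtain ⟨x₀, hx₀⟩ := hπ.mixed_m h.gcgw hδ hr
  have j₁ : p₀ ≫ x₀ = d₀ := h.gcgw.mixed_top_unique (hp.hcomp hx₀) (hd.congr rfl rfl rfl i₃)
  have j₂ : q₀ ≫ x₀ = e₀ := h.gcgw.mixed_top_unique (hq.hcomp hx₀) (he.congr rfl rfl rfl i₄)
  exact (h.extend hs₀.good x₀).congr rfl rfl j₁.symm j₂.symm

end GCGWData.StarAxioms

end Cubes

/-! ## Models of the double category of double functors -/

section Models

variable {D : DoubleCat.{u', v₁', v₂', w'}} {C : DoubleCat.{u, v₁, v₂, w}}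

theorem DoubleFunctor.mixed (F : DoubleFunctor D C) {A B A' B' : D.Obj} {f : D.HomM A B}
    {a : D.HomE A A'} {b : D.HomE B B'} {f' : D.HomM A' B'} (α : D.Sq f a b f') :
    Mixed C (F.mapM f) (F.mapE a) (F.mapE b) (F.mapM f') := ⟨F.mapSq α⟩

/-- A double functor into a double category whose squares are determined by their boundaries. -/
noncomputable def DoubleFunctor.ofMixed
    (hC : ∀ {A B A' B' : C.Obj} (f : C.HomM A B) (a : C.HomE A A') (b : C.HomE B B')
      (f' : C.HomM A' B'), Subsingleton (C.Sq f a b f'))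
    (obj : D.Obj → C.Obj) (mapM : ∀ {A B : D.Obj}, D.HomM A B → C.HomM (obj A) (obj B))
    (mapE : ∀ {A B : D.Obj}, D.HomE A B → C.HomE (obj A) (obj B))
    (mapM_id : ∀ A : D.Obj, mapM (D.idM A) = C.idM (obj A))
    (mapE_id : ∀ A : D.Obj, mapE (D.idE A) = C.idE (obj A))
    (mapM_comp : ∀ {X Y Z : D.Obj} (f : D.HomM X Y) (g : D.HomM Y Z),
      mapM (f ≫ g) = mapM f ≫ mapM g)
    (mapE_comp : ∀ {X Y Z : D.Obj} (f : D.HomE X Y) (g : D.HomE Y Z),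
      mapE (f ≫ g) = mapE f ≫ mapE g)
    (hm : ∀ {A B A' B' : D.Obj} {f : D.HomM A B} {a : D.HomE A A'} {b : D.HomE B B'}
      {f' : D.HomM A' B'}, D.Sq f a b f' → Mixed C (mapM f) (mapE a) (mapE b) (mapM f')) :
    DoubleFunctor D C where
  obj := obj
  mapM := mapM
  mapE := mapE
  mapSq α := (hm α).some
  mapM_id := mapM_id
  mapE_id := mapE_id
  mapM_comp := mapM_comp
  mapE_comp := mapE_comp
  mapSq_hId {A A'} _ := sq_heq hC _ _ (mapM_id A) rfl rfl (mapM_id A')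
  mapSq_vId {A A'} _ := sq_heq hC _ _ rfl (mapE_id A) (mapE_id A') rfl
  mapSq_hComp {_ _ _ _ _ _ f g _ _ _ f' g'} _ _ :=
    sq_heq hC _ _ (mapM_comp f g) rfl rfl (mapM_comp f' g')
  mapSq_vComp {_ _ _ _ _ _ _ _ _ a b a' b'} _ _ :=
    sq_heq hC _ _ rfl (mapE_comp a a') (mapE_comp b b') rfl

/-- An m-natural transformation into a double category whose squares are determined by their
boundaries. -/
noncomputable def MNatTrans.ofMixed
    (hC : ∀ {A B A' B' : C.Obj} (f : C.HomM A B) (a : C.HomE A A') (b : C.HomE B B')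
      (f' : C.HomM A' B'), Subsingleton (C.Sq f a b f')) {F G : DoubleFunctor D C}
    (app : ∀ A : D.Obj, C.HomM (F.obj A) (G.obj A))
    (naturality : ∀ {A B : D.Obj} (f : D.HomM A B), F.mapM f ≫ app B = app A ≫ G.mapM f)
    (hm : ∀ {A A' : D.Obj} (a : D.HomE A A'), Mixed C (app A) (F.mapE a) (G.mapE a) (app A')) :
    MNatTrans F G where
  app := app
  sq a := (hm a).some
  sq_id A := sq_heq hC _ _ rfl (F.mapE_id A) (G.mapE_id A) rfl
  sq_comp a a' := sq_heq hC _ _ rfl (F.mapE_comp a a') (G.mapE_comp a a') rfl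
  naturality := naturality
  naturality_sq {_ _ _ _ f _ _ f'} _ := sq_heq hC _ _ (naturality f) rfl rfl (naturality f')

/-- A double category `X` is a model of `C^D`, via a surjection `ob` from its objects to the
double functors `D → C`, if its m-morphisms, e-morphisms and squares are those of `C^D`. -/
structure Model (S : GCGWData C) (D : DoubleCat.{u', v₁', v₂', w'})
    {X : DoubleCat.{u'', v₁'', v₂'', w''}} (ob : X.Obj → DoubleFunctor D C) where
  appM : ∀ {A B : X.Obj}, X.HomM A B → ∀ i : D.Obj, C.HomM ((ob A).obj i) ((ob B).obj i)
  appE : ∀ {A B : X.Obj}, X.HomE A B → ∀ i : D.Obj, C.HomE ((ob A).obj i) ((ob B).obj i)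
  appM_id : ∀ (A : X.Obj) (i : D.Obj), appM (X.idM A) i = C.idM ((ob A).obj i)
  appE_id : ∀ (A : X.Obj) (i : D.Obj), appE (X.idE A) i = C.idE ((ob A).obj i)
  appM_comp : ∀ {A B A' : X.Obj} (f : X.HomM A B) (g : X.HomM B A') (i : D.Obj),
    appM (f ≫ g) i = appM f i ≫ appM g i
  appE_comp : ∀ {A B A' : X.Obj} (f : X.HomE A B) (g : X.HomE B A') (i : D.Obj),
    appE (f ≫ g) i = appE f i ≫ appE g i
  extM : ∀ {A B : X.Obj} {f g : X.HomM A B}, (∀ i, appM f i = appM g i) → f = g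
  extE : ∀ {A B : X.Obj} {f g : X.HomE A B}, (∀ i, appE f i = appE g i) → f = g
  goodM : ∀ {A B : X.Obj} (f : X.HomM A B) {i j : D.Obj} (k : D.HomM i j),
    GoodSq S.goodM ((ob A).mapM k) (appM f i) (appM f j) ((ob B).mapM k)
  goodE : ∀ {A B : X.Obj} (f : X.HomE A B) {i j : D.Obj} (e : D.HomE i j),
    GoodSq S.goodE ((ob A).mapE e) (appE f i) (appE f j) ((ob B).mapE e)
  mixedM : ∀ {A B : X.Obj} (f : X.HomM A B) {i j : D.Obj} (e : D.HomE i j),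
    Mixed C (appM f i) ((ob A).mapE e) ((ob B).mapE e) (appM f j)
  mixedE : ∀ {A B : X.Obj} (f : X.HomE A B) {i j : D.Obj} (k : D.HomM i j),
    Mixed C ((ob A).mapM k) (appE f i) (appE f j) ((ob B).mapM k)
  liftM : ∀ {A B : X.Obj} (x : ∀ i : D.Obj, C.HomM ((ob A).obj i) ((ob B).obj i)),
    (∀ {i j : D.Obj} (k : D.HomM i j), GoodSq S.goodM ((ob A).mapM k) (x i) (x j) ((ob B).mapM k)) →
    (∀ {i j : D.Obj} (e : D.HomE i j), Mixed C (x i) ((ob A).mapE e) ((ob B).mapE e) (x j)) →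
    ∃ f : X.HomM A B, ∀ i, appM f i = x i
  liftE : ∀ {A B : X.Obj} (x : ∀ i : D.Obj, C.HomE ((ob A).obj i) ((ob B).obj i)),
    (∀ {i j : D.Obj} (e : D.HomE i j), GoodSq S.goodE ((ob A).mapE e) (x i) (x j) ((ob B).mapE e)) →
    (∀ {i j : D.Obj} (k : D.HomM i j), Mixed C ((ob A).mapM k) (x i) (x j) ((ob B).mapM k)) →
    ∃ f : X.HomE A B, ∀ i, appE f i = x i
  mixed_app : ∀ {A B A' B' : X.Obj} {f : X.HomM A B} {a : X.HomE A A'} {b : X.HomE B B'}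
    {f' : X.HomM A' B'}, Mixed X f a b f' → ∀ i, Mixed C (appM f i) (appE a i) (appE b i) (appM f' i)
  mixed_of_app : ∀ {A B A' B' : X.Obj} {f : X.HomM A B} {a : X.HomE A A'} {b : X.HomE B B'}
    {f' : X.HomM A' B'}, (∀ i, Mixed C (appM f i) (appE a i) (appE b i) (appM f' i)) →
    Mixed X f a b f'
  sq_sub : ∀ {A B A' B' : X.Obj} (f : X.HomM A B) (a : X.HomE A A') (b : X.HomE B B')
    (f' : X.HomM A' B'), Subsingleton (X.Sq f a b f')
  surj : ∀ F : DoubleFunctor D C, ∃ A : X.Obj, ob A = F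

namespace Model

variable {S : GCGWData C} {X : DoubleCat.{u'', v₁'', v₂'', w''}} {ob : X.Obj → DoubleFunctor D C}

/-- The transpose of a model. -/
def tr (m : Model S D ob) : Model (C := C.tr) (X := X.tr) S.tr D.tr (fun A => (ob A).tr) where
  appM := m.appE
  appE := m.appM
  appM_id := m.appE_id
  appE_id := m.appM_id
  appM_comp := m.appE_comp
  appE_comp := m.appM_comp
  extM := m.extE
  extE := m.extM
  goodM := m.goodE
  goodE := m.goodM
  mixedM := m.mixedE
  mixedE := m.mixedM
  liftM := m.liftE
  liftE := m.liftM
  mixed_app h := m.mixed_app h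
  mixed_of_app h := m.mixed_of_app h
  sq_sub f a b f' := m.sq_sub a f f' b
  surj F := (m.surj (DoubleFunctor.tr (D := D.tr) (C := C.tr) F)).imp fun A hA => by
    rw [hA]; rfl

/-- The squares of m-morphisms whose component cubes are good. -/
def cubes (m : Model S D ob) : MorphismProperty (Arrow X.M) := fun F G φ =>
  ∀ {i j : D.Obj} (k : D.HomM i j),
    IsGoodCube S.goodM (m.appM F.hom i) (m.appM φ.left i) (m.appM φ.right i) (m.appM G.hom i)
      (m.appM F.hom j) (m.appM φ.left j) (m.appM φ.right j) (m.appM G.hom j)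
      ((ob F.left.obj).mapM k) ((ob F.right.obj).mapM k)
      ((ob G.left.obj).mapM k) ((ob G.right.obj).mapM k)

variable (m : Model S D ob) (h : S.StarAxioms)

theorem comm_iff {A B A' B' : X.Obj} {f : X.HomM A B} {g : X.HomM A A'} {p : X.HomM B B'}
    {q : X.HomM A' B'} :
    g ≫ q = f ≫ p ↔ ∀ i, m.appM g i ≫ m.appM q i = m.appM f i ≫ m.appM p i := by
  constructor
  · intro e i
    rw [← m.appM_comp, e, m.appM_comp]
  · intro e
    exact m.extM fun i => by rw [m.appM_comp, m.appM_comp, e]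

/-- Commutativity need not be assumed: the cube at an identity of `D` contains the component square
as a face. -/
theorem good_iff {A B A' B' : X.Obj} {f : X.HomM A B} {g : X.HomM A A'} {p : X.HomM B B'}
    {q : X.HomM A' B'} : GoodSq m.cubes f g p q ↔ ∀ {i j : D.Obj} (k : D.HomM i j),
    IsGoodCube S.goodM (m.appM f i) (m.appM g i) (m.appM p i) (m.appM q i)
      (m.appM f j) (m.appM g j) (m.appM p j) (m.appM q j)
      ((ob A).mapM k) ((ob B).mapM k) ((ob A').mapM k) ((ob B').mapM k) :=
  ⟨fun hg => hg.2, fun hc => ⟨m.comm_iff.2 fun i => (hc (D.idM i)).face_left.1, hc⟩⟩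

theorem good_app {A B A' B' : X.Obj} {f : X.HomM A B} {g : X.HomM A A'} {p : X.HomM B B'}
    {q : X.HomM A' B'} (hg : GoodSq m.cubes f g p q) (i : D.Obj) :
    GoodSq S.goodM (m.appM f i) (m.appM g i) (m.appM p i) (m.appM q i) :=
  (m.good_iff.1 hg (D.idM i)).face_left

include m h

/-- A pointwise family of isomorphisms that is natural is a morphism. -/
theorem exists_of_isIso {A B : X.Obj} (x : ∀ i : D.Obj, C.HomM ((ob A).obj i) ((ob B).obj i))
    (hx : ∀ i, IsIso (x i))
    (nat : ∀ {i j : D.Obj} (k : D.HomM i j), x i ≫ (ob B).mapM k = (ob A).mapM k ≫ x j)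
    (hm : ∀ {i j : D.Obj} (e : D.HomE i j), Mixed C (x i) ((ob A).mapE e) ((ob B).mapE e) (x j)) :
    ∃ f : X.HomM A B, ∀ i, m.appM f i = x i :=
  m.liftM x (fun k => h.gcgw.good_of_isIso_left (hx _) (nat k)) hm

/-- The pointwise inverse is m- and e-natural, and naturality squares of isomorphisms are weak
triangles, hence good. -/
theorem isIso_iff {A B : X.Obj} (f : X.HomM A B) : IsIso f ↔ ∀ i, IsIso (m.appM f i) := by
  constructor
  · intro hf i
    refine ⟨m.appM (inv f) i, ?_, ?_⟩
    · rw [← m.appM_comp, IsIso.hom_inv_id]; exact m.appM_id A i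
    · rw [← m.appM_comp, IsIso.inv_hom_id]; exact m.appM_id B i
  · intro hf
    obtain ⟨g, hg⟩ := m.exists_of_isIso h (A := B) (B := A) (fun i => inv (m.appM f i))
      (fun i => inferInstance)
      (fun k => by
        rw [IsIso.inv_comp_eq, ← Category.assoc, (m.goodM f k).1, Category.assoc,
          IsIso.hom_inv_id, Category.comp_id])
      (fun e => S.isos.mixed_inv_m (hf _) (hf _) (m.mixedM f e))
    exact ⟨g, m.extM fun i => by rw [m.appM_comp, hg, IsIso.hom_inv_id]; exact (m.appM_id A i).symm,
      m.extM fun i => by rw [m.appM_comp, hg, IsIso.inv_hom_id]; exact (m.appM_id B i).symm⟩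

theorem mono {A B : X.Obj} (f : X.HomM A B) : Mono f :=
  ⟨fun {_} u v e => m.extM fun i => h.gcgw.cancel_m (m.appM f i) (by
    rw [← m.appM_comp, e, m.appM_comp])⟩

/-- A pointwise factorization through an m-morphism is a factorization. -/
theorem exists_over {A A' B : X.Obj} (f : X.HomM A B) (f' : X.HomM A' B)
    (x : ∀ i : D.Obj, C.HomM ((ob A).obj i) ((ob A').obj i))
    (e : ∀ i, x i ≫ m.appM f' i = m.appM f i) :
    ∃ y : X.HomM A A', (∀ i, m.appM y i = x i) ∧ y ≫ f' = f := by
  -- The factorization is automatically good and natural, by the pullback lemma for good squares and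
  -- by (PBL).
  obtain ⟨y, hy⟩ := m.liftM x (fun {i j} k => h.cancel (m.goodM f' k)
    ((m.goodM f k).congr rfl (e i) (e j))) (fun {i j} k => h.pbl (m.mixedM f' k)
    ((m.mixedM f k).congr (e i) rfl rfl (e j)))
  exact ⟨y, hy, m.extM fun i => by rw [m.appM_comp, hy, e]⟩

theorem cubes_mult : m.cubes.IsMultiplicative where
  id_mem F := fun {i j} k => by
    have iid : ∀ i, IsIso (m.appM (𝟙 F.left) i) := fun i => by
      have : m.appM (𝟙 F.left) i = C.idM _ := m.appM_id F.left.obj i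
      rw [this]; infer_instance
    have e : ∀ i, m.appM (𝟙 F.left) i ≫ m.appM F.hom i = m.appM F.hom i ≫ m.appM (𝟙 F.right) i :=
      fun i => (m.comm_iff (g := 𝟙 F.left) (p := 𝟙 F.right) (f := F.hom) (q := F.hom)).1
        ((Category.id_comp _).trans (Category.comp_id _).symm) i
    exact h.cube_of_isIso (iid i) (iid j) (e i) (e j) (h.symm (m.goodM F.hom k))
      (h.symm (m.goodM (𝟙 F.left) k)) (h.symm (m.goodM (𝟙 F.right) k)) (h.symm (m.goodM F.hom k))
  comp_mem φ ψ hφ hψ := fun {i j} k => by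
    have e : ∀ i, m.appM (φ ≫ ψ).left i = m.appM φ.left i ≫ m.appM ψ.left i :=
      fun i => m.appM_comp φ.left ψ.left i
    have e' : ∀ i, m.appM (φ ≫ ψ).right i = m.appM φ.right i ≫ m.appM ψ.right i :=
      fun i => m.appM_comp φ.right ψ.right i
    rw [e, e', e, e']
    exact h.cube_vcomp (hφ k) (hψ k)

theorem weakTriangles_le : weakTriangles X.M ≤ m.cubes := fun F G φ hφ {i j} k => by
  have hφ' := (m.isIso_iff h φ.left).1 hφ
  have e := (m.comm_iff (g := φ.left) (p := φ.right) (f := F.hom) (q := G.hom)).1 φ.w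
  exact h.cube_of_isIso (hφ' i) (hφ' j) (e i) (e j) (h.symm (m.goodM F.hom k))
      (h.symm (m.goodM φ.left k)) (h.symm (m.goodM φ.right k)) (h.symm (m.goodM G.hom k))

/-- Component squares are pullbacks. The pointwise lift factors a morphism through `φ.left`, so it
is a morphism by `exists_over`; uniqueness holds since `φ.left` is monic. -/
theorem le_pullbackSquares : m.cubes ≤ pullbackSquares X.M := fun F G φ hφ => by
  have e := (m.comm_iff (g := φ.left) (p := φ.right) (f := F.hom) (q := G.hom)).1 φ.w
  have hp : ∀ i, IsPullback (m.appM φ.left i) (m.appM F.hom i) (m.appM G.hom i)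
      (m.appM φ.right i) := fun i => h.isPullback (hφ (D.idM i)).face_left
  have key : ∀ {A : X.M} (a : A ⟶ G.left) (b : A ⟶ F.right), a ≫ G.hom = b ≫ φ.right →
      ∃ l : A ⟶ F.left, l ≫ φ.left = a ∧ l ≫ F.hom = b := by
    intro A a b hab
    have hab' := (m.comm_iff (g := a) (p := φ.right) (f := b) (q := G.hom)).1 hab
    obtain ⟨l, hl, hl'⟩ := m.exists_over h a φ.left
      (fun i => (hp i).lift _ _ (hab' i)) (fun i => (hp i).lift_fst _ _ _)
    exact ⟨l, hl', m.extM fun i => by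
      rw [m.appM_comp, hl]; exact (hp i).lift_snd _ _ _⟩
  have hm : Mono φ.left := m.mono h φ.left
  refine ⟨⟨φ.w⟩, ⟨Limits.PullbackCone.IsLimit.mk _
    (fun s => (key s.fst s.snd s.condition).choose)
    (fun s => (key s.fst s.snd s.condition).choose_spec.1)
    (fun s => (key s.fst s.snd s.condition).choose_spec.2)
    (fun s l hl _ => ?_)⟩⟩
  rw [← cancel_mono φ.left, (key s.fst s.snd s.condition).choose_spec.1]
  exact hl

theorem cubes_symm {A B A' B' : X.Obj} (f : X.HomM A B) (g : X.HomM A A') (p : X.HomM B B')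
    (q : X.HomM A' B') : GoodSq m.cubes f g p q ↔ GoodSq m.cubes g f q p :=
  ⟨fun hg => m.good_iff.2 fun k => h.cube_symm (m.good_iff.1 hg k),
    fun hg => m.good_iff.2 fun k => h.cube_symm (m.good_iff.1 hg k)⟩

/-- Maps between initial objects are isomorphisms, so the naturality squares at m-morphisms are good
by (GS) and (G); the mixed squares come from `mixed_initial`. -/
theorem exists_zero {Z A : X.Obj}
    (hM : ∀ i, Nonempty (Limits.IsInitial (⟨(ob Z).obj i⟩ : C.M)))
    (hE : ∀ i, Nonempty (Limits.IsInitial (⟨(ob Z).obj i⟩ : C.E))) :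
    ∃ f : X.HomM Z A, ∀ g : X.HomM Z A, g = f := by
  have iso : ∀ {i j : D.Obj} (k : D.HomM i j), IsIso ((ob Z).mapM k) := fun {i j} k => by
    have : (ob Z).mapM k = ((hM i).some.uniqueUpToIso (hM j).some).hom := (hM i).some.hom_ext _ _
    rw [this]
    infer_instance
  obtain ⟨f, -⟩ := m.liftM (A := Z) (B := A) (fun i => (hM i).some.to _)
    (fun {i j} k => h.good_of_isIso_top (iso k) ((hM i).some.hom_ext _ _))
    (fun {i j} e => h.mixed_initial (hM i) (hM j) (hE i) _ _ _ _)
  exact ⟨f, fun g => m.extM fun i => (hM i).some.hom_ext _ _⟩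

end Model

end Models

/-! ### ★-pushouts in a model of `C^D` -/

section ModelPushouts

variable {D : DoubleCat.{u', v₁', v₂', w'}} {C : DoubleCat.{u, v₁, v₂, w}}
  {S : GCGWData C} {X : DoubleCat.{u'', v₁'', v₂'', w''}} {ob : X.Obj → DoubleFunctor D C}

namespace Model

variable (m : Model S D ob) (h : S.StarAxioms)

include m h

/-- When both faces are ★-pushouts, the southern square has identities as vertical sides. -/
theorem good_of_star_app {A B A' P : X.Obj} {f : X.HomM A B} {g : X.HomM A A'} {p : X.HomM B P}
    {q : X.HomM A' P}
    (hs : ∀ i, IsStarPushout S.goodM (m.appM f i) (m.appM g i) (m.appM p i) (m.appM q i)) :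
    GoodSq m.cubes f g p q :=
  m.good_iff.2 fun {i j} k => ⟨(hs i).good, (hs j).good, h.symm (m.goodM f k),
    h.symm (m.goodM g k), h.symm (m.goodM p k), h.symm (m.goodM q k), _, _, _, _, _, _,
    C.idM _, C.idM _, _, hs i, hs j, Category.comp_id _, Category.comp_id _, Category.comp_id _,
    Category.comp_id _, (m.goodM p k).1, (m.goodM q k).1, h.good_id_left _⟩

/-- The pointwise maps are natural at m-morphisms with good squares because their naturality squares
are the southern squares of the given cubes. -/
theorem exists_desc {A B A' P Q : X.Obj} {f : X.HomM A B} {g : X.HomM A A'} {p : X.HomM B P}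
    {q : X.HomM A' P} {p' : X.HomM B Q} {q' : X.HomM A' Q}
    (hs : ∀ i, IsStarPushout S.goodM (m.appM f i) (m.appM g i) (m.appM p i) (m.appM q i))
    (hg : GoodSq m.cubes f g p' q') :
    ∃ d : X.HomM P Q, p ≫ d = p' ∧ q ≫ d = q' := by
  have hd := fun i => ((hs i).desc _ _ (m.good_app hg i)).exists
  choose x hx₁ hx₂ using hd
  obtain ⟨d, hd⟩ := m.liftM (A := P) (B := Q) x
    (fun {i j} k => by
      obtain ⟨r, h₁, h₂, hr⟩ := h.southern (m.good_iff.1 hg k) (hs i) (hs j) (hx₁ i) (hx₂ i)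
        (hx₁ j) (hx₂ j)
      have e : r = (ob P).mapM k := h.star_ext (hs i) (h₁.trans (m.goodM p k).1.symm)
        (h₂.trans (m.goodM q k).1.symm)
      rw [← e]
      exact hr)
    (fun {i j} e => by
      obtain ⟨ν, hν, h₁, h₂⟩ := h.exists_star_mixed (hs i) (hs j) (m.mixedM f e)
        ((m.mixedM p' e).congr (hx₁ i) rfl rfl (hx₁ j))
        ((m.mixedM q' e).congr (hx₂ i) rfl rfl (hx₂ j))
      -- The e-morphism found between the ★-pushouts must be the one that `P` assigns to `e`.
      rw [h.star_mixed_unique (hs i) (hs j) (m.mixedM f e) (m.mixedM g e) (m.mixedM p e)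
        (m.mixedM q e) h₁ h₂]
      exact hν)
  exact ⟨d, m.extM fun i => by rw [m.appM_comp, hd, hx₁], m.extM fun i => by
    rw [m.appM_comp, hd, hx₂]⟩

theorem star_of_app {A B A' P : X.Obj} {f : X.HomM A B} {g : X.HomM A A'} {p : X.HomM B P}
    {q : X.HomM A' P}
    (hs : ∀ i, IsStarPushout S.goodM (m.appM f i) (m.appM g i) (m.appM p i) (m.appM q i)) :
    IsStarPushout m.cubes f g p q := by
  refine ⟨m.good_of_star_app h hs, fun {Q} p' q' hg => ?_⟩
  obtain ⟨d, h₁, h₂⟩ := m.exists_desc h (Q := Q.obj) hs hg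
  refine ⟨d, ⟨h₁, h₂⟩, fun y hy => m.extM fun i => h.star_ext (hs i) ?_ ?_⟩
  · rw [← m.appM_comp, ← m.appM_comp]
    exact congrArg (fun z => m.appM z i) (hy.1.trans h₁.symm)
  · rw [← m.appM_comp, ← m.appM_comp]
    exact congrArg (fun z => m.appM z i) (hy.2.trans h₂.symm)

/-- Pointwise ★-pushouts that are functorial in the e-morphisms assemble to a double functor. -/
theorem exists_star_app {A B A' : X.Obj} (f : X.HomM A B) (g : X.HomM A A') (P : D.Obj → C.Obj)
    (s : ∀ i, C.HomM ((ob B).obj i) (P i)) (t : ∀ i, C.HomM ((ob A').obj i) (P i))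
    (hs : ∀ i, IsStarPushout S.goodM (m.appM f i) (m.appM g i) (s i) (t i))
    (hν : ∀ {i j : D.Obj} (e : D.HomE i j), ∃ ν : C.HomE (P i) (P j),
      Mixed C (s i) ((ob B).mapE e) ν (s j) ∧ Mixed C (t i) ((ob A').mapE e) ν (t j)) :
    ∃ (Q : X.Obj) (p : X.HomM B Q) (q : X.HomM A' Q),
      ∀ i, IsStarPushout S.goodM (m.appM f i) (m.appM g i) (m.appM p i) (m.appM q i) := by
  have hr : ∀ {i j : D.Obj} (k : D.HomM i j), ∃ r : C.HomM (P i) (P j),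
      s i ≫ r = (ob B).mapM k ≫ s j ∧ t i ≫ r = (ob A').mapM k ≫ t j := fun {i j} k =>
    h.star_map (hs i) (hs j).good (h.symm (m.goodM f k)) (m.goodM g k).1
  choose r hr₁ hr₂ using @hr
  choose ν hν₁ hν₂ using @hν
  have uniq : ∀ {i j : D.Obj} (e : D.HomE i j) {ν' : C.HomE (P i) (P j)},
      Mixed C (s i) ((ob B).mapE e) ν' (s j) → Mixed C (t i) ((ob A').mapE e) ν' (t j) →
      ν e = ν' := fun {i j} e ν' h₁ h₂ =>
    h.star_mixed_unique (hs i) (hs j) (m.mixedM f e) (m.mixedM g e) (hν₁ e) (hν₂ e) h₁ h₂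
  -- Functoriality holds by uniqueness of maps, plain and mixed, out of ★-pushouts. A square of `D`
  -- gives a mixed map between the ★-pushouts by `exists_star_mixed`, whose left side is again
  -- forced.
  let Q : DoubleFunctor D C := DoubleFunctor.ofMixed h.gcgw.sq_subsingleton P r ν
    (fun i => h.star_ext (hs i)
      (by rw [hr₁, (ob B).mapM_id, Category.id_comp, Category.comp_id])
      (by rw [hr₂, (ob A').mapM_id, Category.id_comp, Category.comp_id]))
    (fun i => uniq _ ((Mixed.id_e _).congr rfl ((ob B).mapE_id i))
      ((Mixed.id_e _).congr rfl ((ob A').mapE_id i)))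
    (fun {i _ _} k k' => h.star_ext (hs i)
      (by rw [hr₁, (ob B).mapM_comp, ← Category.assoc, hr₁, Category.assoc, Category.assoc, hr₁])
      (by rw [hr₂, (ob A').mapM_comp, ← Category.assoc, hr₂, Category.assoc, Category.assoc, hr₂]))
    (fun e e' => uniq _
      (((hν₁ e).vcomp (hν₁ e')).congr rfl ((ob B).mapE_comp e e'))
      (((hν₂ e).vcomp (hν₂ e')).congr rfl ((ob A').mapE_comp e e')))
    (fun {i j i' j' k e e' k'} α => by
      obtain ⟨ν', hν', h₁, h₂⟩ := h.exists_star_mixed (hs i) (hs i') (m.mixedM f e)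
        ((((ob B).mixed α).hcomp (hν₁ e')).congr (hr₁ k) rfl rfl (hr₁ k'))
        ((((ob A').mixed α).hcomp (hν₂ e')).congr (hr₂ k) rfl rfl (hr₂ k'))
      rw [uniq e h₁ h₂]
      exact hν')
  obtain ⟨Y, hY⟩ := m.surj Q
  -- Quantifying over `F` allows the equality `ob Y = Q` to be eliminated by substitution.
  have key : ∀ (F : DoubleFunctor D C) (_ : ob Y = F)
      (s' : ∀ i, C.HomM ((ob B).obj i) (F.obj i)) (t' : ∀ i, C.HomM ((ob A').obj i) (F.obj i)),
      (∀ i, IsStarPushout S.goodM (m.appM f i) (m.appM g i) (s' i) (t' i)) →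
      (∀ {i j : D.Obj} (k : D.HomM i j), s' i ≫ F.mapM k = (ob B).mapM k ≫ s' j) →
      (∀ {i j : D.Obj} (k : D.HomM i j), t' i ≫ F.mapM k = (ob A').mapM k ≫ t' j) →
      (∀ {i j : D.Obj} (e : D.HomE i j), Mixed C (s' i) ((ob B).mapE e) (F.mapE e) (s' j)) →
      (∀ {i j : D.Obj} (e : D.HomE i j), Mixed C (t' i) ((ob A').mapE e) (F.mapE e) (t' j)) →
      ∃ (Q : X.Obj) (p : X.HomM B Q) (q : X.HomM A' Q),
        ∀ i, IsStarPushout S.goodM (m.appM f i) (m.appM g i) (m.appM p i) (m.appM q i) := by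
    rintro _ rfl s t hs hr₁ hr₂ hν₁ hν₂
    -- (POL) makes the naturality squares of the coprojections good.
    obtain ⟨p, hp⟩ := m.liftM (A := B) (B := Y) s (fun {i j} k => h.pol (hs i) (hr₁ k).symm
      ((h.hcomp (m.goodM g k) (hs j).good).congr
        (m.goodM f k).1 rfl rfl (hr₂ k))) hν₁
    obtain ⟨q, hq⟩ := m.liftM (A := A') (B := Y) t (fun {i j} k =>
      h.pol (h.star_symm (hs i)) (hr₂ k).symm
        ((h.hcomp (m.goodM f k) (h.symm (hs j).good)).congr
          (m.goodM g k).1 rfl rfl (hr₁ k))) hν₂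
    exact ⟨Y, p, q, fun i => by rw [hp, hq]; exact hs i⟩
  exact key Q hY s t hs hr₁ hr₂ hν₁ hν₂

/-- The given good square supplies the corner over which `exists_star_mixed` produces the
e-morphisms between the pointwise ★-pushouts. -/
theorem exists_star_of_good {A B A' Q : X.Obj} {f : X.HomM A B} {g : X.HomM A A'} {p : X.HomM B Q}
    {q : X.HomM A' Q} (hg : GoodSq m.cubes f g p q) :
    ∃ (Q : X.Obj) (p : X.HomM B Q) (q : X.HomM A' Q),
      ∀ i, IsStarPushout S.goodM (m.appM f i) (m.appM g i) (m.appM p i) (m.appM q i) := by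
  have hP := fun i => h.star_of_good (m.good_app hg i)
  choose P s t x hs h₁ h₂ using hP
  refine m.exists_star_app h f g P s t hs fun {i j} e => ?_
  obtain ⟨ν, -, hν⟩ := h.exists_star_mixed (hs i) (hs j) (m.mixedM f e)
    ((m.mixedM p e).congr (h₁ i) rfl rfl (h₁ j)) ((m.mixedM q e).congr (h₂ i) rfl rfl (h₂ j))
  exact ⟨ν, hν⟩

/-- ★-pushouts in a model of `C^D` are pointwise. -/
theorem star_iff {A B A' P : X.Obj} {f : X.HomM A B} {g : X.HomM A A'} {p : X.HomM B P}
    {q : X.HomM A' P} : IsStarPushout m.cubes f g p q ↔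
      ∀ i, IsStarPushout S.goodM (m.appM f i) (m.appM g i) (m.appM p i) (m.appM q i) := by
  refine ⟨fun hs => ?_, m.star_of_app h⟩
  -- The initial good square is compared with the pointwise one: they are isomorphic, and being a
  -- ★-pushout is invariant under isomorphism.
  obtain ⟨Q, p', q', hs'⟩ := m.exists_star_of_good h hs.good
  have ht := m.star_of_app h hs'
  obtain ⟨x, ⟨hx₁, hx₂⟩, -⟩ := ht.desc _ _ hs.good
  obtain ⟨y, ⟨hy₁, hy₂⟩, -⟩ := hs.desc _ _ ht.good
  have hxy : x ≫ y = 𝟙 _ := (ht.desc _ _ ht.good).unique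
    ⟨by rw [← Category.assoc, hx₁, hy₁], by rw [← Category.assoc, hx₂, hy₂]⟩
    ⟨Category.comp_id _, Category.comp_id _⟩
  have hyx : y ≫ x = 𝟙 _ := (hs.desc _ _ hs.good).unique
    ⟨by rw [← Category.assoc, hy₁, hx₁], by rw [← Category.assoc, hy₂, hx₂]⟩
    ⟨Category.comp_id _, Category.comp_id _⟩
  have hx : IsIso x := ⟨y, hxy, hyx⟩
  intro i
  exact h.star_of_iso (hs' i) (m.appM x i) ((m.isIso_iff h x).1 hx i)
    (by rw [← m.appM_comp]; exact congrArg (fun z => m.appM z i) hx₁)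
    (by rw [← m.appM_comp]; exact congrArg (fun z => m.appM z i) hx₂)

/-- A model of `C^D` inherits (PO) from `C`. -/
theorem exists_good (po : ∀ {A B A' : C.Obj} (f : C.HomM A B) (g : C.HomM A A'),
      ∃ (D : C.Obj) (p : C.HomM B D) (q : C.HomM A' D), GoodSq S.goodM f g p q)
    {A B A' : X.Obj} (f : X.HomM A B) (g : X.HomM A A') :
    ∃ (Q : X.Obj) (p : X.HomM B Q) (q : X.HomM A' Q), GoodSq m.cubes f g p q := by
  have po' : ∀ {A B A' : C.Obj} (f : C.HomM A B) (g : C.HomM A A'),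
      ∃ (D : C.Obj) (p : C.HomM B D) (q : C.HomM A' D), IsStarPushout S.goodM f g p q :=
    fun f g => h.m.star_exists f g (po f g)
  choose P s t hs using fun i => po' (m.appM f i) (m.appM g i)
  obtain ⟨Q, p, q, hQ⟩ := m.exists_star_app h f g P s t hs fun {i j} e => by
    -- Without a given corner, the e-morphism `P i → P j` is built from kernels: by (PO) the span of
    -- kernels of `A(e)`, `B(e)`, `A'(e)` has a ★-pushout `R`, and the cokernel of `R → P j` is a
    -- ★-pushout of the span at `i`, hence isomorphic to `P i`.
    obtain ⟨A₁, a₁, ha⟩ := exists_compl_m h.gcgw ((ob A).mapE e)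
    obtain ⟨B₁, b₁, hb⟩ := exists_compl_m h.gcgw ((ob B).mapE e)
    obtain ⟨C₁, c₁, hc⟩ := exists_compl_m h.gcgw ((ob A').mapE e)
    obtain ⟨f₁, hf₁⟩ := ha.good_m h.gcgw hb (m.mixedM f e)
    obtain ⟨g₁, hg₁⟩ := ha.good_m h.gcgw hc (m.mixedM g e)
    obtain ⟨R, p₁, q₁, hs₁⟩ := po' f₁ g₁
    obtain ⟨r, hr₁, hr₂⟩ := h.star_map hs₁ (hs j).good (h.symm hf₁) hg₁.1
    obtain ⟨P₀, π, hπ⟩ := exists_compl_e S r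
    obtain ⟨p₀, q₀, hp₀, hq₀, hs₀⟩ := h.star_of_compl (hs j) (m.mixedM f e) (m.mixedM g e) hb hc hπ
      hf₁ hg₁ hs₁ hr₁ hr₂
    obtain ⟨θ, hθ, e₁, e₂⟩ := h.star_iso (hs i) hs₀
    have m₁ : ∀ {Y : C.Obj} {y : C.HomM Y (P i)} {y' : C.HomM Y P₀}, y ≫ θ = y' →
        Mixed C y (C.idE Y) (S.isos.equiv (asIso θ)).hom y' := fun {Y y y'} ey => by
      have := (S.isos.mixed_m (Iso.refl (⟨Y⟩ : C.M)) (asIso θ) (g := y) (g' := y')).2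
        (by simpa using ey)
      exact this.congr rfl (by rw [S.isos.equiv_refl]; rfl)
    exact ⟨(S.isos.equiv (asIso θ)).hom ≫ π,
      ((m₁ e₁).vcomp hp₀).congr rfl (Category.id_comp _).symm,
      ((m₁ e₂).vcomp hq₀).congr rfl (Category.id_comp _).symm⟩
  exact ⟨Q, p, q, m.good_of_star_app h hQ⟩

theorem pushout_lemma {A B A' P Q Q' : X.Obj} (f : X.HomM A B) (g : X.HomM A A') (p : X.HomM B P)
    (q : X.HomM A' P) (d : X.HomM B Q) (e : X.HomM P Q') (k : X.HomM Q Q')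
    (hs : IsStarPushout m.cubes f g p q) (c : d ≫ k = p ≫ e)
    (ho : GoodSq m.cubes (f ≫ d) g k (q ≫ e)) : GoodSq m.cubes d p k e := by
  have hs' := (m.star_iff h).1 hs
  have c' := m.comm_iff.1 c.symm
  refine m.good_iff.2 fun {i j} l => ?_
  have ho' := m.good_iff.1 ho l
  rw [m.appM_comp, m.appM_comp, m.appM_comp, m.appM_comp] at ho'
  exact h.cube_pol (hs' i) (hs' j) (c' i).symm (c' j).symm ho' (h.symm (m.goodM d l))
    (h.symm (m.goodM p l)) (h.symm (m.goodM k l)) (h.symm (m.goodM e l)) (m.goodM q l).1.symm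

end Model

end ModelPushouts

/-! ## Pointwise structures -/

section PointwiseStructures

variable {D : DoubleCat.{u', v₁', v₂', w'}} {C : DoubleCat.{u, v₁, v₂, w}}
  {S : GCGWData C} {X : DoubleCat.{u'', v₁'', v₂'', w''}} {ob : X.Obj → DoubleFunctor D C}

namespace Model

variable (m : Model S D ob)

/-- The component at `i` of an m-isomorphism. -/
def isoAt {A B : X.Obj} (μ : X.IsoM A B) (i : D.Obj) :
    C.IsoM ((ob A).obj i) ((ob B).obj i) where
  hom := m.appM μ.hom i
  inv := m.appM μ.inv i
  hom_inv_id := by rw [← m.appM_comp, μ.hom_inv_id]; exact m.appM_id A i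
  inv_hom_id := by rw [← m.appM_comp, μ.inv_hom_id]; exact m.appM_id B i

/-- Shared isomorphisms exchange the two conditions: the mixed squares of `μ` become naturality at
e-morphisms, and naturality of `μ` becomes mixed squares. -/
theorem exists_isoE (h : S.StarAxioms) {A B : X.Obj} (μ : X.IsoM A B) :
    ∃ e : X.IsoE A B, ∀ i, m.appE e.hom i = (S.isos.equiv (m.isoAt μ i)).hom := by
  obtain ⟨f, hf⟩ := m.tr.exists_of_isIso h.tr (A := A) (B := B)
    (fun i => (S.isos.equiv (m.isoAt μ i)).hom)
    (fun i => Iso.isIso_hom (S.isos.equiv (m.isoAt μ i)))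
    (fun {i j} e => ((S.isos.mixed_e (m.isoAt μ i) (m.isoAt μ j)).1 (m.mixedM μ.hom e)).symm)
    (fun {i j} k => (S.isos.mixed_m (m.isoAt μ i) (m.isoAt μ j)).2 (m.goodM μ.hom k).1.symm)
  have hf' : IsIso f := (m.tr.isIso_iff h.tr f).2 fun i => by
    rw [hf]; exact Iso.isIso_hom (S.isos.equiv (m.isoAt μ i))
  exact ⟨asIso f, hf⟩

/-- The e-isomorphism which is pointwise identified with an m-isomorphism. -/
noncomputable def isoE (h : S.StarAxioms) {A B : X.Obj} (μ : X.IsoM A B) : X.IsoE A B :=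
  (m.exists_isoE h μ).choose

theorem appE_isoE (h : S.StarAxioms) {A B : X.Obj} (μ : X.IsoM A B) (i : D.Obj) :
    m.appE (m.isoE h μ).hom i = (S.isos.equiv (m.isoAt μ i)).hom :=
  (m.exists_isoE h μ).choose_spec i

theorem isoAt_isoE (h : S.StarAxioms) {A B : X.Obj} (μ : X.IsoM A B) (i : D.Obj) :
    m.tr.isoAt (m.isoE h μ) i = S.isos.equiv (m.isoAt μ i) :=
  Iso.ext (m.appE_isoE h μ i)

theorem isoE_tr_isoE (h : S.StarAxioms) {A B : X.Obj} (μ : X.IsoM A B) :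
    m.tr.isoE h.tr (m.isoE h μ) = μ := by
  refine Iso.ext (m.extM fun i => (m.tr.appE_isoE h.tr (m.isoE h μ) i).trans ?_)
  rw [m.isoAt_isoE h μ i]
  exact congrArg Iso.hom (S.isos.equiv.symm_apply_apply (m.isoAt μ i))

/-- The pointwise shared isomorphisms. -/
noncomputable def isos (h : S.StarAxioms) : SharedIsos X where
  equiv {A B} :=
    { toFun := m.isoE h
      invFun := m.tr.isoE h.tr
      left_inv := m.isoE_tr_isoE h
      right_inv := m.tr.isoE_tr_isoE h.tr }
  equiv_trans {A B A'} f g := by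
    refine Iso.ext (m.extE fun i => ?_)
    have e : m.isoAt (f ≪≫ g) i = m.isoAt f i ≪≫ m.isoAt g i := Iso.ext (m.appM_comp f.hom g.hom i)
    refine (m.appE_isoE h (f ≪≫ g) i).trans ?_
    rw [e, S.isos.equiv_trans]
    refine Eq.trans ?_ (m.appE_comp (m.isoE h f).hom (m.isoE h g).hom i).symm
    rw [m.appE_isoE h f i, m.appE_isoE h g i]
    rfl
  sq_iff_m f f' g g' := by
    refine Iff.trans ?_ m.comm_iff.symm
    constructor
    · intro H i
      exact (S.isos.mixed_m (m.isoAt f i) (m.isoAt f' i)).1 ((m.mixed_app H i).congr rfl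
        (m.appE_isoE h f i).symm (m.appE_isoE h f' i).symm)
    · intro H
      exact m.mixed_of_app fun i => ((S.isos.mixed_m (m.isoAt f i) (m.isoAt f' i)).2 (H i)).congr
        rfl (m.appE_isoE h f i) (m.appE_isoE h f' i)
  sq_unique_m _ _ _ _ := m.sq_sub _ _ _ _
  sq_iff_e f f' g g' := by
    have e : ∀ i, m.appE g i ≫ m.appE (m.isoE h f').hom i = m.appE (m.isoE h f).hom i ≫ m.appE g' i ↔
        Mixed C (m.isoAt f i).hom (m.appE g i) (m.appE g' i) (m.isoAt f' i).hom := fun i => by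
      rw [m.appE_isoE h f i, m.appE_isoE h f' i]
      exact (S.isos.mixed_e (m.isoAt f i) (m.isoAt f' i)).symm
    refine Iff.trans ?_ m.tr.comm_iff.symm
    exact ⟨fun H i => (e i).2 (m.mixed_app H i), fun H => m.mixed_of_app fun i => (e i).1 (H i)⟩
  sq_unique_e _ _ _ _ := m.sq_sub _ _ _ _

/-- The data of a g-CGW category on a model of `C^D` are pointwise, up to isomorphism. -/
structure Pointwise (T : GCGWData X) : Prop where
  goodM : T.goodM = m.cubes
  goodE : T.goodE = m.tr.cubes
  zeroM : ∀ i, Nonempty (Limits.IsInitial (⟨(ob T.zero).obj i⟩ : C.M))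
  zeroE : ∀ i, Nonempty (Limits.IsInitial (⟨(ob T.zero).obj i⟩ : C.E))
  compl_c : ∀ {A B : X.Obj} (f : X.HomM A B) (i : D.Obj),
    Compl S (m.appM f i) (m.appE (T.c.hom f) i)
  compl_k : ∀ {A B : X.Obj} (z : X.HomE A B) (i : D.Obj),
    Compl S (m.appM (T.k.hom z) i) (m.appE z i)

/-! ### The axioms for pointwise data on a model -/

variable {m} {T : GCGWData X} (h : S.StarAxioms)

theorem Pointwise.tr (hT : m.Pointwise T) (h : S.StarAxioms) : m.tr.Pointwise T.tr where
  goodM := hT.goodE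
  goodE := hT.goodM
  zeroM := hT.zeroE
  zeroE := hT.zeroM
  compl_c z i := (hT.compl_k z i).tr h.gcgw
  compl_k f i := (hT.compl_c f i).tr h.gcgw

namespace Pointwise

variable (hT : m.Pointwise T)

include hT h

/-- Fullness of `c`: the left sides exist pointwise, and the good cube between cokernels makes them
into an e-morphism of the model. -/
theorem exists_sq {A B A' B' : X.Obj} {f : X.HomM A B} {f' : X.HomM A' B'} {b : X.HomE B B'}
    {x : X.HomE (T.c.obj f) (T.c.obj f')} (hx : GoodSq T.goodE (T.c.hom f) x b (T.c.hom f')) :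
    ∃ (a : X.HomE A A') (α : X.Sq f a b f'), T.c.sqMap α = x := by
  have hx : GoodSq m.tr.cubes (T.c.hom f) x b (T.c.hom f') := ⟨hx.1, hT.goodE.le _ hx.2⟩
  have ha := fun i => (hT.compl_c f i).mixed_e h.gcgw (hT.compl_c f' i) (m.tr.good_app hx i)
  choose a ha using ha
  obtain ⟨y, hy⟩ := m.liftE a
    (fun {i j} e => by
      -- The directions are permuted so that the cokernel inclusions become the connecting maps;
      -- `good_of_cube` in the transpose then gives the good naturality square.
      have hc := h.tr.cube_rotate (h.tr.cube_symm (h.tr.cube_rotate (m.tr.good_iff.1 hx e)))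
      exact h.tr.good_of_cube (m.mixedM f e).tr (ha i).tr (ha j).tr (m.mixedM f' e).tr
        ((hT.compl_c f j).tr h.gcgw) ((hT.compl_c f' i).tr h.gcgw) ((hT.compl_c f' j).tr h.gcgw) hc)
    (fun {i j} k => h.pbl (ha j) (((ha i).hcomp (m.mixedE b k)).congr (m.goodM f k).1.symm rfl rfl
        (m.goodM f' k).1.symm))
  obtain ⟨α⟩ := m.mixed_of_app (a := y) fun i => (ha i).congr rfl (hy i)
  have hm : Mono (T.c.hom f') := m.tr.mono h.tr (T.c.hom f')
  exact ⟨y, α, hm.right_cancellation _ _ ((T.c.sqMap_comm α).trans hx.1.symm)⟩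

/-- Essential surjectivity: an e-morphism `z` is isomorphic over its codomain to `c(k(z))`, since
both are pointwise complements of `k(z)`. -/
theorem c_equivalence : T.c.functor.IsEquivalence where
  faithful := ⟨fun {F G} φ ψ e => by
    obtain ⟨a, b, α⟩ := φ
    obtain ⟨a', b', β⟩ := ψ
    obtain rfl : b = b' := congrArg (fun t => t.1.right) e
    obtain rfl : a = a' := m.extE fun i =>
      h.gcgw.mixed_left_unique (m.mixed_app ⟨α⟩ i) (m.mixed_app ⟨β⟩ i)
    have := m.sq_sub F.hom a b G.hom
    obtain rfl : α = β := Subsingleton.elim _ _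
    rfl⟩
  full := ⟨fun {F G} φ => by
    obtain ⟨a, α, hα⟩ := hT.exists_sq h (f := F.hom) (f' := G.hom) (x := φ.1.left)
      (b := φ.1.right) ⟨φ.1.w, φ.2⟩
    refine ⟨(⟨a, φ.1.right, α⟩ : ArSq.Hom F G), ?_⟩
    apply WideSubcategory.hom_ext
    apply Arrow.hom_ext
    · exact hα
    · rfl⟩
  essSurj := ⟨fun Y => by
    let z : X.HomE Y.obj.left.obj Y.obj.right.obj := Y.obj.hom
    let f : X.HomM (T.k.obj z) Y.obj.right.obj := T.k.hom z
    choose y hy e using fun i => (hT.compl_c f i).unique_e (hT.compl_k z i)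
    obtain ⟨x, hx, e'⟩ := m.tr.exists_over h.tr (T.c.hom f) z y fun i => (e i).symm
    have hx' : IsIso x := (m.tr.isIso_iff h.tr x).2 fun i => by rw [hx]; exact hy i
    have hw : weakTriangles X.E ≤ T.goodE := hT.goodE ▸ m.tr.weakTriangles_le h.tr
    let φ : Arrow.mk (T.c.hom f) ≅ Y.obj := Arrow.isoMk (asIso x) (Iso.refl _)
      (e'.trans (Category.comp_id _).symm)
    exact ⟨⟨T.k.obj z, Y.obj.right.obj, f⟩, ⟨WideSubcategory.isoMk φ
      (hw _ (inferInstanceAs (IsIso x))) (hw _ (inferInstanceAs (IsIso (inv x))))⟩⟩⟩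

/-- One half of (D), the other being its transpose. Isomorphisms are detected pointwise, and
monicity identifies the component with the isomorphism given by `isIso_of_mixed`. -/
theorem isIso_sqMap {A B A' B' : X.Obj} {f : X.HomM A B} {a : X.HomE A A'} {b : X.HomE B B'}
    {f' : X.HomM A' B'} (α : X.Sq f a b f')
    (hα : T.tr.Distinguished (A := A) (B := A') (A' := B) (B' := B') α) : T.Distinguished α := by
  refine (m.tr.isIso_iff h.tr (T.c.sqMap α)).2 fun i => ?_
  let g : X.HomM (T.kerObj a) (T.kerObj b) := T.kerMap α
  have hg : IsIso g := hα
  have eg : g ≫ T.k.hom b = T.k.hom a ≫ f' :=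
    T.k.sqMap_comm (f := a) (a := f) (b := f') (f' := b) α
  obtain ⟨τ, hτ, hτ'⟩ := h.isIso_of_mixed (hT.compl_k a i) (hT.compl_k b i) (m.mixed_app ⟨α⟩ i)
    (m.comm_iff.1 eg i) ((m.isIso_iff h g).1 hg i) (hT.compl_c f i) (hT.compl_c f' i)
  have e : m.appE (T.c.sqMap α) i = τ := h.gcgw.cancel_e (m.appE (T.c.hom f') i)
    ((m.tr.comm_iff.1 (T.c.sqMap_comm α) i).trans hτ'.1.symm)
  rw [show m.tr.appM (T.c.sqMap α) i = τ from e]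
  exact hτ

theorem cokernel_sq {A B : X.Obj} (f : X.HomM A B) :
    ∃ (t : X.HomM T.zero (T.c.obj f)) (l : X.HomE T.zero A) (α : X.Sq t l (T.c.hom f) f),
      T.Distinguished α := by
  obtain ⟨t, -⟩ := m.exists_zero h (Z := T.zero) (A := T.c.obj f) hT.zeroM hT.zeroE
  obtain ⟨l, -⟩ := m.tr.exists_zero h.tr (Z := T.zero) (A := A) hT.zeroE hT.zeroM
  obtain ⟨α⟩ : Mixed X t l (T.c.hom f) f := m.mixed_of_app fun i => by
    obtain ⟨iM⟩ := h.gcgw.m.zero_initial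
    obtain ⟨iE⟩ := h.gcgw.e.zero_initial
    obtain ⟨jE⟩ := hT.zeroE i
    exact ((h.mixed_initial (hT.zeroM i) ⟨iM⟩ ⟨jE⟩ (m.appM t i) (jE.to _) (C.idE _)
      (iM.to _)).vcomp ((hT.compl_c f i).mixed_zero h.gcgw _ (iE.to _))).congr rfl
        (jE.hom_ext _ _) (Category.id_comp _).symm
  refine ⟨t, l, α, ?_⟩
  have hm : Mono (T.c.hom f) := m.tr.mono h.tr (T.c.hom f)
  -- As `c(f)` is monic, the induced map on cokernels is `c(t)`, which is invertible because `t`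
  -- starts at a pointwise initial object.
  have e : T.c.sqMap α = T.c.hom t := hm.right_cancellation _ _ (T.c.sqMap_comm α)
  have : IsIso (T.c.hom t) := (m.tr.isIso_iff h.tr (T.c.hom t)).2 fun i =>
    (hT.compl_c t i).isIso_e h.gcgw (hT.zeroM i)
  exact (congrArg (fun z => IsIso z) e).mpr this

theorem gcgwHalf : T.GCGWHalf where
  c_equivalence := hT.c_equivalence h
  zero_initial := by
    choose f hf using fun A => m.exists_zero h (Z := T.zero) (A := A) hT.zeroM hT.zeroE
    exact ⟨Limits.IsInitial.ofUniqueHom (fun A => f A.obj) fun A g => hf A.obj g⟩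
  mono := m.mono h
  weakTriangles_le := hT.goodM ▸ m.weakTriangles_le h
  le_pullbackSquares := hT.goodM ▸ m.le_pullbackSquares h
  distinguished_iff α := ⟨(hT.tr h).isIso_sqMap h.tr _, hT.isIso_sqMap h α⟩
  cokernel_sq := hT.cokernel_sq h

/-- The pointwise isomorphisms are natural in m-morphisms because top sides of mixed squares are
unique, and in e-morphisms by the vertical form of (PBL). -/
theorem star_cokernel {A B A' P : X.Obj} {f : X.HomM A B} {g : X.HomM A A'} {p : X.HomM B P}
    {q : X.HomM A' P} (hs : IsStarPushout m.cubes f g p q) :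
    ∃ x : X.HomM (T.c.obj f) (T.c.obj q), IsIso x ∧ Mixed X x (T.c.hom f) (T.c.hom q) p := by
  have hx := fun i => h.star_mixed ((m.star_iff h).1 hs i) (hT.compl_c f i) (hT.compl_c q i)
  choose x hx hm using hx
  obtain ⟨y, hy⟩ := m.exists_of_isIso h x hx
    (fun {i j} k => h.gcgw.mixed_top_unique ((hm i).hcomp (m.mixedE (T.c.hom q) k))
      (((m.mixedE (T.c.hom f) k).hcomp (hm j)).congr rfl rfl rfl (m.goodM p k).1))
    (fun {i j} e => h.pbl_v (hm j) (((hm i).vcomp (m.mixedM p e)).congr rfl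
      (m.goodE (T.c.hom f) e).1.symm (m.goodE (T.c.hom q) e).1.symm))
  exact ⟨y, (m.isIso_iff h y).2 fun i => by rw [hy]; exact hx i,
    m.mixed_of_app fun i => (hm i).congr (hy i)⟩

theorem starHalf : T.StarHalf where
  good_symm := hT.goodM ▸ m.cubes_symm h
  star_exists f g := by
    rw [hT.goodM]
    rintro ⟨_, _, _, hg⟩
    obtain ⟨Q, p, q, hs⟩ := m.exists_star_of_good h hg
    exact ⟨Q, p, q, m.star_of_app h hs⟩
  star_cokernel f g p q := by
    rw [hT.goodM]
    intro hs
    exact ⟨hT.star_cokernel h hs, hT.star_cokernel h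
      ((m.star_iff h).2 fun i => h.star_symm ((m.star_iff h).1 hs i))⟩
  pullback_lemma f g a b d f' g' h₁ h₂ := m.mixed_of_app fun i =>
    h.pbl (m.mixed_app h₁ i) ((m.mixed_app h₂ i).congr (m.appM_comp f g i).symm rfl rfl
      (m.appM_comp f' g' i).symm)
  pushout_lemma := hT.goodM ▸ m.pushout_lemma h

end Pointwise

end Model

end PointwiseStructures

/-! ## Cokernels of natural transformations -/

section CokernelFunctors

variable {D : DoubleCat.{u', v₁', v₂', w'}} {C : DoubleCat.{u, v₁, v₂, w}}
  {S : GCGWData C} (h : S.StarAxioms) {F G F' G' : DoubleFunctor D C}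

/-- The m-morphism between cokernels of the components of a good m-natural transformation. -/
noncomputable def cokMapM (μ : MNatTrans F G) (hμ : μ.IsGood S.goodM) {i j : D.Obj}
    (k : D.HomM i j) : C.HomM (S.c.obj (μ.app i)) (S.c.obj (μ.app j)) :=
  ((compl_c S (μ.app i)).mixed_m h.gcgw (compl_c S (μ.app j)) (h.symm (hμ k))).choose

theorem mixed_cokMapM (μ : MNatTrans F G) (hμ : μ.IsGood S.goodM) {i j : D.Obj}
    (k : D.HomM i j) :
    Mixed C (cokMapM h μ hμ k) (S.c.hom (μ.app i)) (S.c.hom (μ.app j)) (G.mapM k) :=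
  ((compl_c S (μ.app i)).mixed_m h.gcgw (compl_c S (μ.app j)) (h.symm (hμ k))).choose_spec

/-- The pointwise cokernel of a good m-natural transformation. -/
noncomputable def cokFunctor (μ : MNatTrans F G) (hμ : μ.IsGood S.goodM) : DoubleFunctor D C :=
  DoubleFunctor.ofMixed h.gcgw.sq_subsingleton (fun i => S.c.obj (μ.app i))
    (fun k => cokMapM h μ hμ k) (fun e => S.c.sqMap (μ.sq e))
    -- Functoriality at m-morphisms comes from uniqueness of top sides, at e-morphisms from monicity
    -- of the cokernel inclusions; squares of `D` are carried over by (PBL).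
    (fun i => h.gcgw.mixed_top_unique (mixed_cokMapM h μ hμ (D.idM i))
      ((Mixed.id_m (S.c.hom (μ.app i))).congr rfl rfl rfl (G.mapM_id i)))
    (fun i => h.gcgw.cancel_e (S.c.hom (μ.app i)) (by
      rw [S.c.sqMap_comm, G.mapE_id, Category.comp_id, Category.id_comp]))
    (fun k k' => h.gcgw.mixed_top_unique (mixed_cokMapM h μ hμ (k ≫ k'))
      (((mixed_cokMapM h μ hμ k).hcomp (mixed_cokMapM h μ hμ k')).congr rfl rfl rfl
        (G.mapM_comp k k')))
    (fun {_ _ l} e e' => h.gcgw.cancel_e (S.c.hom (μ.app l)) (by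
      rw [S.c.sqMap_comm, G.mapE_comp, ← Category.assoc, ← S.c.sqMap_comm (μ.sq e)]
      exact (Category.assoc _ _ _).trans ((congrArg (fun z => S.c.sqMap (μ.sq e) ≫ z)
        (S.c.sqMap_comm (μ.sq e')).symm).trans (Category.assoc _ _ _).symm)))
    (fun {i j i' j' k e e' k'} α => h.pbl_v (mixed_cokMapM h μ hμ k')
      (((mixed_cokMapM h μ hμ k).vcomp (G.mixed α)).congr rfl (S.c.sqMap_comm (μ.sq e))
        (S.c.sqMap_comm (μ.sq e'))))

/-- The inclusion of the pointwise cokernel of a good m-natural transformation. -/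
noncomputable def cokHom (μ : MNatTrans F G) (hμ : μ.IsGood S.goodM) :
    ENatTrans (cokFunctor h μ hμ) G :=
  MNatTrans.ofMixed (D := D.tr) (C := C.tr) (F := (cokFunctor h μ hμ).tr) (G := G.tr)
    h.gcgw.tr.sq_subsingleton (fun i => S.c.hom (μ.app i))
    (fun e => S.c.sqMap_comm (μ.sq e)) (fun k => mixed_cokMapM h μ hμ k)

theorem cokHom_isGood (μ : MNatTrans F G) (hμ : μ.IsGood S.goodM) :
    MNatTrans.IsGood S.goodE (cokHom h μ hμ) :=
  fun e => h.tr.symm (C := C.tr) (S.good_sqMap (μ.sq e))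

/-- The e-natural transformation between pointwise cokernels induced by a modification. -/
noncomputable def cokMap (μ : MNatTrans F G) (hμ : μ.IsGood S.goodM) (μ' : MNatTrans F' G')
    (hμ' : μ'.IsGood S.goodM) (η : ENatTrans F F') (η' : ENatTrans G G')
    (α : ∀ i, C.Sq (μ.app i) (η.appE i) (η'.appE i) (μ'.app i)) :
    ENatTrans (cokFunctor h μ hμ) (cokFunctor h μ' hμ') :=
  MNatTrans.ofMixed (D := D.tr) (C := C.tr) (F := (cokFunctor h μ hμ).tr)
    (G := (cokFunctor h μ' hμ').tr) h.gcgw.tr.sq_subsingleton (fun i => S.c.sqMap (α i))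
    (fun {i j} e => h.gcgw.cancel_e (S.c.hom (μ'.app j)) (by
      have e₁ : G.mapE e ≫ η'.appE j = η'.appE i ≫ G'.mapE e := η'.naturality e
      have e₂ : S.c.sqMap (μ.sq e) ≫ S.c.sqMap (α j) ≫ S.c.hom (μ'.app j) =
          S.c.sqMap (α i) ≫ S.c.sqMap (μ'.sq e) ≫ S.c.hom (μ'.app j) := by
        rw [S.c.sqMap_comm, S.c.sqMap_comm, ← Category.assoc, ← Category.assoc, S.c.sqMap_comm,
          S.c.sqMap_comm, Category.assoc, Category.assoc, e₁]
      exact (Category.assoc _ _ _).trans (e₂.trans (Category.assoc _ _ _).symm)))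
    (fun {i j} k => h.pbl_v (mixed_cokMapM h μ' hμ' k)
      (((mixed_cokMapM h μ hμ k).vcomp ⟨η'.sqE k⟩).congr rfl (S.c.sqMap_comm (α i))
        (S.c.sqMap_comm (α j))))

/-- The naturality square, pasted with that of the inclusion for `μ'`, is the pasting of the one for
`μ` with that of `η'`; the pullback lemma cancels the former. -/
theorem cokMap_isGood (μ : MNatTrans F G) (hμ : μ.IsGood S.goodM) (μ' : MNatTrans F' G')
    (hμ' : μ'.IsGood S.goodM) (η : ENatTrans F F') (η' : ENatTrans G G')
    (hη' : MNatTrans.IsGood S.goodE η')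
    (α : ∀ i, C.Sq (μ.app i) (η.appE i) (η'.appE i) (μ'.app i)) :
    MNatTrans.IsGood S.goodE (cokMap h μ hμ μ' hμ' η η' α) := fun {i j} e =>
  h.tr.cancel (C := C.tr) (cokHom_isGood h μ' hμ' e) (((cokHom_isGood h μ hμ e).vcomp (hη' e)).congr
    rfl (S.c.sqMap_comm (α i)) (S.c.sqMap_comm (α j)))

-- In the transpose, the components of the modification are a mixed map from the naturality square
-- of `η` to that of `η'`. Its complement is a good cube, which is then turned to the required
-- direction.
include h in
theorem cokMap_cube (μ : MNatTrans F G) (μ' : MNatTrans F' G') (η : ENatTrans F F')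
    (hη : MNatTrans.IsGood S.goodE η) (η' : ENatTrans G G') (hη' : MNatTrans.IsGood S.goodE η')
    (α : ∀ i, C.Sq (μ.app i) (η.appE i) (η'.appE i) (μ'.app i)) {i j : D.Obj} (e : D.HomE i j) :
    IsGoodCube S.goodE (S.c.hom (μ.app i)) (S.c.sqMap (α i)) (η'.appE i) (S.c.hom (μ'.app i))
      (S.c.hom (μ.app j)) (S.c.sqMap (α j)) (η'.appE j) (S.c.hom (μ'.app j))
      (S.c.sqMap (μ.sq e)) (G.mapE e) (S.c.sqMap (μ'.sq e)) (G'.mapE e) := by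
  have hc := h.tr.cube_of_mixed (C := C.tr) (hη e) (hη' e) (Mixed.tr ⟨μ.sq e⟩) (Mixed.tr ⟨α j⟩)
    (Mixed.tr ⟨μ'.sq e⟩) ((compl_c S (μ.app j)).tr h.gcgw) ((compl_c S (μ'.app i)).tr h.gcgw)
    ((compl_c S (μ'.app j)).tr h.gcgw) (S.good_sqMap (μ.sq e)) (S.good_sqMap (α i))
    (S.good_sqMap (α j)) (S.good_sqMap (μ'.sq e))
  exact h.tr.cube_rotate (h.tr.cube_symm (h.tr.cube_rotate hc))

end CokernelFunctors

/-! ## The ★-CGW structure on `C^D` -/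

section FunctorStructure

variable {C : DoubleCat.{u, v₁, v₂, w}} (S : StarCGW C) (D : DoubleCat.{u', v₁', v₂', w'})

namespace functorDoubleCat

/-- `C^D` as a model of itself. -/
def model : Model (X := functorDoubleCat S D) S.toGCGWData D (fun F => F) where
  appM := appM
  appE := appE
  appM_id _ _ := rfl
  appE_id _ _ := rfl
  appM_comp _ _ _ := rfl
  appE_comp _ _ _ := rfl
  extM hfg := Subtype.ext (MNatTrans.ext_app S.gcgw.sq_subsingleton hfg)
  extE hfg := Subtype.ext (MNatTrans.ext_app S.gcgw.tr.sq_subsingleton hfg)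
  goodM f _ _ k := f.2 k
  goodE f _ _ e := f.2 e
  mixedM f _ _ e := ⟨MNatTrans.sq f.1 e⟩
  mixedE f _ _ k := ⟨MNatTrans.sq f.1 k⟩
  liftM x hg hm := ⟨⟨MNatTrans.ofMixed S.gcgw.sq_subsingleton x (fun k => (hg k).1.symm) hm, hg⟩,
    fun _ => rfl⟩
  liftE {A B} x hg hm := ⟨⟨MNatTrans.ofMixed (D := D.tr) (C := C.tr) (F := DoubleFunctor.tr A)
    (G := DoubleFunctor.tr B) S.gcgw.tr.sq_subsingleton x (fun e => (hg e).1.symm) hm, hg⟩,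
    fun _ => rfl⟩
  mixed_app := fun ⟨α⟩ i => ⟨appSq α i⟩
  mixed_of_app hm := ⟨Modification.ofApp S.gcgw.sq_subsingleton fun i => (hm i).some⟩
  sq_sub f a b f' := Modification.subsingleton S.gcgw.sq_subsingleton f.1 a.1 b.1 f'.1
  surj F := ⟨F, rfl⟩

/-- The constant double functor at the initial object. -/
noncomputable def zero : DoubleFunctor D C :=
  DoubleFunctor.ofMixed S.gcgw.sq_subsingleton (fun _ => S.zero) (fun _ => C.idM _)
    (fun _ => C.idE _) (fun _ => rfl) (fun _ => rfl) (fun _ _ => (Category.comp_id _).symm)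
    (fun _ _ => (Category.comp_id _).symm) (fun _ => Mixed.id_m _)

/-- The pointwise functor `c`. -/
noncomputable def cokernelData :
    CokernelData (functorDoubleCat S D) (model S D).tr.cubes where
  obj μ := cokFunctor S.starAxioms μ.1 μ.2
  hom μ := ⟨cokHom S.starAxioms μ.1 μ.2, cokHom_isGood S.starAxioms μ.1 μ.2⟩
  sqMap {_ _ _ _ μ η η' μ'} α :=
    ⟨cokMap S.starAxioms μ.1 μ.2 μ'.1 μ'.2 η.1 η'.1 (Modification.app α),
      cokMap_isGood S.starAxioms μ.1 μ.2 μ'.1 μ'.2 η.1 η'.1 η'.2 (Modification.app α)⟩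
  sqMap_comm α := (model S D).extE fun i => S.c.sqMap_comm (Modification.app α i)
  sqMap_good {_ _ _ _ μ η η' μ'} α := fun {_ _} e =>
    cokMap_cube S.starAxioms μ.1 μ'.1 η.1 η.2 η'.1 η'.2 (Modification.app α) e
  sqMap_id μ := (model S D).extE fun i => S.c.sqMap_id (MNatTrans.app μ.1 i)
  sqMap_comp α β := (model S D).extE fun i =>
    S.c.sqMap_comp (Modification.app α i) (Modification.app β i)

/-- The pointwise functor `k`. -/
noncomputable def kernelData :
    CokernelData (functorDoubleCat S D).tr (model S D).cubes where
  obj η := (cokFunctor S.starAxioms.tr η.1 η.2).tr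
  hom η := ⟨cokHom S.starAxioms.tr η.1 η.2, cokHom_isGood S.starAxioms.tr η.1 η.2⟩
  sqMap {_ _ _ _ η μ μ' η'} α :=
    ⟨cokMap S.starAxioms.tr η.1 η.2 η'.1 η'.2 μ.1 μ'.1 (appSq (μ := μ) (η := η) (η' := η') (μ' := μ') α),
      cokMap_isGood S.starAxioms.tr η.1 η.2 η'.1 η'.2 μ.1 μ'.1 μ'.2 (appSq (μ := μ) (η := η) (η' := η') (μ' := μ') α)⟩
  sqMap_comm {_ _ _ _ η μ μ' η'} α := (model S D).extM fun i => S.k.sqMap_comm (appSq (μ := μ) (η := η) (η' := η') (μ' := μ') α i)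
  sqMap_good {_ _ _ _ η μ μ' η'} α := fun {_ _} e =>
    cokMap_cube (D := D.tr) (C := C.tr) S.starAxioms.tr η.1 η'.1 μ.1 μ.2 μ'.1 μ'.2 (appSq (μ := μ) (η := η) (η' := η') (μ' := μ') α) e
  sqMap_id η := (model S D).extM fun i => S.k.sqMap_id (MNatTrans.app η.1 i)
  sqMap_comp α β := (model S D).extM fun i =>
    S.k.sqMap_comp (Modification.app α i) (Modification.app β i)

/-- The pointwise data of a g-CGW category on `C^D`. -/
noncomputable def gcgwData : GCGWData (functorDoubleCat S D) where
  isos := (model S D).isos S.starAxioms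
  zero := zero S D
  goodM := (model S D).cubes
  goodE := (model S D).tr.cubes
  goodM_mult := (model S D).cubes_mult S.starAxioms
  goodE_mult := (model S D).tr.cubes_mult S.starAxioms.tr
  c := cokernelData S D
  k := kernelData S D

theorem pointwise : (model S D).Pointwise (gcgwData S D) where
  goodM := rfl
  goodE := rfl
  zeroM _ := S.gcgw.m.zero_initial
  zeroE _ := S.gcgw.e.zero_initial
  compl_c μ i := compl_c S.toGCGWData (appM μ i)
  compl_k η i := compl_k S.gcgw (appE η i)

/-- The pointwise ★-CGW structure on `C^D`. -/
noncomputable def starCGW : StarCGW (functorDoubleCat S D) where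
  toGCGWData := gcgwData S D
  gcgw := ⟨(pointwise S D).gcgwHalf S.starAxioms,
    ((pointwise S D).tr S.starAxioms).gcgwHalf S.starAxioms.tr⟩
  star_m := (pointwise S D).starHalf S.starAxioms
  star_e := ((pointwise S D).tr S.starAxioms).starHalf S.starAxioms.tr
  pushout_exists := (model S D).exists_good S.starAxioms S.pushout_exists

end functorDoubleCat

end FunctorStructure

end CGW

/-! ### The theorem for `C^D` -/

open CGW CGW.functorDoubleCat in
theorem mainTheorem8 (C : DoubleCat) (S : StarCGW C) (D : DoubleCat) :
    ∃ T : StarCGW (functorDoubleCat S D),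
      -- the good squares of m-morphisms, and of e-morphisms, are those given by good cubes
      (∀ {F G H K : DoubleFunctor D C}
        (f : (functorDoubleCat S D).HomM F G) (g : (functorDoubleCat S D).HomM F H)
        (p : (functorDoubleCat S D).HomM G K) (q : (functorDoubleCat S D).HomM H K),
        g ≫ q = f ≫ p →
        (GoodSq T.goodM f g p q ↔ ∀ {i j : D.Obj} (m : D.HomM i j),
          IsGoodCube S.goodM (appM f i) (appM g i) (appM p i) (appM q i)
            (appM f j) (appM g j) (appM p j) (appM q j)
            (F.mapM m) (G.mapM m) (H.mapM m) (K.mapM m))) ∧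
      (∀ {F G H K : DoubleFunctor D C}
        (f : (functorDoubleCat S D).HomE F G) (g : (functorDoubleCat S D).HomE F H)
        (p : (functorDoubleCat S D).HomE G K) (q : (functorDoubleCat S D).HomE H K),
        g ≫ q = f ≫ p →
        (GoodSq T.goodE f g p q ↔ ∀ {i j : D.Obj} (e : D.HomE i j),
          IsGoodCube S.goodE (appE f i) (appE g i) (appE p i) (appE q i)
            (appE f j) (appE g j) (appE p j) (appE q j)
            (F.mapE e) (G.mapE e) (H.mapE e) (K.mapE e))) ∧
      -- the functor `k` is pointwise, on objects and on morphisms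
      (∀ {F G : DoubleFunctor D C} (η : (functorDoubleCat S D).HomE F G) (i : D.Obj),
        DoubleFunctor.obj (T.kerObj η) i = S.kerObj (appE η i) ∧
        HEq (appM (T.kerHom η) i) (S.kerHom (appE η i))) ∧
      (∀ {F G F' G' : DoubleFunctor D C} {μ : (functorDoubleCat S D).HomM F G}
        {η : (functorDoubleCat S D).HomE F F'} {η' : (functorDoubleCat S D).HomE G G'}
        {μ' : (functorDoubleCat S D).HomM F' G'} (α : (functorDoubleCat S D).Sq μ η η' μ')
        (i : D.Obj), HEq (appM (T.kerMap α) i) (S.kerMap (appSq α i))) ∧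
      -- the functor `c` is pointwise, on objects and on morphisms
      (∀ {F G : DoubleFunctor D C} (μ : (functorDoubleCat S D).HomM F G) (i : D.Obj),
        DoubleFunctor.obj (T.c.obj μ) i = S.c.obj (appM μ i) ∧
        HEq (appE (T.c.hom μ) i) (S.c.hom (appM μ i))) ∧
      (∀ {F G F' G' : DoubleFunctor D C} {μ : (functorDoubleCat S D).HomM F G}
        {η : (functorDoubleCat S D).HomE F F'} {η' : (functorDoubleCat S D).HomE G G'}
        {μ' : (functorDoubleCat S D).HomM F' G'} (α : (functorDoubleCat S D).Sq μ η η' μ')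
        (i : D.Obj), HEq (appE (T.c.sqMap α) i) (S.c.sqMap (appSq α i))) ∧
      -- ★-pushouts, of m-spans and of e-spans, are pointwise
      (∀ {F G H K : DoubleFunctor D C}
        (f : (functorDoubleCat S D).HomM F G) (g : (functorDoubleCat S D).HomM F H)
        (p : (functorDoubleCat S D).HomM G K) (q : (functorDoubleCat S D).HomM H K),
        IsStarPushout T.goodM f g p q ↔
          ∀ i : D.Obj, IsStarPushout S.goodM (appM f i) (appM g i) (appM p i) (appM q i)) ∧
      (∀ {F G H K : DoubleFunctor D C}
        (f : (functorDoubleCat S D).HomE F G) (g : (functorDoubleCat S D).HomE F H)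
        (p : (functorDoubleCat S D).HomE G K) (q : (functorDoubleCat S D).HomE H K),
        IsStarPushout T.goodE f g p q ↔
          ∀ i : D.Obj, IsStarPushout S.goodE (appE f i) (appE g i) (appE p i) (appE q i)) ∧
      -- shared isomorphisms are pointwise
      (∀ {F G : DoubleFunctor D C} (μ : (functorDoubleCat S D).IsoM F G) (i : D.Obj)
        (e : C.IsoM (F.obj i) (G.obj i)), e.hom = appM μ.hom i →
        appE (T.isos.equiv μ).hom i = (S.isos.equiv e).hom) := by
  exact ⟨starCGW S D,
    fun f g p q _ => (model S D).good_iff,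
    fun f g p q _ => (model S D).tr.good_iff,
    fun _ _ => ⟨rfl, HEq.rfl⟩,
    fun _ _ => HEq.rfl,
    fun _ _ => ⟨rfl, HEq.rfl⟩,
    fun _ _ => HEq.rfl,
    fun f g p q => (model S D).star_iff S.starAxioms,
    fun f g p q => (model S D).tr.star_iff S.starAxioms.tr,
    fun μ i e he => by
      -- An isomorphism is determined by its underlying morphism, so `e` is the component of `μ` at
      -- `i`.
      obtain rfl : e = (model S D).isoAt μ i := Iso.ext he
      exact (model S D).appE_isoE S.starAxioms μ i⟩
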